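/- **Setting.** Let $u,v,w$ be complex coordinates, $O=(0,0,0)$, $W_0=\{w=0\}$, $U_0=\{u=0\}$, $I=\{u=w=0\}$. The unknowns are 24 formal power series in $(u,v,w)$ over $\mathbb C$: $\hat e^a{}_{01},\hat e^a{}_{11}$ ($a=1,2$), $\hat\Gamma_{0100},\hat\Gamma_{0101},\hat\Gamma_{0111},\hat\Gamma_{1100},\hat\Gamma_{1101},\hat\Gamma_{1111}$, $\phi$, $\phi_{00},\phi_{01},\phi_{11}$, $\Omega$, $\Omega_{00},\Omega_{01},\Omega_{11}$, $R$, $S_0,\dots,S_4$ (all other components $\hat e^a{}_{AB}$, $\hat\Gamma_{ABCD}$ vanish or follow from $\hat e^a{}_{AB}=\hat e^a{}_{(AB)}$, $\hat\Gamma_{ABCD}=\hat\Gamma_{(AB)(CD)}$). Put $\kappa=(1+\Omega-\phi^2)^{-1}$, $\lambda_{AB}=\phi\Omega_{AB}-2(1+\Omega)\phi_{AB}$, $\Delta_\Omega=\Omega_{00}\Omega_{11}-\Omega_{01}^2$, $\Delta_\phi=\phi_{00}\phi_{11}-\phi_{01}^2$, $X=\Omega_{00}\phi_{11}-2\Omega_{01}\phi_{01}+\Omega_{11}\phi_{00}$,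 $\langle\Omega,S\rangle_{k}=\Omega_{11}S_k-2\Omega_{01}S_{k+1}+\Omega_{00}S_{k+2}$, $\langle\phi,S\rangle_{k}=\phi_{11}S_k-2\phi_{01}S_{k+1}+\phi_{00}S_{k+2}$, $h=\tfrac12[1+(-1+\Omega)\phi^2]$, $W=\Omega_{00}\phi_{01}-\Omega_{01}\phi_{00}$, $\hat e_{01}f=\hat e^1{}_{01}\partial_uf+\hat e^2{}_{01}\partial_vf$, $e_{11}f=\partial_wf+\hat e^1{}_{11}\partial_uf+\hat e^2{}_{11}\partial_vf$, $E_1=\tfrac1{2u}(\partial_v\phi_{01}-\phi_{11})+\hat e_{01}\phi_{01}$, $E_2=\tfrac1{2u}\partial_v\phi_{11}+\hat e_{01}\phi_{11}$, and $$\begin{aligned}Q_{AB}={}&\tfrac14\phi^2[-6+(20+3\Omega)\phi^2]\Delta_\Omega\Omega_{AB}-\tfrac12(14+23\Omega+3\Omega^2)\phi^3X\Omega_{AB}\\&+(1+\Omega)[6(1+\Omega)+(8+23\Omega+3\Omega^2)\phi^2]\Delta_\phi\Omega_{AB}\\&-\tfrac12\phi[-12(1+\Omega)+(26+23\Omega+3\Omega^2)\phi^2]\Delta_\Omega\phi_{AB}\\&+(1+\Omega)^2[-6+(20+3\Omega)\phi^2]X\phi_{AB}-2(1+\Omega)^2(7+\Omega)(2+3\Omega)\phi\Delta_\phi\phi_{AB}.\end{aligned}$$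 Equations containing $1/u$ are understood as identities of power series after multiplication by $u$. **(a) $A_{00}=0$ and the $\partial_u$-equations.** $\partial_u\phi=\phi_{00}$, $\partial_u\Omega=\Omega_{00}$; $\partial_u\hat e^1{}_{01}+\tfrac1u\hat e^1{}_{01}=-2\hat\Gamma_{0101}+2\hat\Gamma_{0100}\hat e^1{}_{01}$, $\partial_u\hat e^2{}_{01}+\tfrac1u\hat e^2{}_{01}=\tfrac1u\hat\Gamma_{0100}+2\hat\Gamma_{0100}\hat e^2{}_{01}$, $\partial_u\hat e^1{}_{11}=-2\hat\Gamma_{1101}+2\hat\Gamma_{1100}\hat e^1{}_{01}$, $\partial_u\hat e^2{}_{11}=\tfrac1u\hat\Gamma_{1100}+2\hat\Gamma_{1100}\hat e^2{}_{01}$; $\partial_u\hat\Gamma_{0100}+\tfrac2u\hat\Gamma_{0100}-2\hat\Gamma_{0100}^2=\tfrac12S_0$, $\partial_u\hat\Gamma_{0101}+\tfrac1u\hat\Gamma_{0101}-2\hat\Gamma_{0100}\hat\Gamma_{0101}=\tfrac12S_1$, $\partial_u\hat\Gamma_{0111}+\tfrac1u\hat\Gamma_{0111}-2\hat\Gamma_{0100}\hat\Gamma_{0111}=\tfrac12S_2-\tfrac1{12}R$,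 $\partial_u\hat\Gamma_{1100}+\tfrac1u\hat\Gamma_{1100}-2\hat\Gamma_{0100}\hat\Gamma_{1100}=S_1$, $\partial_u\hat\Gamma_{1101}-2\hat\Gamma_{1100}\hat\Gamma_{0101}=S_2+\tfrac1{12}R$, $\partial_u\hat\Gamma_{1111}-2\hat\Gamma_{1100}\hat\Gamma_{0111}=S_3$; $$\partial_u\phi_{01}=\tfrac1{2u}(\partial_v\phi_{00}-2\phi_{01})+\hat e_{01}\phi_{00}-2\hat\Gamma_{0101}\phi_{00}+2\hat\Gamma_{0100}\phi_{01},$$ $$\begin{aligned}\partial_u\phi_{11}-E_1={}&-\hat\Gamma_{0111}\phi_{00}+\hat\Gamma_{0100}\phi_{11}-\tfrac14\phi\big\{R+10\kappa\big[\tfrac12\phi^2\Omega_{00}\Omega_{11}-\tfrac12\lambda_{01}^2\\&-(1+\Omega)\phi(\Omega_{00}\phi_{11}+\Omega_{11}\phi_{00})+2(1+\Omega)^2\phi_{00}\phi_{11}\big]\big\},\end{aligned}$$ $$\partial_u\Omega_{00}=-\Omega S_0+\kappa\{h\Omega_{00}^2-2\Omega^2\phi\Omega_{00}\phi_{00}+2\Omega^2(1+\Omega)\phi_{00}^2\},$$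 $$\partial_u\Omega_{01}=-\Omega S_1+\kappa\{h\Omega_{00}\Omega_{01}-\Omega^2\phi(\Omega_{00}\phi_{01}+\Omega_{01}\phi_{00})+2\Omega^2(1+\Omega)\phi_{00}\phi_{01}\},$$ $$\begin{aligned}\partial_u\Omega_{11}={}&-\Omega S_2-\tfrac13(1+\Omega)R+\tfrac13\kappa\{\tfrac12[3-(11+9\Omega)\phi^2]\Omega_{00}\Omega_{11}+2(2+3\Omega)\lambda_{01}^2\\&+(8+20\Omega+9\Omega^2)[\phi(\Omega_{00}\phi_{11}+\Omega_{11}\phi_{00})-2(1+\Omega)\phi_{00}\phi_{11}]\},\end{aligned}$$ $$\begin{aligned}&\partial_uR-\kappa\{2(4+7\Omega)\phi(\Omega_{11}\partial_u\phi_{00}-2\Omega_{01}\partial_u\phi_{01}+\Omega_{00}\partial_u\phi_{11})\\&\quad-4(1+\Omega)(4+7\Omega)(\phi_{11}\partial_u\phi_{00}-2\phi_{01}\partial_u\phi_{01}+\phi_{00}\partial_u\phi_{11})\}\\&=\kappa\{[3+(-3+7\Omega)\phi^2]\,\langle\Omega,S\rangle_{0}-2\Omega(4+7\Omega)\phi\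,\langle\phi,S\rangle_{0}+\tfrac13(4+7\Omega)\phi\lambda_{00}R\}\\&\quad+\tfrac13\kappa^2\{\phi^2[-12+(40+21\Omega)\phi^2]\Delta_\Omega\Omega_{00}-2\phi[-18(1+\Omega)+(46+61\Omega+21\Omega^2)\phi^2]X\Omega_{00}\\&\quad+4(1+\Omega)[-24(1+\Omega)+(52+61\Omega+21\Omega^2)\phi^2]\Delta_\phi\Omega_{00}-2\phi[12(1+\Omega)+(16+61\Omega+21\Omega^2)\phi^2]\Delta_\Omega\phi_{00}\\&\quad+4(1+\Omega)[6(1+\Omega)+(22+61\Omega+21\Omega^2)\phi^2]X\phi_{00}-8(1+\Omega)^2(7+3\Omega)(4+7\Omega)\phi\Delta_\phi\phi_{00}\},\end{aligned}$$ $$\begin{aligned}&\partial_uS_1-\tfrac1{2u}(\partial_vS_0-4S_1)-\hat e_{01}S_0+\kappa\{\Omega\lambda_{01}\partial_u\phi_{00}-\Omega\lambda_{00}\partial_u\phi_{01}\}\\&=-4\hat\Gamma_{0101}S_0+4\hat\Gamma_{0100}S_1-\kappa\{h(\Omega_{01}S_0-\Omega_{00}S_1)-\Omega^2\phi(\phi_{01}S_0-\phi_{00}S_1)+2\lambda_{00}W\},\end{aligned}$$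 $$\begin{aligned}&\partial_uS_2-\tfrac1{2u}(\partial_vS_1-3S_2)-\hat e_{01}S_1+\tfrac13\kappa\{-(1+\Omega)\lambda_{11}\partial_u\phi_{00}+(2+5\Omega)\lambda_{01}\partial_u\phi_{01}\\&\quad-(1+2\Omega)\lambda_{00}\partial_u\phi_{11}-2\Omega\lambda_{00}E_1\}\\&=-\hat\Gamma_{0111}S_0-2\hat\Gamma_{0101}S_1+3\hat\Gamma_{0100}S_2-\kappa\{\tfrac23\Omega\lambda_{00}(\hat\Gamma_{0111}\phi_{00}-\hat\Gamma_{0100}\phi_{11})+h(\Omega_{01}S_1-\Omega_{00}S_2)\\&\quad-\Omega^2\phi(\phi_{01}S_1-\phi_{00}S_2)-\tfrac16\Omega\phi^2\,\langle\Omega,S\rangle_{0}+\tfrac13\Omega(1+\Omega)\phi\,\langle\phi,S\rangle_{0}-\tfrac1{18}(1+\Omega)\phi\lambda_{00}R+2\lambda_{01}W\}+\tfrac19\kappa^2Q_{00},\end{aligned}$$ $$\begin{aligned}&\partial_uS_3-\tfrac1{2u}(\partial_vS_2-2S_3)-\hat e_{01}S_2+\tfrac13\kappa\{-2(1+\Om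ega)\lambda_{11}\partial_u\phi_{01}+\Omega\lambda_{01}\partial_u\phi_{11}\\&\quad+2(2+3\Omega)\lambda_{01}E_1-(2+5\Omega)\lambda_{00}E_2\}\\&=-2\hat\Gamma_{0111}S_1+2\hat\Gamma_{0100}S_3-\kappa\{-\tfrac23(2+3\Omega)\lambda_{01}(\hat\Gamma_{0111}\phi_{00}-\hat\Gamma_{0100}\phi_{11})+\tfrac23(2+5\Omega)\lambda_{00}(\hat\Gamma_{0111}\phi_{01}-\hat\Gamma_{0101}\phi_{11})\\&\quad+h(\Omega_{01}S_2-\Omega_{00}S_3)-\Omega^2\phi(\phi_{01}S_2-\phi_{00}S_3)-\tfrac13\Omega\phi^2\,\langle\Omega,S\rangle_{1}+\tfrac23\Omega(1+\Omega)\phi\,\langle\phi,S\rangle_{1}\\&\quad-\tfrac19(1+\Omega)\phi\lambda_{01}R+2\lambda_{11}W\}+\tfrac29\kappa^2Q_{01},\end{aligned}$$ $$\begin{aligned}&\partial_uS_4-\tfrac1{2u}(\partial_vS_3-S_4)-\hat e_{01}S_3+\kappa\{-(1+\Omega)\lambda_{11}\partial_u\phi_{11}+(2+3\Omega)\lamb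da_{01}E_2-(1+2\Omega)\lambda_{00}\,e_{11}\phi_{11}\}\\&=-3\hat\Gamma_{0111}S_2+2\hat\Gamma_{0101}S_3+\hat\Gamma_{0100}S_4+\kappa\{2(2+3\Omega)\lambda_{01}(\hat\Gamma_{0111}\phi_{01}-\hat\Gamma_{0101}\phi_{11})\\&\quad-2(1+2\Omega)\lambda_{00}(\hat\Gamma_{1111}\phi_{01}-\hat\Gamma_{1101}\phi_{11})-h(\Omega_{01}S_3-\Omega_{00}S_4)+\Omega^2\phi(\phi_{01}S_3-\phi_{00}S_4)\\&\quad+\tfrac12\Omega\phi^2\,\langle\Omega,S\rangle_{2}-\Omega(1+\Omega)\phi\,\langle\phi,S\rangle_{2}+\tfrac16(1+\Omega)\phi\lambda_{11}R-2\phi[\Omega_{11}(\Omega_{01}\phi_{01}-\Omega_{11}\phi_{00})+\phi_{11}\Delta_\Omega]\\&\quad-4(1+\Omega)[\phi_{11}(\Omega_{01}\phi_{01}-\Omega_{00}\phi_{11})+\Omega_{11}\Delta_\phi]\}+\tfrac13\kappa^2Q_{11}.\end{aligned}$$ **(b) The $\partial_w$-equations.** $e_{11}\phi=\phi_{11}$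 and $$\begin{aligned}&e_{11}S_0-\partial_uS_2-\tfrac13\kappa\{(2+5\Omega)\lambda_{11}\partial_u\phi_{00}-4(1+\Omega)\lambda_{01}\partial_u\phi_{01}+(2+\Omega)\lambda_{00}\partial_u\phi_{11}-2\Omega\lambda_{00}E_1\}\\&=4\hat\Gamma_{1101}S_0-4\hat\Gamma_{1100}S_1+\kappa\{\tfrac23\Omega\lambda_{00}(\hat\Gamma_{0111}\phi_{00}-\hat\Gamma_{0100}\phi_{11})+h(\Omega_{11}S_0-\Omega_{00}S_2)-\Omega^2\phi(\phi_{11}S_0-\phi_{00}S_2)\\&\quad+\tfrac13\Omega\phi^2\,\langle\Omega,S\rangle_{0}-\tfrac23\Omega(1+\Omega)\phi\,\langle\phi,S\rangle_{0}+\tfrac19(1+\Omega)\phi\lambda_{00}R+2\lambda_{00}(\Omega_{00}\phi_{11}-\Omega_{11}\phi_{00})\}+\tfrac29\kappa^2Q_{00}.\end{aligned}$$ **(c) Initial conditions.** On $U_0$: all $\hat e^a{}_{AB}=0$, all $\hat\Gamma_{ABCD}=0$, $\phi_{01}=\tfrac12\partial_u\partial_v\phi$, $\phi_{11}=\tfrac12\partial_u\partial_v^2\phi$,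 $S_k=\tfrac{(4-k)!}{4!}\partial_v^kS_0$ ($k=1,\dots,4$), $\Omega=\Omega_{01}=\Omega_{11}=0$, $$\partial_w\Omega_{00}=-\tfrac13R+\tfrac8{3(1-\phi^2)}(\phi\Omega_{00}\phi_{11}-2\phi_{00}\phi_{11}+2\phi_{01}^2),$$ $$\begin{aligned}\partial_wR={}&3\Omega_{00}S_4+\tfrac8{1-\phi^2}\{(\phi\Omega_{00}-2\phi_{00})\partial_w\phi_{11}+4\phi_{01}\partial_w\phi_{01}-2\phi_{11}\partial_w\phi_{00}-\tfrac13\phi R\phi_{11}\}\\&+\tfrac8{3(1-\phi^2)^2}\phi_{11}\{(3+11\phi^2)\Omega_{00}\phi_{11}-28\phi\Delta_\phi\};\end{aligned}$$ on $I$: $\Omega_{00}=0$ and $R=-6-8\,\partial_u\phi\,\partial_u\partial_v^2\phi+4(\partial_u\partial_v\phi)^2$. **Lemma.** Let $\phi(u,v)$, $S_0(u,v)$ be holomorphic on an open neighbourhood of the origin in $W_0\cong\mathbb C^2$, with $\phi(0,0)=0$ and with expansions at the origin $$\phi=\sum_{m\ge0}\sum_{n=0}^{2m}\psi_{m,n}u^mv^n,\qquad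 S_0=\sum_{m\ge0}\sum_{n=0}^{2m+4}\Psi_{m,n}u^mv^n.$$ Suppose that for some positive constants $\tilde c_\phi,r_\phi,\tilde c_{S_0},r_{S_0}$ and some $0<\rho_\phi,\rho_{S_0}<\tfrac13$ $$|\partial_u^m\partial_v^n\phi(0,0)|\le\tilde c_\phi\frac{r_\phi^{m-1}m!\,\rho_\phi^nn!}{(m+1)^2(n+1)^2}\quad(m\ge 0,\ 0\le n\le2m),$$ $$|\partial_u^m\partial_v^nS_0(0,0)|\le\tilde c_{S_0}\frac{r_{S_0}^mm!\,\rho_{S_0}^nn!}{(m+1)^2(n+1)^2}\quad(m\ge 0,\ 0\le n\le2m+4).$$ Then there is exactly one family of 24 formal power series satisfying (a), (b), (c) whose members $\phi$ and $S_0$ restrict to the given $\phi(u,v)$ and $S_0(u,v)$ at $w=0$. Moreover there are positive constants $r,\rho$ and $c_f$, one for each of the 24 unknowns $f$, such that for all $m,n,p\ge0$ and all $f$ $$|\partial_u^m\partial_v^n\partial_w^pf(O)|\le c_f\frac{r^{m+p+q_f}(m+p)!\,\rho^nn!}{(m+1)^2(n+1)^2(p+1)^2},$$ where $q_f=-1$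 for $f=\hat e^a{}_{AB},\hat\Gamma_{ABCD},\phi,\Omega,\Omega_{AB}$ and $q_f=0$ for $f=\phi_{AB},R,S_k$. Consequently the formal solution converges: for every $0<\alpha\le1$ the Taylor series of each $f$ converges absolutely wherever $|v|<\tfrac1{\alpha\rho}$ and $|u|+|w|<\tfrac{\alpha^2}r$. -/

import Mathlib

open scoped Topology

noncomputable section

namespace NullCone

/-- Formal power series in the three coordinates `u`, `v`, `w` (indexed by `0`, `1`, `2`). -/
abbrev Ser : Type := MvPowerSeries (Fin 3) ℂ

/-- The coordinate `u`, as a formal power series. -/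
def uu : Ser := MvPowerSeries.X 0

/-- The formal derivatives `∂_u`, `∂_v`, `∂_w`. -/
def du (f : Ser) : Ser := MvPowerSeries.pderiv ℂ 0 f
def dv (f : Ser) : Ser := MvPowerSeries.pderiv ℂ 1 f
def dw (f : Ser) : Ser := MvPowerSeries.pderiv ℂ 2 f

/-- The exponent of the monomial `u ^ m * v ^ n * w ^ p`. -/
def expo (m n p : ℕ) : Fin 3 →₀ ℕ :=
  Finsupp.single 0 m + Finsupp.single 1 n + Finsupp.single 2 p

/-- The coefficient of `u ^ m * v ^ n * w ^ p`. -/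
def coef (f : Ser) (m n p : ℕ) : ℂ := MvPowerSeries.coeff (expo m n p) f

/-- The expansion coefficient `∂_u ^ m ∂_v ^ n ∂_w ^ p f (O)`: the constant term of the iterated
formal derivative. -/
def derivAt (f : Ser) (m n p : ℕ) : ℂ :=
  MvPowerSeries.constantCoeff (du^[m] (dv^[n] (dw^[p] f)))

/-- Equality on `U₀ = {u = 0}`. -/
def EqOnU0 (f g : Ser) : Prop := ∀ n p : ℕ, coef f 0 n p = coef g 0 n p

/-- Equality on `I = {u = 0, w = 0}`. -/
def EqOnI (f g : Ser) : Prop := ∀ n : ℕ, coef f 0 n 0 = coef g 0 n 0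

/-- The mixed derivative `∂_u ^ m ∂_v ^ n g (0, 0)` of a function of two complex variables. -/
def derivAt2 (g : ℂ × ℂ → ℂ) (m n : ℕ) : ℂ :=
  iteratedDeriv m (fun u => iteratedDeriv n (fun v => g (u, v)) 0) 0

/-- The unknowns.  `e1_AB`, `e2_AB` are the regular parts `ê^1_AB`, `ê^2_AB` of the frame
coefficients, `G_ABCD` the regular parts of the connection coefficients.  The components which are
not listed (`ê^a_00`, `ê^3_AB` and `Γ̂_00AB`) vanish identically in the gauge considered, and the
others follow from the symmetries `φ_AB = φ_BA`, `Ω_AB = Ω_BA`, `Γ̂_ABCD = Γ̂_(AB)(CD)`. -/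
inductive Unknown : Type
  | e1_01 | e2_01 | e1_11 | e2_11
  | G_0100 | G_0101 | G_0111 | G_1100 | G_1101 | G_1111
  | phi | phi_00 | phi_01 | phi_11
  | Om | Om_00 | Om_01 | Om_11
  | R
  | S_0 | S_1 | S_2 | S_3 | S_4

/-- The integers `q_f`: `-1` for the frame and connection coefficients, `φ`, `Ω` and `Ω_AB`, and `0`
for `φ_AB`, `R` and `S_k`. -/
def Unknown.q : Unknown → ℤ
  | .phi_00 | .phi_01 | .phi_11 | .R | .S_0 | .S_1 | .S_2 | .S_3 | .S_4 => 0
  | _ => -1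

variable (F : Unknown → Ser)

/-! ### Expressions that recur in the field equations -/

/-- `1 / (1 + Ω - φ²)`. -/
def kap : Ser := (1 + F .Om - F .phi ^ 2)⁻¹

/-- `φ Ω_AB - 2 (1 + Ω) φ_AB`. -/
def lam00 : Ser := F .phi * F .Om_00 - 2 * (1 + F .Om) * F .phi_00
def lam01 : Ser := F .phi * F .Om_01 - 2 * (1 + F .Om) * F .phi_01
def lam11 : Ser := F .phi * F .Om_11 - 2 * (1 + F .Om) * F .phi_11

/-- `Ω_00 Ω_11 - Ω_01²`. -/
def detOm : Ser := F .Om_00 * F .Om_11 - F .Om_01 ^ 2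

/-- `φ_00 φ_11 - φ_01²`. -/
def detPhi : Ser := F .phi_00 * F .phi_11 - F .phi_01 ^ 2

/-- `Ω_00 φ_11 - 2 Ω_01 φ_01 + Ω_11 φ_00`. -/
def mixed : Ser := F .Om_00 * F .phi_11 - 2 * F .Om_01 * F .phi_01 + F .Om_11 * F .phi_00

/-- `x_11 S_k - 2 x_01 S_(k+1) + x_00 S_(k+2)`, for `x = Ω` and `x = φ`. -/
def conOm (s s' s'' : Ser) : Ser := F .Om_11 * s - 2 * F .Om_01 * s' + F .Om_00 * s''
def conPhi (s s' s'' : Ser) : Ser := F .phi_11 * s - 2 * F .phi_01 * s' + F .phi_00 * s''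

/-- `(1/2) [1 + (-1 + Ω) φ²]`. -/
def half : Ser := (1 / 2 : ℂ) • (1 + (-1 + F .Om) * F .phi ^ 2)

/-- The bracket which multiplies `(1 + Ω - φ²)⁻²` in the equations for the `S_k`; it is used with
`(o, p) = (Ω_AB, φ_AB)`. -/
def brack (o p : Ser) : Ser :=
  (1 / 4 : ℂ) • (F .phi ^ 2 * (-6 + (20 + 3 * F .Om) * F .phi ^ 2) * detOm F * o)
  - (1 / 2 : ℂ) • ((14 + 23 * F .Om + 3 * F .Om ^ 2) * F .phi ^ 3 * mixed F * o)
  + (1 + F .Om) * (6 * (1 + F .Om) + (8 + 23 * F .Om + 3 * F .Om ^ 2) * F .phi ^ 2)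
      * detPhi F * o
  - (1 / 2 : ℂ) • (F .phi * (-12 * (1 + F .Om) + (26 + 23 * F .Om + 3 * F .Om ^ 2) * F .phi ^ 2)
      * detOm F * p)
  + (1 + F .Om) ^ 2 * (-6 + (20 + 3 * F .Om) * F .phi ^ 2) * mixed F * p
  - 2 * (1 + F .Om) ^ 2 * (7 + F .Om) * (2 + 3 * F .Om) * F .phi * detPhi F * p

/-- `u` times `ê^1_01 ∂_u f + ê^2_01 ∂_v f`. -/
def uhat01 (f : Ser) : Ser := uu * (F .e1_01 * du f + F .e2_01 * dv f)

/-- `u` times `(1/2u) (∂_v φ_01 - φ_11) + ê^1_01 ∂_u φ_01 + ê^2_01 ∂_v φ_01`. -/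
def uD01phi01 : Ser := (1 / 2 : ℂ) • (dv (F .phi_01) - F .phi_11) + uhat01 F (F .phi_01)

/-- `u` times `(1/2u) ∂_v φ_11 + ê^1_01 ∂_u φ_11 + ê^2_01 ∂_v φ_11`. -/
def uD01phi11 : Ser := (1 / 2 : ℂ) • dv (F .phi_11) + uhat01 F (F .phi_11)

/-- `e_11 (f) = ∂_w f + ê^1_11 ∂_u f + ê^2_11 ∂_v f`. -/
def e11 (f : Ser) : Ser := dw f + F .e1_11 * du f + F .e2_11 * dv f

/-! ### The equations

Every equation that contains a factor `1/u` is multiplied by `u`. -/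

/-- `A_00 = 0` and the `∂_u`-equations. -/
structure DuEquations : Prop where
  A_00 : du (F .phi) = F .phi_00
  -- torsion
  t_01_1 : uu * du (F .e1_01) + F .e1_01 = uu * (-2 * F .G_0101 + 2 * F .G_0100 * F .e1_01)
  t_01_2 : uu * du (F .e2_01) + F .e2_01 = F .G_0100 + uu * (2 * F .G_0100 * F .e2_01)
  t_11_1 : du (F .e1_11) = -2 * F .G_1101 + 2 * F .G_1100 * F .e1_01
  t_11_2 : uu * du (F .e2_11) = F .G_1100 + uu * (2 * F .G_1100 * F .e2_01)
  -- curvature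
  R_0001 : uu * du (F .G_0100) + 2 * F .G_0100 - uu * (2 * F .G_0100 ^ 2)
      = uu * ((1 / 2 : ℂ) • F .S_0)
  R_0101 : uu * du (F .G_0101) + F .G_0101 - uu * (2 * F .G_0100 * F .G_0101)
      = uu * ((1 / 2 : ℂ) • F .S_1)
  R_1101 : uu * du (F .G_0111) + F .G_0111 - uu * (2 * F .G_0100 * F .G_0111)
      = uu * ((1 / 2 : ℂ) • F .S_2 - (1 / 12 : ℂ) • F .R)
  R_0011 : uu * du (F .G_1100) + F .G_1100 - uu * (2 * F .G_0100 * F .G_1100)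
      = uu * F .S_1
  R_0111 : du (F .G_1101) - 2 * F .G_1100 * F .G_0101 = F .S_2 + (1 / 12 : ℂ) • F .R
  R_1111 : du (F .G_1111) - 2 * F .G_1100 * F .G_0111 = F .S_3
  -- conformal factor
  Sigma_00 : du (F .Om) = F .Om_00
  -- equations for `φ_01` and `φ_11`
  Phi_00 : uu * du (F .phi_01)
      = (1 / 2 : ℂ) • (dv (F .phi_00) - 2 * F .phi_01) + uhat01 F (F .phi_00)
        + uu * (-2 * F .G_0101 * F .phi_00 + 2 * F .G_0100 * F .phi_01)
  Phi_10 : uu * du (F .phi_11) - uD01phi01 F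
      = uu * (-F .G_0111 * F .phi_00 + F .G_0100 * F .phi_11
        - (1 / 4 : ℂ) • (F .phi * (F .R + 10 * kap F * (
            (1 / 2 : ℂ) • (F .phi ^ 2 * F .Om_00 * F .Om_11) - (1 / 2 : ℂ) • lam01 F ^ 2
            - (1 + F .Om) * F .phi * (F .Om_00 * F .phi_11 + F .Om_11 * F .phi_00)
            + 2 * (1 + F .Om) ^ 2 * F .phi_00 * F .phi_11))))
  -- equations for `Ω_AB`
  Sigma_0000 : du (F .Om_00) = -F .Om * F .S_0 + kap F * (
      half F * F .Om_00 ^ 2 - 2 * F .Om ^ 2 * F .phi * F .Om_00 * F .phi_00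
      + 2 * F .Om ^ 2 * (1 + F .Om) * F .phi_00 ^ 2)
  Sigma_0001 : du (F .Om_01) = -F .Om * F .S_1 + kap F * (
      half F * F .Om_00 * F .Om_01
      - F .Om ^ 2 * F .phi * (F .Om_00 * F .phi_01 + F .Om_01 * F .phi_00)
      + 2 * F .Om ^ 2 * (1 + F .Om) * F .phi_00 * F .phi_01)
  Sigma_0011 : du (F .Om_11) = -F .Om * F .S_2 - (1 / 3 : ℂ) • ((1 + F .Om) * F .R)
      + (1 / 3 : ℂ) • (kap F * (
        (1 / 2 : ℂ) • ((3 - (11 + 9 * F .Om) * F .phi ^ 2) * F .Om_00 * F .Om_11)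
        + 2 * (2 + 3 * F .Om) * lam01 F ^ 2
        + (8 + 20 * F .Om + 9 * F .Om ^ 2) * (
            F .phi * (F .Om_00 * F .phi_11 + F .Om_11 * F .phi_00)
            - 2 * (1 + F .Om) * F .phi_00 * F .phi_11)))
  -- equation for `R`
  Pi_00 : du (F .R) - kap F * (
        2 * (4 + 7 * F .Om) * F .phi * (F .Om_11 * du (F .phi_00) - 2 * F .Om_01 * du (F .phi_01)
          + F .Om_00 * du (F .phi_11))
        - 4 * (1 + F .Om) * (4 + 7 * F .Om) * (F .phi_11 * du (F .phi_00)
          - 2 * F .phi_01 * du (F .phi_01) + F .phi_00 * du (F .phi_11)))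
      = kap F * (
        (3 + (-3 + 7 * F .Om) * F .phi ^ 2) * conOm F (F .S_0) (F .S_1) (F .S_2)
        - 2 * F .Om * (4 + 7 * F .Om) * F .phi * conPhi F (F .S_0) (F .S_1) (F .S_2)
        + (1 / 3 : ℂ) • ((4 + 7 * F .Om) * F .phi * lam00 F * F .R))
      + (1 / 3 : ℂ) • (kap F ^ 2 * (
        F .phi ^ 2 * (-12 + (40 + 21 * F .Om) * F .phi ^ 2) * detOm F * F .Om_00
        - 2 * F .phi * (-18 * (1 + F .Om) + (46 + 61 * F .Om + 21 * F .Om ^ 2) * F .phi ^ 2)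
          * mixed F * F .Om_00
        + 4 * (1 + F .Om) * (-24 * (1 + F .Om)
          + (52 + 61 * F .Om + 21 * F .Om ^ 2) * F .phi ^ 2) * detPhi F * F .Om_00
        - 2 * F .phi * (12 * (1 + F .Om) + (16 + 61 * F .Om + 21 * F .Om ^ 2) * F .phi ^ 2)
          * detOm F * F .phi_00
        + 4 * (1 + F .Om) * (6 * (1 + F .Om)
          + (22 + 61 * F .Om + 21 * F .Om ^ 2) * F .phi ^ 2) * mixed F * F .phi_00
        - 8 * (1 + F .Om) ^ 2 * (7 + 3 * F .Om) * (4 + 7 * F .Om) * F .phi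
          * detPhi F * F .phi_00))
  -- equations for `S_1`, `S_2`, `S_3`, `S_4`
  H_0000 : uu * du (F .S_1) - (1 / 2 : ℂ) • (dv (F .S_0) - 4 * F .S_1) - uhat01 F (F .S_0)
      + uu * (kap F * (F .Om * lam01 F * du (F .phi_00) - F .Om * lam00 F * du (F .phi_01)))
      = uu * (-4 * F .G_0101 * F .S_0 + 4 * F .G_0100 * F .S_1
        - kap F * (half F * (F .Om_01 * F .S_0 - F .Om_00 * F .S_1)
          - F .Om ^ 2 * F .phi * (F .phi_01 * F .S_0 - F .phi_00 * F .S_1)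
          + 2 * lam00 F * (F .Om_00 * F .phi_01 - F .Om_01 * F .phi_00)))
  H_0001 : uu * du (F .S_2) - (1 / 2 : ℂ) • (dv (F .S_1) - 3 * F .S_2) - uhat01 F (F .S_1)
      + (1 / 3 : ℂ) • (kap F * (
        uu * (-(1 + F .Om) * lam11 F * du (F .phi_00)
          + (2 + 5 * F .Om) * lam01 F * du (F .phi_01)
          - (1 + 2 * F .Om) * lam00 F * du (F .phi_11))
        - 2 * F .Om * lam00 F * uD01phi01 F))
      = uu * (-F .G_0111 * F .S_0 - 2 * F .G_0101 * F .S_1 + 3 * F .G_0100 * F .S_2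
        - kap F * (
          (2 / 3 : ℂ) • (F .Om * lam00 F * (F .G_0111 * F .phi_00 - F .G_0100 * F .phi_11))
          + half F * (F .Om_01 * F .S_1 - F .Om_00 * F .S_2)
          - F .Om ^ 2 * F .phi * (F .phi_01 * F .S_1 - F .phi_00 * F .S_2)
          - (1 / 6 : ℂ) • (F .Om * F .phi ^ 2 * conOm F (F .S_0) (F .S_1) (F .S_2))
          + (1 / 3 : ℂ) • (F .Om * (1 + F .Om) * F .phi * conPhi F (F .S_0) (F .S_1) (F .S_2))
          - (1 / 18 : ℂ) • ((1 + F .Om) * F .phi * lam00 F * F .R)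
          + 2 * lam01 F * (F .Om_00 * F .phi_01 - F .Om_01 * F .phi_00))
        + (1 / 9 : ℂ) • (kap F ^ 2 * brack F (F .Om_00) (F .phi_00)))
  H_0011 : uu * du (F .S_3) - (1 / 2 : ℂ) • (dv (F .S_2) - 2 * F .S_3) - uhat01 F (F .S_2)
      + (1 / 3 : ℂ) • (kap F * (
        uu * (-2 * (1 + F .Om) * lam11 F * du (F .phi_01)
          + F .Om * lam01 F * du (F .phi_11))
        + 2 * (2 + 3 * F .Om) * lam01 F * uD01phi01 F
        - (2 + 5 * F .Om) * lam00 F * uD01phi11 F))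
      = uu * (-2 * F .G_0111 * F .S_1 + 2 * F .G_0100 * F .S_3
        - kap F * (
          -((2 / 3 : ℂ) • ((2 + 3 * F .Om) * lam01 F
              * (F .G_0111 * F .phi_00 - F .G_0100 * F .phi_11)))
          + (2 / 3 : ℂ) • ((2 + 5 * F .Om) * lam00 F
              * (F .G_0111 * F .phi_01 - F .G_0101 * F .phi_11))
          + half F * (F .Om_01 * F .S_2 - F .Om_00 * F .S_3)
          - F .Om ^ 2 * F .phi * (F .phi_01 * F .S_2 - F .phi_00 * F .S_3)
          - (1 / 3 : ℂ) • (F .Om * F .phi ^ 2 * conOm F (F .S_1) (F .S_2) (F .S_3))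
          + (2 / 3 : ℂ) • (F .Om * (1 + F .Om) * F .phi * conPhi F (F .S_1) (F .S_2) (F .S_3))
          - (1 / 9 : ℂ) • ((1 + F .Om) * F .phi * lam01 F * F .R)
          + 2 * lam11 F * (F .Om_00 * F .phi_01 - F .Om_01 * F .phi_00))
        + (2 / 9 : ℂ) • (kap F ^ 2 * brack F (F .Om_01) (F .phi_01)))
  H_0111 : uu * du (F .S_4) - (1 / 2 : ℂ) • (dv (F .S_3) - F .S_4) - uhat01 F (F .S_3)
      + kap F * (
        uu * (-(1 + F .Om) * lam11 F * du (F .phi_11))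
        + (2 + 3 * F .Om) * lam01 F * uD01phi11 F
        - uu * ((1 + 2 * F .Om) * lam00 F * e11 F (F .phi_11)))
      = uu * (-3 * F .G_0111 * F .S_2 + 2 * F .G_0101 * F .S_3 + F .G_0100 * F .S_4
        + kap F * (
          2 * (2 + 3 * F .Om) * lam01 F * (F .G_0111 * F .phi_01 - F .G_0101 * F .phi_11)
          - 2 * (1 + 2 * F .Om) * lam00 F * (F .G_1111 * F .phi_01 - F .G_1101 * F .phi_11)
          - half F * (F .Om_01 * F .S_3 - F .Om_00 * F .S_4)
          + F .Om ^ 2 * F .phi * (F .phi_01 * F .S_3 - F .phi_00 * F .S_4)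
          + (1 / 2 : ℂ) • (F .Om * F .phi ^ 2 * conOm F (F .S_2) (F .S_3) (F .S_4))
          - F .Om * (1 + F .Om) * F .phi * conPhi F (F .S_2) (F .S_3) (F .S_4)
          + (1 / 6 : ℂ) • ((1 + F .Om) * F .phi * lam11 F * F .R)
          - 2 * F .phi * (F .Om_11 * (F .Om_01 * F .phi_01 - F .Om_11 * F .phi_00)
              + F .phi_11 * detOm F)
          - 4 * (1 + F .Om) * (F .phi_11 * (F .Om_01 * F .phi_01 - F .Om_00 * F .phi_11)
              + F .Om_11 * detPhi F))
        + (1 / 3 : ℂ) • (kap F ^ 2 * brack F (F .Om_11) (F .phi_11)))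

/-- The `∂_w`-equations. -/
structure DwEquations : Prop where
  A_11 : e11 F (F .phi) = F .phi_11
  H_w : uu * (e11 F (F .S_0) - du (F .S_2))
      - (1 / 3 : ℂ) • (kap F * (
        uu * ((2 + 5 * F .Om) * lam11 F * du (F .phi_00)
          - 4 * (1 + F .Om) * lam01 F * du (F .phi_01)
          + (2 + F .Om) * lam00 F * du (F .phi_11))
        - 2 * F .Om * lam00 F * uD01phi01 F))
      = uu * (4 * F .G_1101 * F .S_0 - 4 * F .G_1100 * F .S_1
        + kap F * (
          (2 / 3 : ℂ) • (F .Om * lam00 F * (F .G_0111 * F .phi_00 - F .G_0100 * F .phi_11))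
          + half F * (F .Om_11 * F .S_0 - F .Om_00 * F .S_2)
          - F .Om ^ 2 * F .phi * (F .phi_11 * F .S_0 - F .phi_00 * F .S_2)
          + (1 / 3 : ℂ) • (F .Om * F .phi ^ 2 * conOm F (F .S_0) (F .S_1) (F .S_2))
          - (2 / 3 : ℂ) • (F .Om * (1 + F .Om) * F .phi * conPhi F (F .S_0) (F .S_1) (F .S_2))
          + (1 / 9 : ℂ) • ((1 + F .Om) * F .phi * lam00 F * F .R)
          + 2 * lam00 F * (F .Om_00 * F .phi_11 - F .Om_11 * F .phi_00))
        + (2 / 9 : ℂ) • (kap F ^ 2 * brack F (F .Om_00) (F .phi_00)))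

/-- The initial conditions for the `∂_u`-equations, on `U₀` and on `I`. -/
structure InitialConditions : Prop where
  -- gauge conditions for the frame and the connection
  e1_01 : EqOnU0 (F .e1_01) 0
  e2_01 : EqOnU0 (F .e2_01) 0
  e1_11 : EqOnU0 (F .e1_11) 0
  e2_11 : EqOnU0 (F .e2_11) 0
  G_0100 : EqOnU0 (F .G_0100) 0
  G_0101 : EqOnU0 (F .G_0101) 0
  G_0111 : EqOnU0 (F .G_0111) 0
  G_1100 : EqOnU0 (F .G_1100) 0
  G_1101 : EqOnU0 (F .G_1101) 0
  G_1111 : EqOnU0 (F .G_1111) 0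
  -- spinorial behaviour
  phi_01 : EqOnU0 (F .phi_01) ((1 / 2 : ℂ) • du (dv (F .phi)))
  phi_11 : EqOnU0 (F .phi_11) ((1 / 2 : ℂ) • du (dv (dv (F .phi))))
  S_1 : EqOnU0 (F .S_1) ((1 / 4 : ℂ) • dv (F .S_0))
  S_2 : EqOnU0 (F .S_2) ((1 / 12 : ℂ) • dv (dv (F .S_0)))
  S_3 : EqOnU0 (F .S_3) ((1 / 24 : ℂ) • dv (dv (dv (F .S_0))))
  S_4 : EqOnU0 (F .S_4) ((1 / 24 : ℂ) • dv (dv (dv (dv (F .S_0)))))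
  -- conformal factor
  Om : EqOnU0 (F .Om) 0
  Om_01 : EqOnU0 (F .Om_01) 0
  Om_11 : EqOnU0 (F .Om_11) 0
  Om_00 : EqOnI (F .Om_00) 0
  dw_Om_00 : EqOnU0 (dw (F .Om_00)) (-((1 / 3 : ℂ) • F .R)
      + (8 / 3 : ℂ) • ((1 - F .phi ^ 2)⁻¹ * (F .phi * F .Om_00 * F .phi_11
          - 2 * F .phi_00 * F .phi_11 + 2 * F .phi_01 ^ 2)))
  -- Ricci scalar
  R : EqOnI (F .R) (-6 - 8 * du (F .phi) * du (dv (dv (F .phi))) + 4 * du (dv (F .phi)) ^ 2)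
  dw_R : EqOnU0 (dw (F .R)) (3 * F .Om_00 * F .S_4
      + 8 * (1 - F .phi ^ 2)⁻¹ * ((F .phi * F .Om_00 - 2 * F .phi_00) * dw (F .phi_11)
          + 4 * F .phi_01 * dw (F .phi_01) - 2 * F .phi_11 * dw (F .phi_00)
          - (1 / 3 : ℂ) • (F .phi * F .R * F .phi_11))
      + (8 / 3 : ℂ) • ((1 - F .phi ^ 2)⁻¹ ^ 2 * F .phi_11 * (
          (3 + 11 * F .phi ^ 2) * F .Om_00 * F .phi_11 - 28 * F .phi * detPhi F)))

/-- `F` is a formal expansion determined by the data `φ = ∑ ψ m n u^m v^n`,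
`S_0 = ∑ Ψ m n u^m v^n` on `W₀ = {w = 0}`. -/
structure IsFormalExpansion (ψ Ψ : ℕ → ℕ → ℂ) (F : Unknown → Ser) : Prop where
  data_phi : ∀ m n : ℕ, coef (F .phi) m n 0 = ψ m n
  data_S_0 : ∀ m n : ℕ, coef (F .S_0) m n 0 = Ψ m n
  du_equations : DuEquations F
  dw_equations : DwEquations F
  initial : InitialConditions F

end NullCone

end

noncomputable section

namespace NullCone

/-! The system is rewritten as a fixed-point problem `step ψ Ψ F = F`. The ∂_u-equations have the
form u ∂_u f + c f = X with c a nonnegative half-integer and are inverted coefficientwise by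
`solveU`; φ and S_0 come from their data by integration in w; φ_00 is ∂_u φ. For Ω_00 and R, where c
= 0 and the value on U_0 is free, the transport equation in w along U_0 and the value on I supply
it. The right-hand sides are syntax trees, so three gradings of the system become finite
computations.

The rank orders the coefficients so that `step` computes each one from coefficients of strictly
smaller rank (`Agree.step`). Hence `step` has exactly one fixed point, `solution`. Every formal
expansion is a fixed point (`IsFormalExpansion.step_eq`), which gives uniqueness. Conversely a fixed
point satisfies all equations and initial conditions once ∂_v φ_11 = 0 on U_0
(`isFormalExpansion_of_step`).

The type bounds the v-degree: a coefficient of f vanishes for n > 2m + type f. This gives the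
missing condition on φ_11, and it makes ∂_v harmless, since the factor n is then at most a multiple
of m + 1, which the inversion of u ∂_u + c recovers.

The size measures f in a weighted ℓ¹-norm with weight s^(m+p) t^n / binom(m+p, m), where s = ε^100
and t = ε^(-2). The binomial makes ∂_u and ∂_w cost the same factor (m+p+1)/s, so that an
integration in u or in w compensates one derivative in either variable. The weights are infinite
outside the allowed type, so a finite norm contains the vanishing statement. The exponents are
chosen so that everything `step` produces is smaller by one power of ε than required; for small ε
this power beats all constants, and a ball is invariant (`exists_step_inBall`). The bound passes
from the iterates to their coefficientwise limit (`exists_solution_inBall`), and the derivative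
estimates and the convergence follow from it. -/

/-! ### Syntax of the right-hand sides -/

/-- Polynomial expressions in the unknowns. The leaf `kap0` stands for `(1 - φ²)⁻¹` and `dvphi`
for `∂_v φ`. -/
inductive PE : Type
  | var (f : Unknown)
  | kap | kap0 | dvphi
  | const (c : ℂ)
  | add (a b : PE)
  | sub (a b : PE)
  | neg (a : PE)
  | mul (a b : PE)

namespace PE

instance : Add PE := ⟨add⟩
instance : Sub PE := ⟨sub⟩
instance : Neg PE := ⟨neg⟩
instance : Mul PE := ⟨mul⟩
instance : SMul ℂ PE := ⟨fun c a => mul (const c) a⟩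
instance (n : ℕ) : OfNat PE n := ⟨const n⟩

/-- Powers of polynomial expressions. -/
def npow (a : PE) : ℕ → PE
  | 0 => const 1
  | 1 => a
  | n + 2 => mul (npow a (n + 1)) a

instance : Pow PE ℕ := ⟨npow⟩

/-- The value of a polynomial expression. -/
def eval (F : Unknown → Ser) : PE → Ser
  | var f => F f
  | kap => NullCone.kap F
  | kap0 => (1 - F .phi ^ 2)⁻¹
  | dvphi => dv (F .phi)
  | const c => MvPowerSeries.C c
  | add a b => eval F a + eval F b
  | sub a b => eval F a - eval F b
  | neg a => -eval F a
  | mul a b => eval F a * eval F b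

variable (F : Unknown → Ser) (a b : PE)

@[simp] lemma eval_var (f : Unknown) : (var f).eval F = F f := rfl
@[simp] lemma eval_kap : PE.kap.eval F = NullCone.kap F := rfl
@[simp] lemma eval_kap0 : PE.kap0.eval F = (1 - F .phi ^ 2)⁻¹ := rfl
@[simp] lemma eval_dvphi : PE.dvphi.eval F = dv (F .phi) := rfl
@[simp] lemma eval_add : (a + b).eval F = a.eval F + b.eval F := rfl
@[simp] lemma eval_sub : (a - b).eval F = a.eval F - b.eval F := rfl
@[simp] lemma eval_neg : (-a).eval F = -a.eval F := rfl
@[simp] lemma eval_mul : (a * b).eval F = a.eval F * b.eval F := rfl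
@[simp] lemma eval_smul (c : ℂ) : (c • a).eval F = c • a.eval F :=
  (MvPowerSeries.smul_eq_C_mul _ _).symm

@[simp] lemma eval_ofNat (n : ℕ) [n.AtLeastTwo] : (ofNat(n) : PE).eval F = ofNat(n) := by
  change MvPowerSeries.C ((OfNat.ofNat n : ℕ) : ℂ) = _
  rw [map_natCast]; rfl

@[simp] lemma eval_one : (1 : PE).eval F = 1 := by
  change MvPowerSeries.C ((1 : ℕ) : ℂ) = _
  simp

@[simp] lemma eval_pow (n : ℕ) : (a ^ n).eval F = a.eval F ^ n := by
  induction n with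
  | zero => change MvPowerSeries.C (1 : ℂ) = _; simp
  | succ n ih =>
    cases n with
    | zero => change a.eval F = _; simp
    | succ n => rw [pow_succ, ← ih]; rfl

end PE

/-- Expressions which are linear in first derivatives of the unknowns. -/
inductive DE : Type
  | pol (a : PE)
  | du (f : Unknown) | dv (f : Unknown) | dw (f : Unknown)
  | add (a b : DE)
  | sub (a b : DE)
  | mul (a : PE) (b : DE)

namespace DE

instance : Add DE := ⟨add⟩
instance : Sub DE := ⟨sub⟩
instance : HMul PE DE DE := ⟨mul⟩
instance : SMul ℂ DE := ⟨fun c a => mul (.const c) a⟩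

/-- The value of a derivative-linear expression. -/
def eval (F : Unknown → Ser) : DE → Ser
  | pol a => a.eval F
  | du f => NullCone.du (F f)
  | dv f => NullCone.dv (F f)
  | dw f => NullCone.dw (F f)
  | add a b => eval F a + eval F b
  | sub a b => eval F a - eval F b
  | mul a b => a.eval F * eval F b

variable (F : Unknown → Ser) (a b : DE)

@[simp] lemma eval_pol (a : PE) : (pol a).eval F = a.eval F := rfl
@[simp] lemma eval_du (f : Unknown) : (du f).eval F = NullCone.du (F f) := rfl
@[simp] lemma eval_dv (f : Unknown) : (dv f).eval F = NullCone.dv (F f) := rfl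
@[simp] lemma eval_dw (f : Unknown) : (dw f).eval F = NullCone.dw (F f) := rfl
@[simp] lemma eval_add : (a + b).eval F = a.eval F + b.eval F := rfl
@[simp] lemma eval_sub : (a - b).eval F = a.eval F - b.eval F := rfl
@[simp] lemma eval_mul (a : PE) : (a * b).eval F = a.eval F * b.eval F := rfl
@[simp] lemma eval_smul (c : ℂ) : (c • a).eval F = c • a.eval F :=
  (MvPowerSeries.smul_eq_C_mul _ _).symm

end DE

/-- Expressions of the form `u X + Y`, where `X` is linear in first derivatives and `Y` involves
`v`-derivatives only. -/
inductive EE : Type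
  | pol (a : PE)
  | u (a : DE)
  | dv (f : Unknown)
  | add (a b : EE)
  | mul (a : PE) (b : EE)

namespace EE

instance : Add EE := ⟨add⟩
instance : HMul PE EE EE := ⟨mul⟩
instance : SMul ℂ EE := ⟨fun c a => mul (.const c) a⟩

/-- The value of such an expression. -/
def eval (F : Unknown → Ser) : EE → Ser
  | pol a => a.eval F
  | u a => uu * a.eval F
  | dv f => NullCone.dv (F f)
  | add a b => eval F a + eval F b
  | mul a b => a.eval F * eval F b

variable (F : Unknown → Ser) (a b : EE)

@[simp] lemma eval_pol (a : PE) : (pol a).eval F = a.eval F := rfl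
@[simp] lemma eval_u (a : DE) : (u a).eval F = uu * a.eval F := rfl
@[simp] lemma eval_dv (f : Unknown) : (dv f).eval F = NullCone.dv (F f) := rfl
@[simp] lemma eval_add : (a + b).eval F = a.eval F + b.eval F := rfl
@[simp] lemma eval_mul (a : PE) : (a * b).eval F = a.eval F * b.eval F := rfl
@[simp] lemma eval_smul (c : ℂ) : (c • a).eval F = c • a.eval F :=
  (MvPowerSeries.smul_eq_C_mul _ _).symm

end EE

/-! ### The right-hand sides -/

namespace Rhs

open PE

/-- `φ Ω_00 - 2 (1 + Ω) φ_00`. -/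
def lam00 : PE :=
  var .phi * var .Om_00 - 2 * (1 + var .Om) * var .phi_00

/-- `φ Ω_01 - 2 (1 + Ω) φ_01`. -/
def lam01 : PE :=
  var .phi * var .Om_01 - 2 * (1 + var .Om) * var .phi_01

/-- `φ Ω_11 - 2 (1 + Ω) φ_11`. -/
def lam11 : PE :=
  var .phi * var .Om_11 - 2 * (1 + var .Om) * var .phi_11

/-- `Ω_00 Ω_11 - Ω_01²`. -/
def detOm : PE :=
  var .Om_00 * var .Om_11 - var .Om_01 ^ 2

/-- `φ_00 φ_11 - φ_01²`. -/
def detPhi : PE :=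
  var .phi_00 * var .phi_11 - var .phi_01 ^ 2

/-- `Ω_00 φ_11 - 2 Ω_01 φ_01 + Ω_11 φ_00`. -/
def mixed : PE :=
  var .Om_00 * var .phi_11 - 2 * var .Om_01 * var .phi_01 + var .Om_11 * var .phi_00

/-- `Ω_11 s - 2 Ω_01 s' + Ω_00 s''`. -/
def conOm (s s' s'' : PE) : PE :=
  var .Om_11 * s - 2 * var .Om_01 * s' + var .Om_00 * s''

/-- `φ_11 s - 2 φ_01 s' + φ_00 s''`. -/
def conPhi (s s' s'' : PE) : PE :=
  var .phi_11 * s - 2 * var .phi_01 * s' + var .phi_00 * s''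

/-- `(1/2) [1 + (-1 + Ω) φ²]`. -/
def half : PE :=
  (1 / 2 : ℂ) • (1 + (-1 + var .Om) * var .phi ^ 2)

/-- The bracket multiplying `κ²` in the equations for the `S_k`. -/
def brack (o p : PE) : PE :=
  (1 / 4 : ℂ) • (var .phi ^ 2 * (-6 + (20 + 3 * var .Om) * var .phi ^ 2) * detOm * o)
  - (1 / 2 : ℂ) • ((14 + 23 * var .Om + 3 * var .Om ^ 2) * var .phi ^ 3 * mixed * o)
  + (1 + var .Om) * (6 * (1 + var .Om) + (8 + 23 * var .Om + 3 * var .Om ^ 2) * var .phi ^ 2)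
      * detPhi * o
  - (1 / 2 : ℂ) • (var .phi * (-12 * (1 + var .Om) + (26 + 23 * var .Om + 3 * var .Om ^ 2) * var .phi ^ 2)
      * detOm * p)
  + (1 + var .Om) ^ 2 * (-6 + (20 + 3 * var .Om) * var .phi ^ 2) * mixed * p
  - 2 * (1 + var .Om) ^ 2 * (7 + var .Om) * (2 + 3 * var .Om) * var .phi * detPhi * p

/-- `ê_01 f`. -/
def hat01 (f : Unknown) : DE :=
  var .e1_01 * DE.du f + var .e2_01 * DE.dv f

/-- `e_11 f`. -/
def e11 (f : Unknown) : DE :=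
  DE.dw f + var .e1_11 * DE.du f + var .e2_11 * DE.dv f

/-- The difference `∂_u φ_11 - E_1`. -/
def phi11 : PE :=
  -var .G_0111 * var .phi_00 + var .G_0100 * var .phi_11
        - (1 / 4 : ℂ) • (var .phi * (var .R + 10 * PE.kap * (
            (1 / 2 : ℂ) • (var .phi ^ 2 * var .Om_00 * var .Om_11) - (1 / 2 : ℂ) • lam01 ^ 2
            - (1 + var .Om) * var .phi * (var .Om_00 * var .phi_11 + var .Om_11 * var .phi_00)
            + 2 * (1 + var .Om) ^ 2 * var .phi_00 * var .phi_11)))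

/-- `E_1`. -/
def E1 : DE :=
  -- Expressing E_1 through the equation for ∂_u φ_11 removes its factor 1/u. It can then stand in
  -- the equation for ∂_w S_0, and in those for S_2 and S_3 it contributes no term without a factor
  -- u.
  DE.du .phi_11 - .pol phi11

/-- `∂_u Ω_00`. -/
def Om00 : PE :=
  -var .Om * var .S_0 + PE.kap * (
      half * var .Om_00 ^ 2 - 2 * var .Om ^ 2 * var .phi * var .Om_00 * var .phi_00
      + 2 * var .Om ^ 2 * (1 + var .Om) * var .phi_00 ^ 2)

/-- `∂_u Ω_01`. -/
def Om01 : PE :=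
  -var .Om * var .S_1 + PE.kap * (
      half * var .Om_00 * var .Om_01
      - var .Om ^ 2 * var .phi * (var .Om_00 * var .phi_01 + var .Om_01 * var .phi_00)
      + 2 * var .Om ^ 2 * (1 + var .Om) * var .phi_00 * var .phi_01)

/-- `∂_u Ω_11`. -/
def Om11 : PE :=
  -var .Om * var .S_2 - (1 / 3 : ℂ) • ((1 + var .Om) * var .R)
      + (1 / 3 : ℂ) • (PE.kap * (
        (1 / 2 : ℂ) • ((3 - (11 + 9 * var .Om) * var .phi ^ 2) * var .Om_00 * var .Om_11)
        + 2 * (2 + 3 * var .Om) * lam01 ^ 2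
        + (8 + 20 * var .Om + 9 * var .Om ^ 2) * (
            var .phi * (var .Om_00 * var .phi_11 + var .Om_11 * var .phi_00)
            - 2 * (1 + var .Om) * var .phi_00 * var .phi_11)))

/-- `∂_u R`. -/
def R : DE :=
  PE.kap * (
        2 * (4 + 7 * var .Om) * var .phi * (var .Om_11 * DE.du .phi_00 - 2 * var .Om_01 * DE.du .phi_01
          + var .Om_00 * DE.du .phi_11)
        - 4 * (1 + var .Om) * (4 + 7 * var .Om) * (var .phi_11 * DE.du .phi_00
          - 2 * var .phi_01 * DE.du .phi_01 + var .phi_00 * DE.du .phi_11))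
      + .pol (PE.kap * (
        (3 + (-3 + 7 * var .Om) * var .phi ^ 2) * conOm (var .S_0) (var .S_1) (var .S_2)
        - 2 * var .Om * (4 + 7 * var .Om) * var .phi * conPhi (var .S_0) (var .S_1) (var .S_2)
        + (1 / 3 : ℂ) • ((4 + 7 * var .Om) * var .phi * lam00 * var .R))
      + (1 / 3 : ℂ) • (PE.kap ^ 2 * (
        var .phi ^ 2 * (-12 + (40 + 21 * var .Om) * var .phi ^ 2) * detOm * var .Om_00
        - 2 * var .phi * (-18 * (1 + var .Om) + (46 + 61 * var .Om + 21 * var .Om ^ 2) * var .phi ^ 2)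
          * mixed * var .Om_00
        + 4 * (1 + var .Om) * (-24 * (1 + var .Om)
          + (52 + 61 * var .Om + 21 * var .Om ^ 2) * var .phi ^ 2) * detPhi * var .Om_00
        - 2 * var .phi * (12 * (1 + var .Om) + (16 + 61 * var .Om + 21 * var .Om ^ 2) * var .phi ^ 2)
          * detOm * var .phi_00
        + 4 * (1 + var .Om) * (6 * (1 + var .Om)
          + (22 + 61 * var .Om + 21 * var .Om ^ 2) * var .phi ^ 2) * mixed * var .phi_00
        - 8 * (1 + var .Om) ^ 2 * (7 + 3 * var .Om) * (4 + 7 * var .Om) * var .phi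
          * detPhi * var .phi_00)))

/-- `u ∂_u S_1 + 2 S_1`. -/
def S1 : EE :=
  (1 / 2 : ℂ) • EE.dv .S_0 + .u (hat01 .S_0
      - PE.kap * (var .Om * lam01 * DE.du .phi_00 - var .Om * lam00 * DE.du .phi_01)
      + .pol (-4 * var .G_0101 * var .S_0 + 4 * var .G_0100 * var .S_1
        - PE.kap * (half * (var .Om_01 * var .S_0 - var .Om_00 * var .S_1)
          - var .Om ^ 2 * var .phi * (var .phi_01 * var .S_0 - var .phi_00 * var .S_1)
          + 2 * lam00 * (var .Om_00 * var .phi_01 - var .Om_01 * var .phi_00))))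

/-- `u ∂_u S_2 + (3/2) S_2`. -/
def S2 : EE :=
  (1 / 2 : ℂ) • EE.dv .S_1 + .u (hat01 .S_1
      - (1 / 3 : ℂ) • (PE.kap * (
        -(1 + var .Om) * lam11 * DE.du .phi_00
          + (2 + 5 * var .Om) * lam01 * DE.du .phi_01
          - (1 + 2 * var .Om) * lam00 * DE.du .phi_11
        - 2 * var .Om * lam00 * E1))
      + .pol (-var .G_0111 * var .S_0 - 2 * var .G_0101 * var .S_1 + 3 * var .G_0100 * var .S_2
        - PE.kap * (
          (2 / 3 : ℂ) • (var .Om * lam00 * (var .G_0111 * var .phi_00 - var .G_0100 * var .phi_11))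
          + half * (var .Om_01 * var .S_1 - var .Om_00 * var .S_2)
          - var .Om ^ 2 * var .phi * (var .phi_01 * var .S_1 - var .phi_00 * var .S_2)
          - (1 / 6 : ℂ) • (var .Om * var .phi ^ 2 * conOm (var .S_0) (var .S_1) (var .S_2))
          + (1 / 3 : ℂ) • (var .Om * (1 + var .Om) * var .phi * conPhi (var .S_0) (var .S_1) (var .S_2))
          - (1 / 18 : ℂ) • ((1 + var .Om) * var .phi * lam00 * var .R)
          + 2 * lam01 * (var .Om_00 * var .phi_01 - var .Om_01 * var .phi_00))
        + (1 / 9 : ℂ) • (PE.kap ^ 2 * brack (var .Om_00) (var .phi_00))))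

/-- `u ∂_u S_3 + S_3`. -/
def S3 : EE :=
  (1 / 2 : ℂ) • EE.dv .S_2
      -- This term comes from E_2 and carries no factor u, so it survives on U_0. The prescribed
      -- value of S_3 there is consistent because ∂_v φ_11 vanishes on U_0.
      + (1 / 3 : ℂ) • (PE.kap * ((2 + 5 * var .Om) * lam00 * ((1 / 2 : ℂ) • EE.dv .phi_11)))
      + .u (hat01 .S_2
      - (1 / 3 : ℂ) • (PE.kap * (
        -2 * (1 + var .Om) * lam11 * DE.du .phi_01
          + var .Om * lam01 * DE.du .phi_11
        + 2 * (2 + 3 * var .Om) * lam01 * E1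
        - (2 + 5 * var .Om) * lam00 * hat01 .phi_11))
      + .pol (-2 * var .G_0111 * var .S_1 + 2 * var .G_0100 * var .S_3
        - PE.kap * (
          -((2 / 3 : ℂ) • ((2 + 3 * var .Om) * lam01
              * (var .G_0111 * var .phi_00 - var .G_0100 * var .phi_11)))
          + (2 / 3 : ℂ) • ((2 + 5 * var .Om) * lam00
              * (var .G_0111 * var .phi_01 - var .G_0101 * var .phi_11))
          + half * (var .Om_01 * var .S_2 - var .Om_00 * var .S_3)
          - var .Om ^ 2 * var .phi * (var .phi_01 * var .S_2 - var .phi_00 * var .S_3)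
          - (1 / 3 : ℂ) • (var .Om * var .phi ^ 2 * conOm (var .S_1) (var .S_2) (var .S_3))
          + (2 / 3 : ℂ) • (var .Om * (1 + var .Om) * var .phi * conPhi (var .S_1) (var .S_2) (var .S_3))
          - (1 / 9 : ℂ) • ((1 + var .Om) * var .phi * lam01 * var .R)
          + 2 * lam11 * (var .Om_00 * var .phi_01 - var .Om_01 * var .phi_00))
        + (2 / 9 : ℂ) • (PE.kap ^ 2 * brack (var .Om_01) (var .phi_01))))

/-- `u ∂_u S_4 + (1/2) S_4`. -/
def S4 : EE :=
  (1 / 2 : ℂ) • EE.dv .S_3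
      + (-PE.kap * (2 + 3 * var .Om) * lam01) * ((1 / 2 : ℂ) • EE.dv .phi_11)
      + .u (hat01 .S_3
      - PE.kap * (
        -(1 + var .Om) * lam11 * DE.du .phi_11
        + (2 + 3 * var .Om) * lam01 * hat01 .phi_11
        - (1 + 2 * var .Om) * lam00 * e11 .phi_11)
      + .pol (-3 * var .G_0111 * var .S_2 + 2 * var .G_0101 * var .S_3 + var .G_0100 * var .S_4
        + PE.kap * (
          2 * (2 + 3 * var .Om) * lam01 * (var .G_0111 * var .phi_01 - var .G_0101 * var .phi_11)
          - 2 * (1 + 2 * var .Om) * lam00 * (var .G_1111 * var .phi_01 - var .G_1101 * var .phi_11)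
          - half * (var .Om_01 * var .S_3 - var .Om_00 * var .S_4)
          + var .Om ^ 2 * var .phi * (var .phi_01 * var .S_3 - var .phi_00 * var .S_4)
          + (1 / 2 : ℂ) • (var .Om * var .phi ^ 2 * conOm (var .S_2) (var .S_3) (var .S_4))
          - var .Om * (1 + var .Om) * var .phi * conPhi (var .S_2) (var .S_3) (var .S_4)
          + (1 / 6 : ℂ) • ((1 + var .Om) * var .phi * lam11 * var .R)
          - 2 * var .phi * (var .Om_11 * (var .Om_01 * var .phi_01 - var .Om_11 * var .phi_00)
              + var .phi_11 * detOm)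
          - 4 * (1 + var .Om) * (var .phi_11 * (var .Om_01 * var .phi_01 - var .Om_00 * var .phi_11)
              + var .Om_11 * detPhi))
        + (1 / 3 : ℂ) • (PE.kap ^ 2 * brack (var .Om_11) (var .phi_11))))

/-- `∂_w φ`. -/
def phi : PE :=
  var .phi_11 - var .e1_11 * var .phi_00 - var .e2_11 * PE.dvphi

/-- `∂_w S_0`. -/
def S0 : DE :=
  DE.du .S_2 - (var .e1_11 * DE.du .S_0 + var .e2_11 * DE.dv .S_0)
      + (1 / 3 : ℂ) • (PE.kap * (
        (2 + 5 * var .Om) * lam11 * DE.du .phi_00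
          - 4 * (1 + var .Om) * lam01 * DE.du .phi_01
          + (2 + var .Om) * lam00 * DE.du .phi_11
        - 2 * var .Om * lam00 * E1))
      + .pol (4 * var .G_1101 * var .S_0 - 4 * var .G_1100 * var .S_1
        + PE.kap * (
          (2 / 3 : ℂ) • (var .Om * lam00 * (var .G_0111 * var .phi_00 - var .G_0100 * var .phi_11))
          + half * (var .Om_11 * var .S_0 - var .Om_00 * var .S_2)
          - var .Om ^ 2 * var .phi * (var .phi_11 * var .S_0 - var .phi_00 * var .S_2)
          + (1 / 3 : ℂ) • (var .Om * var .phi ^ 2 * conOm (var .S_0) (var .S_1) (var .S_2))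
          - (2 / 3 : ℂ) • (var .Om * (1 + var .Om) * var .phi * conPhi (var .S_0) (var .S_1) (var .S_2))
          + (1 / 9 : ℂ) • ((1 + var .Om) * var .phi * lam00 * var .R)
          + 2 * lam00 * (var .Om_00 * var .phi_11 - var .Om_11 * var .phi_00))
        + (2 / 9 : ℂ) • (PE.kap ^ 2 * brack (var .Om_00) (var .phi_00)))

/-- `∂_w Ω_00` on `U₀`. -/
def dwOm00 : PE :=
  -((1 / 3 : ℂ) • var .R)
      + (8 / 3 : ℂ) • (PE.kap0 * (var .phi * var .Om_00 * var .phi_11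
          - 2 * var .phi_00 * var .phi_11 + 2 * var .phi_01 ^ 2))

/-- `∂_w R` on `U₀`. -/
def dwR : DE :=
  .pol (3 * var .Om_00 * var .S_4)
      + 8 * PE.kap0 * ((var .phi * var .Om_00 - 2 * var .phi_00) * DE.dw .phi_11
          + 4 * var .phi_01 * DE.dw .phi_01 - 2 * var .phi_11 * DE.dw .phi_00
          - .pol ((1 / 3 : ℂ) • (var .phi * var .R * var .phi_11)))
      + .pol ((8 / 3 : ℂ) • (PE.kap0 ^ 2 * var .phi_11 * (
          (3 + 11 * var .phi ^ 2) * var .Om_00 * var .phi_11 - 28 * var .phi * detPhi)))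

/-- `R` on `I`. -/
def valR : PE :=
  -- On U_0 the initial conditions turn ∂_u∂_v²φ into 2 φ_11 and ∂_u∂_vφ into 2 φ_01, so no
  -- derivative is needed.
  -6 - 16 * var .phi_00 * var .phi_11 + 16 * var .phi_01 ^ 2

/-- The right-hand sides of the equations `u ∂_u f + (1/2) (shift f) f = …`. The unknowns `φ`,
`φ_00` and `S_0` do not satisfy such an equation. -/
def all : Unknown → EE
  | .e1_01 => .u (.pol (-2 * var .G_0101 + 2 * var .G_0100 * var .e1_01))
  | .e2_01 => .pol (var .G_0100) + .u (.pol (2 * var .G_0100 * var .e2_01))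
  | .e1_11 => .u (.pol (-2 * var .G_1101 + 2 * var .G_1100 * var .e1_01))
  | .e2_11 => .pol (var .G_1100) + .u (.pol (2 * var .G_1100 * var .e2_01))
  | .G_0100 => .u (.pol ((1 / 2 : ℂ) • var .S_0 + 2 * var .G_0100 ^ 2))
  | .G_0101 => .u (.pol ((1 / 2 : ℂ) • var .S_1 + 2 * var .G_0100 * var .G_0101))
  | .G_0111 => .u (.pol ((1 / 2 : ℂ) • var .S_2 - (1 / 12 : ℂ) • var .R
      + 2 * var .G_0100 * var .G_0111))
  | .G_1100 => .u (.pol (var .S_1 + 2 * var .G_0100 * var .G_1100))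
  | .G_1101 => .u (.pol (var .S_2 + (1 / 12 : ℂ) • var .R + 2 * var .G_1100 * var .G_0101))
  | .G_1111 => .u (.pol (var .S_3 + 2 * var .G_1100 * var .G_0111))
  | .phi_01 => (1 / 2 : ℂ) • EE.dv .phi_00 + .u (hat01 .phi_00
      + .pol (-2 * var .G_0101 * var .phi_00 + 2 * var .G_0100 * var .phi_01))
  | .phi_11 => (1 / 2 : ℂ) • EE.dv .phi_01 + .u (hat01 .phi_01 + .pol phi11)
  | .Om => .u (.pol (var .Om_00))
  | .Om_00 => .u (.pol Om00)
  | .Om_01 => .u (.pol Om01)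
  | .Om_11 => .u (.pol Om11)
  | .R => .u R
  | .S_1 => S1
  | .S_2 => S2
  | .S_3 => S3
  | .S_4 => S4
  | _ => .pol 0

/-- Twice the coefficient of `f` in the equation `u ∂_u f + c f = …`. -/
def shift : Unknown → ℕ
  | .e1_01 | .e2_01 | .G_0101 | .G_0111 | .G_1100 | .phi_01 | .S_3 => 2
  | .G_0100 | .S_1 => 4
  | .phi_11 | .S_4 => 1
  | .S_2 => 3
  | _ => 0


end Rhs

/-! ### Rank, type and size of expressions -/

/-- The coefficient of `u^m v^n w^p` in the unknown `f` has rank `rank f + 10 m + 16 p`. -/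
def Unknown.rank : Unknown → ℤ
  -- The powers of v do not count, so ∂_v is free; instead the rank rises along the ladders φ_00,
  -- φ_01, φ_11 and S_0, …, S_4, each member being obtained from ∂_v of the previous one. A power of
  -- w counts more than one of u because ∂_w S_0 contains ∂_u S_2: the requirement is 20 + 10 - 16 <
  -- 18.
  | .phi => 0 | .phi_00 => 11 | .phi_01 => 12 | .phi_11 => 13
  | .Om => 2 | .Om_00 => 11 | .Om_01 => 11 | .Om_11 => 11
  | .R => 14
  | .S_0 => 18 | .S_1 => 19 | .S_2 => 20 | .S_3 => 21 | .S_4 => 22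
  | .G_0100 | .G_0101 | .G_0111 | .G_1100 | .G_1101 | .G_1111 => 13
  | .e1_01 | .e2_01 | .e1_11 | .e2_11 => 14

/-- The coefficient of `u^m v^n w^p` in the unknown `f` vanishes for `n > 2 m + type f`. -/
def Unknown.type : Unknown → ℤ
  | .phi => 0 | .phi_00 => 2 | .phi_01 => 1 | .phi_11 => 0
  | .Om => 0 | .Om_00 => 2 | .Om_01 => 1 | .Om_11 => 0
  | .R => 2
  | .S_0 => 4 | .S_1 => 3 | .S_2 => 2 | .S_3 => 1 | .S_4 => 0
  | .G_0100 => 2 | .G_0101 => 1 | .G_0111 => 0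
  | .G_1100 => 1 | .G_1101 => 0 | .G_1111 => -1
  | .e1_01 => -1 | .e2_01 => 2 | .e1_11 => -2 | .e2_11 => 1

/-- The unknown `f` is of size `ε ^ size f` in the norm with parameter `ε`. -/
def Unknown.size : Unknown → ℤ
  -- A ∂_v gains ε², so climbing one rung of a ladder may lose one power and still leave one to
  -- spare. For φ_00 = ∂_u φ this reads 95 - 100 = -6 + 1. The products of two φ_AB in the equations
  -- for R and S_2 are of order -10 = -11 + 1, and the factor u raises the order by 100 for Γ̂ and
  -- Ω_AB.
  | .phi => 95 | .phi_00 => -6 | .phi_01 => -5 | .phi_11 => -4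
  | .Om | .Om_00 | .Om_01 | .Om_11 => 88
  | .S_0 => -12
  | .R | .S_1 | .S_2 | .S_3 | .S_4 => -11
  | .G_0100 | .G_0101 | .G_0111 | .G_1100 | .G_1101 | .G_1111 => 87
  | .e1_01 | .e2_01 | .e1_11 | .e2_11 => 86

namespace PE

/-- The rank of an expression: the largest rank of its constituents. -/
def rank : PE → ℤ
  | var f => f.rank
  | kap => 2
  | kap0 => 0
  | dvphi => 0
  | const _ => 0
  | add a b => max (rank a) (rank b)
  | sub a b => max (rank a) (rank b)
  | neg a => rank a
  | mul a b => max (rank a) (rank b)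

/-- The type of an expression. -/
def type : PE → ℤ
  | var f => f.type
  | kap => 0
  | kap0 => 0
  | dvphi => -1
  | const _ => 0
  | add a b => max (type a) (type b)
  | sub a b => max (type a) (type b)
  | neg a => type a
  | mul a b => type a + type b

/-- The size exponent of an expression. -/
def size : PE → ℤ
  | var f => f.size
  | kap => 0
  | kap0 => 0
  | dvphi => 97
  | const _ => 0
  | add a b => min (size a) (size b)
  | sub a b => min (size a) (size b)
  | neg a => size a
  | mul a b => size a + size b

end PE

namespace DE

/-- The rank of a derivative-linear expression. -/
def rank : DE → ℤ
  | pol a => a.rank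
  | du f => f.rank + 10
  | dv f => f.rank
  | dw f => f.rank + 16
  | add a b => max (rank a) (rank b)
  | sub a b => max (rank a) (rank b)
  | mul a b => max a.rank (rank b)

/-- The type of a derivative-linear expression. -/
def type : DE → ℤ
  | pol a => a.type
  | du f => f.type + 2
  | dv f => f.type - 1
  | dw f => f.type
  | add a b => max (type a) (type b)
  | sub a b => max (type a) (type b)
  | mul a b => a.type + type b

/-- The size exponent of a derivative-linear expression. -/
def size : DE → ℤ
  | pol a => a.size
  | du f => f.size - 100
  | dv f => f.size + 2
  | dw f => f.size - 100
  | add a b => min (size a) (size b)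
  | sub a b => min (size a) (size b)
  | mul a b => a.size + size b

end DE

namespace EE

/-- The rank of an expression. -/
def rank : EE → ℤ
  | pol a => a.rank
  | u a => a.rank - 10
  | dv f => f.rank
  | add a b => max (rank a) (rank b)
  | mul a b => max a.rank (rank b)

/-- The type of an expression. -/
def type : EE → ℤ
  | pol a => a.type
  | u a => a.type - 2
  | dv f => f.type - 1
  | add a b => max (type a) (type b)
  | mul a b => a.type + type b

/-- The size exponent of an expression. -/
def size : EE → ℤ
  | pol a => a.size
  | u a => a.size + 100
  | dv f => f.size + 2
  | add a b => min (size a) (size b)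
  | mul a b => a.size + size b

end EE

/-! ### Verification of the three gradings. -/

namespace Rhs

/-- The strictness is what makes `step` a contraction for the rank filtration. The gradings are
computed on syntax trees, so these inequalities are decided by evaluation. The unknown φ is excluded
because its entry in `all` is only a placeholder. In the lemmas for ∂_w-equations, the -16 on ranks
and the +100 on sizes account for one integration in w. -/
lemma rank_all (f : Unknown) (hf : f ≠ .phi) : (all f).rank < f.rank := by
  cases f <;> first | exact absurd rfl hf | decide +kernel

lemma rank_phi : phi.rank - 16 < Unknown.phi.rank := by decide +kernel
lemma rank_S0 : S0.rank - 16 < Unknown.S_0.rank := by decide +kernel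
lemma rank_dwOm00 : dwOm00.rank - 16 < Unknown.Om_00.rank := by decide +kernel
lemma rank_dwR : dwR.rank - 16 < Unknown.R.rank := by decide +kernel
lemma rank_valR : valR.rank < Unknown.R.rank := by decide +kernel

lemma type_all (f : Unknown) : (all f).type ≤ f.type := by
  cases f <;> decide +kernel

lemma type_phi : phi.type ≤ Unknown.phi.type := by decide +kernel
lemma type_S0 : S0.type ≤ Unknown.S_0.type := by decide +kernel
lemma type_dwOm00 : dwOm00.type ≤ Unknown.Om_00.type := by decide +kernel
lemma type_dwR : dwR.type ≤ Unknown.R.type := by decide +kernel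
lemma type_valR : valR.type ≤ Unknown.R.type := by decide +kernel

lemma size_all (f : Unknown) (hf : f ≠ .phi) : f.size + 1 ≤ (all f).size := by
  cases f <;> first | exact absurd rfl hf | decide +kernel

lemma size_phi : Unknown.phi.size + 1 ≤ phi.size + 100 := by decide +kernel
lemma size_S0 : Unknown.S_0.size + 1 ≤ S0.size + 100 := by decide +kernel
lemma size_dwOm00 : Unknown.Om_00.size + 1 ≤ dwOm00.size + 100 := by decide +kernel
lemma size_dwR : Unknown.R.size + 1 ≤ dwR.size + 100 := by decide +kernel
lemma size_valR : Unknown.R.size + 1 ≤ valR.size := by decide +kernel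

end Rhs

open MvPowerSeries Finsupp

/-! ### Congruence of power series up to a weighted order -/

/-- The weighted degree of an exponent. -/
def wdeg (e : Fin 3 →₀ ℕ) : ℤ := 10 * e 0 + 16 * e 2

lemma wdeg_add (a b : Fin 3 →₀ ℕ) : wdeg (a + b) = wdeg a + wdeg b := by
  simp only [wdeg, Finsupp.add_apply]; push_cast; ring

lemma wdeg_nonneg (a : Fin 3 →₀ ℕ) : 0 ≤ wdeg a := by
  unfold wdeg; positivity

/-- Equality of all coefficients of weighted degree less than `N`. -/
def Cong (N : ℤ) (f g : Ser) : Prop := ∀ e, wdeg e < N → coeff e f = coeff e g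

namespace Cong

variable {N M : ℤ} {f g f' g' : Ser}

lemma refl (N : ℤ) (f : Ser) : Cong N f f := fun _ _ => rfl

lemma mono (h : Cong N f g) (hM : M ≤ N) : Cong M f g := fun e he => h e (he.trans_le hM)

lemma add (h : Cong N f g) (h' : Cong N f' g') : Cong N (f + f') (g + g') := fun e he => by
  simp [h e he, h' e he]

lemma sub (h : Cong N f g) (h' : Cong N f' g') : Cong N (f - f') (g - g') := fun e he => by
  simp [h e he, h' e he]

lemma neg (h : Cong N f g) : Cong N (-f) (-g) := fun e he => by
  simp [h e he]

lemma mul (h : Cong N f g) (h' : Cong N f' g') : Cong N (f * f') (g * g') := fun e he => by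
  classical
  rw [coeff_mul, coeff_mul]
  refine Finset.sum_congr rfl fun p hp => ?_
  replace hp := Finset.HasAntidiagonal.mem_antidiagonal.1 hp
  have := wdeg_add p.1 p.2
  rw [hp] at this
  rw [h p.1 (by linarith [wdeg_nonneg p.2]), h' p.2 (by linarith [wdeg_nonneg p.1])]

/-- Multiplying f ≡ g by f⁻¹ on the left and g⁻¹ on the right gives g⁻¹ ≡ f⁻¹. If the common
constant term is 0, both inverses are 0 by convention. -/
lemma inv (h : Cong N f g) : Cong N f⁻¹ g⁻¹ := by
  intro e he
  have h0 : constantCoeff f = constantCoeff g := by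
    have := h 0 (by simpa [wdeg] using (wdeg_nonneg e).trans_lt he)
    simpa using this
  by_cases hf : constantCoeff f = 0
  · rw [MvPowerSeries.inv_eq_zero.2 hf, MvPowerSeries.inv_eq_zero.2 (h0 ▸ hf)]
  · have hg : constantCoeff g ≠ 0 := h0 ▸ hf
    have h1 := ((refl N f⁻¹).mul h).mul (refl N g⁻¹)
    rw [MvPowerSeries.inv_mul_cancel _ hf, one_mul, mul_assoc, MvPowerSeries.mul_inv_cancel _ hg,
      mul_one] at h1
    exact (h1 e he).symm

lemma pderiv (i : Fin 3) (h : Cong N f g) :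
    Cong (N - wdeg (single i 1)) (pderiv ℂ i f) (pderiv ℂ i g) := fun e he => by
  rw [coeff_pderiv, coeff_pderiv, h _ (by rw [wdeg_add]; linarith)]

lemma du (h : Cong N f g) : Cong (N - 10) (du f) (du g) := by
  simpa [wdeg, NullCone.du] using h.pderiv 0

lemma dv (h : Cong N f g) : Cong N (dv f) (dv g) := by
  simpa [wdeg, NullCone.dv] using h.pderiv 1

lemma dw (h : Cong N f g) : Cong (N - 16) (dw f) (dw g) := by
  simpa [wdeg, NullCone.dw] using h.pderiv 2

end Cong

/-! ### Multiplication by u. -/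

lemma coeff_uu_mul (e : Fin 3 →₀ ℕ) (X : Ser) :
    coeff e (uu * X) = if e 0 = 0 then 0 else coeff (e - single 0 1) X := by
  rw [uu, X_mul, show (MvPowerSeries.X 0 : Ser) = monomial (single 0 1) 1 from rfl, coeff_mul_monomial]
  by_cases h : e 0 = 0
  · rw [if_neg (by rw [Finsupp.single_le_iff]; omega), if_pos h]
  · rw [if_pos (by rw [Finsupp.single_le_iff]; omega), if_neg h, mul_one]

lemma coeff_add_uu_mul (e : Fin 3 →₀ ℕ) (X : Ser) :
    coeff (e + single 0 1) (uu * X) = coeff e X := by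
  rw [coeff_uu_mul]; simp

lemma wdeg_sub_single {e : Fin 3 →₀ ℕ} {i : Fin 3} (h : e i ≠ 0) :
    wdeg (e - single i 1) = wdeg e - wdeg (single i 1) := by
  have : e - single i 1 + single i 1 = e :=
    tsub_add_cancel_of_le (by rw [Finsupp.single_le_iff]; omega)
  rw [eq_sub_iff_add_eq, ← wdeg_add, this]

lemma Cong.uu_mul {N : ℤ} {f g : Ser} (h : Cong N f g) : Cong (N + 10) (uu * f) (uu * g) := by
  intro e he
  rw [coeff_uu_mul, coeff_uu_mul]
  split_ifs with h0
  · rfl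
  · apply h
    rw [wdeg_sub_single h0]
    simp only [wdeg, single_apply] at he ⊢
    simp; linarith

/-! ### Integration operators -/

/-- The solution `f` of `u ∂_u f + (k / 2) f = X`; for `k = 0` the one that vanishes on `U₀`. -/
def solveU (k : ℕ) (X : Ser) : Ser := fun e => coeff e X / ((e 0 : ℂ) + k / 2)

/-- The solution of `∂_w f = X` which vanishes on `W₀`. -/
def intW (X : Ser) : Ser := fun e => if e 2 = 0 then 0 else coeff (e - single 2 1) X / (e 2 : ℂ)

/-- The part of a series which is independent of `u`. -/
def onU0 (X : Ser) : Ser := fun e => if e 0 = 0 then coeff e X else 0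

/-- The part of a series which is independent of `w`. -/
def onW0 (X : Ser) : Ser := fun e => if e 2 = 0 then coeff e X else 0

/-- The series `∑ ψ m n u^m v^n`. -/
def ofData (ψ : ℕ → ℕ → ℂ) : Ser := fun e => if e 2 = 0 then ψ (e 0) (e 1) else 0

lemma coeff_solveU (k : ℕ) (X : Ser) (e : Fin 3 →₀ ℕ) :
    coeff e (solveU k X) = coeff e X / ((e 0 : ℂ) + k / 2) := rfl

lemma coeff_intW (X : Ser) (e : Fin 3 →₀ ℕ) :
    coeff e (intW X) = if e 2 = 0 then 0 else coeff (e - single 2 1) X / (e 2 : ℂ) := rfl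

lemma coeff_onU0 (X : Ser) (e : Fin 3 →₀ ℕ) :
    coeff e (onU0 X) = if e 0 = 0 then coeff e X else 0 := rfl

lemma coeff_onW0 (X : Ser) (e : Fin 3 →₀ ℕ) :
    coeff e (onW0 X) = if e 2 = 0 then coeff e X else 0 := rfl

lemma coeff_ofData (ψ : ℕ → ℕ → ℂ) (e : Fin 3 →₀ ℕ) :
    coeff e (ofData ψ) = if e 2 = 0 then ψ (e 0) (e 1) else 0 := rfl

namespace Cong

variable {N : ℤ} {f g : Ser}

lemma solveU (k : ℕ) (h : Cong N f g) : Cong N (solveU k f) (solveU k g) := fun e he => by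
  rw [coeff_solveU, coeff_solveU, h e he]

lemma onU0 (h : Cong N f g) : Cong N (onU0 f) (onU0 g) := fun e he => by
  rw [coeff_onU0, coeff_onU0, h e he]

lemma onW0 (h : Cong N f g) : Cong N (onW0 f) (onW0 g) := fun e he => by
  rw [coeff_onW0, coeff_onW0, h e he]

lemma intW (h : Cong N f g) : Cong (N + 16) (intW f) (intW g) := by
  intro e he
  rw [coeff_intW, coeff_intW]
  split_ifs with h0
  · rfl
  · rw [h]
    rw [wdeg_sub_single h0]
    simp only [wdeg, single_apply] at he ⊢
    simp; linarith

end Cong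

/-! ### The iteration -/

/-- The map whose fixed points are the formal expansions. -/
def step (ψ Ψ : ℕ → ℕ → ℂ) (F : Unknown → Ser) : Unknown → Ser
  | .phi => ofData ψ + intW (Rhs.phi.eval F)
  | .phi_00 => du (F .phi)
  | .S_0 => ofData Ψ + intW (Rhs.S0.eval F)
  | .Om_00 => solveU 0 ((Rhs.all .Om_00).eval F) + onU0 (intW (Rhs.dwOm00.eval F))
  | .R => solveU 0 ((Rhs.all .R).eval F) + onU0 (intW (Rhs.dwR.eval F))
      + onU0 (onW0 (Rhs.valR.eval F))
  | f => solveU (Rhs.shift f) ((Rhs.all f).eval F)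

/-- The unknowns for which `step` uses an equation `u ∂_u f + c f = …` only. -/
def Unknown.Regular (f : Unknown) : Prop :=
  f ≠ .phi ∧ f ≠ .phi_00 ∧ f ≠ .S_0 ∧ f ≠ .Om_00 ∧ f ≠ .R

lemma step_regular (ψ Ψ : ℕ → ℕ → ℂ) (F : Unknown → Ser) {f : Unknown} (hf : f.Regular) :
    step ψ Ψ F f = solveU (Rhs.shift f) ((Rhs.all f).eval F) := by
  obtain ⟨h1, h2, h3, h4, h5⟩ := hf
  cases f <;> first | rfl | contradiction

/-- Equality of all coefficients of rank less than `N`. -/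
def Agree (N : ℤ) (F G : Unknown → Ser) : Prop := ∀ f, Cong (N - f.rank) (F f) (G f)

section

variable {N : ℤ} {F G : Unknown → Ser}

lemma PE.cong (h : Agree N F G) (a : PE) : Cong (N - a.rank) (a.eval F) (a.eval G) := by
  have hp : Cong N (F .phi) (G .phi) := by simpa [Unknown.rank] using h .phi
  induction a with
  | var f => exact h f
  | kap =>
    have hO : Cong (N - 2) (F .Om) (G .Om) := h .Om
    have hp' := hp.mono (show N - 2 ≤ N by omega)
    refine Cong.inv (((Cong.refl _ 1).add hO).sub ?_)
    rw [pow_two, pow_two]; exact hp'.mul hp'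
  | kap0 =>
    simp only [PE.rank, sub_zero]
    refine Cong.inv ((Cong.refl _ 1).sub ?_)
    rw [pow_two, pow_two]; exact hp.mul hp
  | dvphi => simpa [PE.rank] using hp.dv
  | const c => exact Cong.refl _ _
  | add a b ha hb => exact (ha.mono (by simp only [PE.rank]; omega)).add (hb.mono (by simp only [PE.rank]; omega))
  | sub a b ha hb => exact (ha.mono (by simp only [PE.rank]; omega)).sub (hb.mono (by simp only [PE.rank]; omega))
  | neg a ha => exact ha.neg
  | mul a b ha hb => exact (ha.mono (by simp only [PE.rank]; omega)).mul (hb.mono (by simp only [PE.rank]; omega))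

lemma DE.cong (h : Agree N F G) (a : DE) : Cong (N - a.rank) (a.eval F) (a.eval G) := by
  induction a with
  | pol a => exact a.cong h
  | du f => exact (h f).du.mono (by simp only [DE.rank]; omega)
  | dv f => exact (h f).dv
  | dw f => exact (h f).dw.mono (by simp only [DE.rank]; omega)
  | add a b ha hb => exact (ha.mono (by simp only [DE.rank]; omega)).add (hb.mono (by simp only [DE.rank]; omega))
  | sub a b ha hb => exact (ha.mono (by simp only [DE.rank]; omega)).sub (hb.mono (by simp only [DE.rank]; omega))
  | mul a b hb =>
    exact ((a.cong h).mono (by simp only [DE.rank]; omega)).mul (hb.mono (by simp only [DE.rank]; omega))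

lemma EE.cong (h : Agree N F G) (a : EE) : Cong (N - a.rank) (a.eval F) (a.eval G) := by
  induction a with
  | pol a => exact a.cong h
  | u a => exact (a.cong h).uu_mul.mono (by simp only [EE.rank]; omega)
  | dv f => exact (h f).dv
  | add a b ha hb => exact (ha.mono (by simp only [EE.rank]; omega)).add (hb.mono (by simp only [EE.rank]; omega))
  | mul a b hb =>
    exact ((a.cong h).mono (by simp only [EE.rank]; omega)).mul (hb.mono (by simp only [EE.rank]; omega))

/-- A coefficient of rank N in the image depends only on coefficients of rank less than N in the
argument. -/
lemma Agree.step (ψ Ψ : ℕ → ℕ → ℂ) (h : Agree N F G) :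
    Agree (N + 1) (step ψ Ψ F) (step ψ Ψ G) := by
  intro f
  by_cases hf : f.Regular
  · rw [step_regular _ _ _ hf, step_regular _ _ _ hf]
    exact (((Rhs.all f).cong h).solveU _).mono (by linarith [Rhs.rank_all f hf.1])
  · have hcase : f = .phi ∨ f = .phi_00 ∨ f = .S_0 ∨ f = .Om_00 ∨ f = .R := by
      unfold Unknown.Regular at hf; tauto
    rcases hcase with rfl | rfl | rfl | rfl | rfl
    · exact (Cong.refl _ _).add ((Rhs.phi.cong h).intW.mono (by linarith [Rhs.rank_phi]))
    · exact (h .phi).du.mono (by simp only [Unknown.rank]; omega)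
    · exact (Cong.refl _ _).add ((Rhs.S0.cong h).intW.mono (by linarith [Rhs.rank_S0]))
    · exact ((((Rhs.all _).cong h).solveU _).mono
        (by linarith [Rhs.rank_all .Om_00 (by simp)])).add
        ((Rhs.dwOm00.cong h).intW.onU0.mono (by linarith [Rhs.rank_dwOm00]))
    · exact (((((Rhs.all _).cong h).solveU _).mono
        (by linarith [Rhs.rank_all .R (by simp)])).add
        ((Rhs.dwR.cong h).intW.onU0.mono (by linarith [Rhs.rank_dwR]))).add
        ((Rhs.valR.cong h).onW0.onU0.mono (by linarith [Rhs.rank_valR]))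

end

lemma agree_zero (F G : Unknown → Ser) : Agree 0 F G := fun f e he => by
  have := wdeg_nonneg e
  have : 0 ≤ f.rank := by cases f <;> decide
  omega

lemma eq_of_agree {F G : Unknown → Ser} (h : ∀ n : ℕ, Agree n F G) : F = G := by
  funext f
  ext e
  obtain ⟨n, hn⟩ := (wdeg e + f.rank + 1).eq_ofNat_of_zero_le (by
    have := wdeg_nonneg e
    have : 0 ≤ f.rank := by cases f <;> decide
    omega)
  exact h n f e (by omega)

lemma step_fixed_unique {ψ Ψ : ℕ → ℕ → ℂ} {F G : Unknown → Ser} (hF : step ψ Ψ F = F)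
    (hG : step ψ Ψ G = G) : F = G := by
  refine eq_of_agree fun n => ?_
  induction n with
  | zero => exact agree_zero F G
  | succ n ih =>
    have := ih.step ψ Ψ
    rw [hF, hG] at this
    exact_mod_cast this

/-- The iterates of `step`, starting from zero. -/
def iter (ψ Ψ : ℕ → ℕ → ℂ) (n : ℕ) : Unknown → Ser := (step ψ Ψ)^[n] 0

lemma iter_succ (ψ Ψ : ℕ → ℕ → ℂ) (n : ℕ) : iter ψ Ψ (n + 1) = step ψ Ψ (iter ψ Ψ n) :=
  Function.iterate_succ_apply' _ _ _

lemma agree_iter (ψ Ψ : ℕ → ℕ → ℂ) (n k : ℕ) : Agree n (iter ψ Ψ n) (iter ψ Ψ (n + k)) := by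
  induction n with
  | zero => exact agree_zero _ _
  | succ n ih =>
    rw [Nat.add_right_comm, iter_succ, iter_succ]
    exact_mod_cast ih.step ψ Ψ

/-- The fixed point of `step`. -/
def solution (ψ Ψ : ℕ → ℕ → ℂ) : Unknown → Ser := fun f e =>
  -- A coefficient of rank k is final from the iterate k + 1 on.
  coeff e (iter ψ Ψ (wdeg e + f.rank + 1).toNat f)

lemma agree_solution (ψ Ψ : ℕ → ℕ → ℂ) (n : ℕ) : Agree n (iter ψ Ψ n) (solution ψ Ψ) := by
  intro f e he
  have h0 : 0 ≤ f.rank := by cases f <;> decide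
  have h1 := wdeg_nonneg e
  change _ = coeff e (iter ψ Ψ (wdeg e + f.rank + 1).toNat f)
  obtain ⟨k, hk⟩ : ∃ k : ℕ, n = (wdeg e + f.rank + 1).toNat + k :=
    ⟨n - (wdeg e + f.rank + 1).toNat, by omega⟩
  rw [hk]
  exact (agree_iter ψ Ψ _ k f e (by omega)).symm

lemma step_solution (ψ Ψ : ℕ → ℕ → ℂ) : step ψ Ψ (solution ψ Ψ) = solution ψ Ψ := by
  refine eq_of_agree fun n => ?_
  have h1 := (agree_solution ψ Ψ n).step ψ Ψ
  rw [← iter_succ] at h1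
  have h2 := agree_solution ψ Ψ (n + 1)
  intro f e he
  rw [← h1 f e (by omega), h2 f e (by push_cast; omega)]

/-! ### The equations in solved form -/

namespace Rhs

variable (F : Unknown → Ser)

@[simp] lemma eval_lam00 : lam00.eval F = NullCone.lam00 F := by
  simp [lam00, NullCone.lam00]

@[simp] lemma eval_lam01 : lam01.eval F = NullCone.lam01 F := by
  simp [lam01, NullCone.lam01]

@[simp] lemma eval_lam11 : lam11.eval F = NullCone.lam11 F := by
  simp [lam11, NullCone.lam11]

@[simp] lemma eval_detOm : detOm.eval F = NullCone.detOm F := by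
  simp [detOm, NullCone.detOm]

@[simp] lemma eval_detPhi : detPhi.eval F = NullCone.detPhi F := by
  simp [detPhi, NullCone.detPhi]

@[simp] lemma eval_mixed : mixed.eval F = NullCone.mixed F := by
  simp [mixed, NullCone.mixed]

@[simp] lemma eval_half : half.eval F = NullCone.half F := by
  simp [half, NullCone.half]

@[simp] lemma eval_conOm (a b c : PE) :
    (conOm a b c).eval F = NullCone.conOm F (a.eval F) (b.eval F) (c.eval F) := by
  simp [conOm, NullCone.conOm]

@[simp] lemma eval_conPhi (a b c : PE) :
    (conPhi a b c).eval F = NullCone.conPhi F (a.eval F) (b.eval F) (c.eval F) := by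
  simp [conPhi, NullCone.conPhi]

@[simp] lemma eval_brack (a b : PE) :
    (brack a b).eval F = NullCone.brack F (a.eval F) (b.eval F) := by
  simp [brack, NullCone.brack]

@[simp] lemma eval_hat01 (f : Unknown) :
    (hat01 f).eval F = F .e1_01 * du (F f) + F .e2_01 * dv (F f) := by
  simp [hat01]

@[simp] lemma eval_e11 (f : Unknown) : (e11 f).eval F = NullCone.e11 F (F f) := by
  simp [e11, NullCone.e11]

@[simp] lemma eval_E1 : E1.eval F = du (F .phi_11) - phi11.eval F := by
  simp [E1]

end Rhs

lemma uu_ne_zero : uu ≠ 0 := by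
  intro h
  have := congrArg (coeff (single 0 1)) h
  simp [uu, MvPowerSeries.coeff_X] at this

lemma C_half_mul_two : (C (1 / 2 : ℂ) : Ser) * 2 = 1 := by
  rw [show (2 : Ser) = C 2 from (map_ofNat _ 2).symm, ← map_mul]; norm_num

lemma C_shift (k : ℕ) : (C ((k : ℂ) / 2) : Ser) = (k : Ser) * (C (1 / 2 : ℂ) : Ser) := by
  rw [show ((k : ℂ) / 2) = k * (1 / 2) by ring, map_mul, map_natCast]

/-- The equation `u ∂_u f + c f = …` for the unknown `f`. -/
def SolvedEq (F : Unknown → Ser) (f : Unknown) : Prop :=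
  uu * du (F f) + (Rhs.shift f : Ser) * (C (1 / 2 : ℂ) : Ser) * F f = (Rhs.all f).eval F

section

variable {F : Unknown → Ser}

lemma uu_mul_E1 (h : DuEquations F) : uu * Rhs.E1.eval F = uD01phi01 F := by
  have := h.Phi_10
  simp only [Rhs.phi11, PE.eval_add, PE.eval_sub, PE.eval_neg, PE.eval_mul, PE.eval_smul,
    PE.eval_var, PE.eval_pow, PE.eval_one, PE.eval_ofNat, PE.eval_kap, Rhs.eval_lam01, Rhs.eval_E1] at this ⊢
  linear_combination this

/-- Each solved equation is a rearrangement of the original one, multiplied by u where no 1/u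
occurred. Beyond that only C (1/2) * 2 = 1 and the replacement of E_1 in the equations for S_2 and
S_3 enter. -/
lemma DuEquations.solvedEq (h : DuEquations F) (f : Unknown)
    (hf : f ≠ .phi ∧ f ≠ .phi_00 ∧ f ≠ .S_0) : SolvedEq F f := by
  have h2 := C_half_mul_two
  have hE := uu_mul_E1 h
  obtain ⟨h1, h3, h4⟩ := hf
  cases f <;> try contradiction
  all_goals simp only [SolvedEq, Rhs.all, Rhs.shift, Rhs.S1, Rhs.S2, Rhs.S3, Rhs.S4, Rhs.R, Rhs.Om00, Rhs.Om01,
    Rhs.Om11, Rhs.phi11, EE.eval_add, EE.eval_smul, EE.eval_dv, EE.eval_mul, EE.eval_u, EE.eval_pol,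
    DE.eval_add, DE.eval_sub, DE.eval_smul, DE.eval_mul, DE.eval_du, DE.eval_pol, PE.eval_add,
    PE.eval_sub, PE.eval_neg, PE.eval_mul, PE.eval_smul, PE.eval_var, PE.eval_pow, PE.eval_one,
    PE.eval_ofNat, PE.eval_kap, Rhs.eval_lam00, Rhs.eval_lam01, Rhs.eval_lam11, Rhs.eval_detOm,
    Rhs.eval_detPhi, Rhs.eval_mixed, Rhs.eval_half, Rhs.eval_conOm, Rhs.eval_conPhi,
    Rhs.eval_brack, Rhs.eval_hat01, Rhs.eval_e11, smul_eq_C_mul,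
    Nat.cast_zero, Nat.cast_one, Nat.cast_ofNat, zero_mul, add_zero]
  case e1_01 =>
    have := h.t_01_1
    linear_combination this + F .e1_01 * h2
  case e2_01 =>
    have := h.t_01_2
    linear_combination this + F .e2_01 * h2
  case e1_11 =>
    have := h.t_11_1
    linear_combination uu * this
  case e2_11 =>
    have := h.t_11_2
    linear_combination this
  case G_0100 =>
    have := h.R_0001
    simp only [smul_eq_C_mul, uhat01, uD01phi11] at this
    linear_combination this + 2 * F .G_0100 * h2
  case G_0101 =>
    have := h.R_0101
    simp only [smul_eq_C_mul, uhat01, uD01phi11] at this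
    linear_combination this + F .G_0101 * h2
  case G_0111 =>
    have := h.R_1101
    simp only [smul_eq_C_mul, uhat01, uD01phi11] at this
    linear_combination this + F .G_0111 * h2
  case G_1100 =>
    have := h.R_0011
    linear_combination this + F .G_1100 * h2
  case G_1101 =>
    have := h.R_0111
    simp only [smul_eq_C_mul, uhat01, uD01phi11] at this
    linear_combination uu * this
  case G_1111 =>
    have := h.R_1111
    linear_combination uu * this
  case Om =>
    have := h.Sigma_00
    linear_combination uu * this
  case phi_01 =>
    have := h.Phi_00
    simp only [smul_eq_C_mul, uhat01, uD01phi11] at this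
    linear_combination this
  case phi_11 =>
    have := h.Phi_10
    simp only [smul_eq_C_mul, uhat01, uD01phi01, uD01phi11] at this
    linear_combination this
  case Om_00 =>
    have := h.Sigma_0000
    linear_combination uu * this
  case Om_01 =>
    have := h.Sigma_0001
    linear_combination uu * this
  case Om_11 =>
    have := h.Sigma_0011
    simp only [smul_eq_C_mul, uhat01, uD01phi11] at this
    linear_combination uu * this
  case R =>
    have := h.Pi_00
    simp only [smul_eq_C_mul, uhat01, uD01phi11] at this
    linear_combination uu * this
  case S_1 =>
    have := h.H_0000
    simp only [smul_eq_C_mul, uhat01, uD01phi11] at this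
    linear_combination this
  case S_2 =>
    have := h.H_0001
    simp only [smul_eq_C_mul, uhat01, uD01phi11] at this
    linear_combination this + -C (1 / 3) * kap F * 2 * F .Om * lam00 F * hE
  case S_3 =>
    have := h.H_0011
    simp only [smul_eq_C_mul, uhat01, uD01phi11] at this
    linear_combination this + C (1 / 3) * kap F * 2 * (2 + 3 * F .Om) * lam01 F * hE
  case S_4 =>
    have := h.H_0111
    simp only [smul_eq_C_mul, uhat01, uD01phi11] at this
    linear_combination this

/-- The power series ring is a domain, so the extra factors u introduced in the solved form can be
cancelled. The equation for φ_11 first gives back the meaning of E_1. -/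
lemma duEquations_of_solvedEq (h0 : du (F .phi) = F .phi_00)
    (h : ∀ f : Unknown, f ≠ .phi ∧ f ≠ .phi_00 ∧ f ≠ .S_0 → SolvedEq F f) : DuEquations F := by
  have h2 := C_half_mul_two
  have e1_01 := h .e1_01 (by simp)
  have e2_01 := h .e2_01 (by simp)
  have e1_11 := h .e1_11 (by simp)
  have e2_11 := h .e2_11 (by simp)
  have G_0100 := h .G_0100 (by simp)
  have G_0101 := h .G_0101 (by simp)
  have G_0111 := h .G_0111 (by simp)
  have G_1100 := h .G_1100 (by simp)
  have G_1101 := h .G_1101 (by simp)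
  have G_1111 := h .G_1111 (by simp)
  have Om := h .Om (by simp)
  have phi_01 := h .phi_01 (by simp)
  have phi_11 := h .phi_11 (by simp)
  have Om_00 := h .Om_00 (by simp)
  have Om_01 := h .Om_01 (by simp)
  have Om_11 := h .Om_11 (by simp)
  have R := h .R (by simp)
  have S_1 := h .S_1 (by simp)
  have S_2 := h .S_2 (by simp)
  have S_3 := h .S_3 (by simp)
  have S_4 := h .S_4 (by simp)
  have hE : uu * Rhs.E1.eval F = uD01phi01 F := by
    simp only [uD01phi01, uhat01, Rhs.eval_E1]
    simp only [SolvedEq, Rhs.all, Rhs.shift, Rhs.S1, Rhs.S2, Rhs.S3, Rhs.S4, Rhs.R, Rhs.Om00, Rhs.Om01,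
    Rhs.Om11, Rhs.phi11, EE.eval_add, EE.eval_smul, EE.eval_dv, EE.eval_mul, EE.eval_u, EE.eval_pol,
    DE.eval_add, DE.eval_sub, DE.eval_smul, DE.eval_mul, DE.eval_du, DE.eval_pol, PE.eval_add,
    PE.eval_sub, PE.eval_neg, PE.eval_mul, PE.eval_smul, PE.eval_var, PE.eval_pow, PE.eval_one,
    PE.eval_ofNat, PE.eval_kap, Rhs.eval_lam00, Rhs.eval_lam01, Rhs.eval_lam11, Rhs.eval_detOm,
    Rhs.eval_detPhi, Rhs.eval_mixed, Rhs.eval_half, Rhs.eval_conOm, Rhs.eval_conPhi,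
    Rhs.eval_brack, Rhs.eval_hat01, Rhs.eval_e11, smul_eq_C_mul,
    Nat.cast_zero, Nat.cast_one, Nat.cast_ofNat, zero_mul, add_zero] at phi_11 ⊢
    linear_combination phi_11
  simp only [SolvedEq, Rhs.all, Rhs.shift, Rhs.S1, Rhs.S2, Rhs.S3, Rhs.S4, Rhs.R, Rhs.Om00, Rhs.Om01,
    Rhs.Om11, Rhs.phi11, EE.eval_add, EE.eval_smul, EE.eval_dv, EE.eval_mul, EE.eval_u, EE.eval_pol,
    DE.eval_add, DE.eval_sub, DE.eval_smul, DE.eval_mul, DE.eval_du, DE.eval_pol, PE.eval_add,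
    PE.eval_sub, PE.eval_neg, PE.eval_mul, PE.eval_smul, PE.eval_var, PE.eval_pow, PE.eval_one,
    PE.eval_ofNat, PE.eval_kap, Rhs.eval_lam00, Rhs.eval_lam01, Rhs.eval_lam11, Rhs.eval_detOm,
    Rhs.eval_detPhi, Rhs.eval_mixed, Rhs.eval_half, Rhs.eval_conOm, Rhs.eval_conPhi,
    Rhs.eval_brack, Rhs.eval_hat01, Rhs.eval_e11, smul_eq_C_mul,
    Nat.cast_zero, Nat.cast_one, Nat.cast_ofNat, zero_mul, add_zero] at e1_01 e2_01 e1_11 e2_11 G_0100 G_0101 G_0111 G_1100 G_1101 G_1111 Om phi_01 phi_11 Om_00 Om_01 Om_11 R S_1 S_2 S_3 S_4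
  constructor
  case A_00 => exact h0
  case t_01_1 =>
    linear_combination e1_01 - F .e1_01 * h2
  case t_01_2 =>
    linear_combination e2_01 - F .e2_01 * h2
  case t_11_1 =>
    refine mul_left_cancel₀ uu_ne_zero ?_
    linear_combination e1_11
  case t_11_2 =>
    linear_combination e2_11
  case R_0001 =>
    simp only [smul_eq_C_mul, uhat01, uD01phi11]
    linear_combination G_0100 - 2 * F .G_0100 * h2
  case R_0101 =>
    simp only [smul_eq_C_mul, uhat01, uD01phi11]
    linear_combination G_0101 - F .G_0101 * h2
  case R_1101 =>
    simp only [smul_eq_C_mul, uhat01, uD01phi11]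
    linear_combination G_0111 - F .G_0111 * h2
  case R_0011 =>
    linear_combination G_1100 - F .G_1100 * h2
  case R_0111 =>
    refine mul_left_cancel₀ uu_ne_zero ?_
    simp only [smul_eq_C_mul, uhat01, uD01phi11]
    linear_combination G_1101
  case R_1111 =>
    refine mul_left_cancel₀ uu_ne_zero ?_
    linear_combination G_1111
  case Sigma_00 =>
    refine mul_left_cancel₀ uu_ne_zero ?_
    linear_combination Om
  case Phi_00 =>
    simp only [smul_eq_C_mul, uhat01, uD01phi11]
    linear_combination phi_01
  case Phi_10 =>
    simp only [smul_eq_C_mul, uhat01, uD01phi11, uD01phi01]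
    linear_combination phi_11
  case Sigma_0000 =>
    refine mul_left_cancel₀ uu_ne_zero ?_
    linear_combination Om_00
  case Sigma_0001 =>
    refine mul_left_cancel₀ uu_ne_zero ?_
    linear_combination Om_01
  case Sigma_0011 =>
    refine mul_left_cancel₀ uu_ne_zero ?_
    simp only [smul_eq_C_mul, uhat01, uD01phi11]
    linear_combination Om_11
  case Pi_00 =>
    refine mul_left_cancel₀ uu_ne_zero ?_
    simp only [smul_eq_C_mul, uhat01, uD01phi11]
    linear_combination R
  case H_0000 =>
    simp only [smul_eq_C_mul, uhat01, uD01phi11]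
    linear_combination S_1
  case H_0001 =>
    simp only [smul_eq_C_mul, uhat01, uD01phi11]
    linear_combination S_2 + C (1 / 3) * kap F * 2 * F .Om * lam00 F * hE
  case H_0011 =>
    simp only [smul_eq_C_mul, uhat01, uD01phi11]
    linear_combination S_3 - C (1 / 3) * kap F * 2 * (2 + 3 * F .Om) * lam01 F * hE
  case H_0111 =>
    simp only [smul_eq_C_mul, uhat01, uD01phi11]
    linear_combination S_4

/-- In the equation for S_0 the factor 1/u enters through E_1 only; with E_1 replaced by its regular
expression the whole equation is divisible by u. -/
lemma dwEquations_iff (h0 : du (F .phi) = F .phi_00) (hE : uu * Rhs.E1.eval F = uD01phi01 F) :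
    DwEquations F ↔ dw (F .phi) = Rhs.phi.eval F ∧ dw (F .S_0) = Rhs.S0.eval F := by
  constructor
  · rintro ⟨hA, hH⟩
    constructor
    · simp only [Rhs.phi, PE.eval_sub, PE.eval_mul, PE.eval_var, PE.eval_dvphi, e11] at hA ⊢
      linear_combination hA - F .e1_11 * h0
    · refine mul_left_cancel₀ uu_ne_zero ?_
      simp only [Rhs.S0, DE.eval_add, DE.eval_sub, DE.eval_smul, DE.eval_mul, DE.eval_du,
    DE.eval_dv, DE.eval_pol, PE.eval_add, PE.eval_sub, PE.eval_neg, PE.eval_mul, PE.eval_smul,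
    PE.eval_var, PE.eval_pow, PE.eval_one, PE.eval_ofNat, PE.eval_kap, Rhs.eval_lam00,
    Rhs.eval_lam01, Rhs.eval_lam11, Rhs.eval_half, Rhs.eval_conOm, Rhs.eval_conPhi,
    Rhs.eval_brack, smul_eq_C_mul, e11] at hH ⊢
      linear_combination hH + C (1 / 3) * kap F * 2 * F .Om * lam00 F * hE
  · rintro ⟨hA, hH⟩
    constructor
    · simp only [Rhs.phi, PE.eval_sub, PE.eval_mul, PE.eval_var, PE.eval_dvphi, e11] at hA ⊢
      linear_combination hA + F .e1_11 * h0
    · simp only [Rhs.S0, DE.eval_add, DE.eval_sub, DE.eval_smul, DE.eval_mul, DE.eval_du,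
    DE.eval_dv, DE.eval_pol, PE.eval_add, PE.eval_sub, PE.eval_neg, PE.eval_mul, PE.eval_smul,
    PE.eval_var, PE.eval_pow, PE.eval_one, PE.eval_ofNat, PE.eval_kap, Rhs.eval_lam00,
    Rhs.eval_lam01, Rhs.eval_lam11, Rhs.eval_half, Rhs.eval_conOm, Rhs.eval_conPhi,
    Rhs.eval_brack, smul_eq_C_mul, e11] at hH ⊢
      linear_combination uu * hH - C (1 / 3) * kap F * 2 * F .Om * lam00 F * hE

end

/-! ### Fixed points of `step` and formal expansions -/

@[simp] lemma expo_zero (m n p : ℕ) : expo m n p 0 = m := by simp [expo]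
@[simp] lemma expo_one (m n p : ℕ) : expo m n p 1 = n := by simp [expo]
@[simp] lemma expo_two (m n p : ℕ) : expo m n p 2 = p := by simp [expo]

lemma expo_eq (e : Fin 3 →₀ ℕ) : expo (e 0) (e 1) (e 2) = e := by
  ext i; fin_cases i <;> simp

lemma coef_eq (f : Ser) (e : Fin 3 →₀ ℕ) : coef f (e 0) (e 1) (e 2) = coeff e f := by
  rw [coef, expo_eq]

/-- Equality on U_0 is congruence modulo the ideal generated by u, so products can be handled by
exhibiting quotients. -/
lemma eqOnU0_iff {f g : Ser} : EqOnU0 f g ↔ uu ∣ f - g := by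
  rw [uu, MvPowerSeries.X_dvd_iff]
  constructor
  · intro h e he
    rw [map_sub, ← coef_eq, ← coef_eq, he, h, sub_self]
  · intro h n p
    have := h (expo 0 n p) (by simp)
    rwa [map_sub, sub_eq_zero] at this

lemma EqOnU0.coeff {f g : Ser} (h : EqOnU0 f g) {e : Fin 3 →₀ ℕ} (he : e 0 = 0) :
    MvPowerSeries.coeff e f = MvPowerSeries.coeff e g := by
  rw [← coef_eq, ← coef_eq, he, h]

lemma coeff_du (f : Ser) (e : Fin 3 →₀ ℕ) :
    coeff e (du f) = coeff (e + single 0 1) f * (e 0 + 1) := coeff_pderiv f e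

lemma coeff_dv (f : Ser) (e : Fin 3 →₀ ℕ) :
    coeff e (dv f) = coeff (e + single 1 1) f * (e 1 + 1) := coeff_pderiv f e

lemma coeff_dw (f : Ser) (e : Fin 3 →₀ ℕ) :
    coeff e (dw f) = coeff (e + single 2 1) f * (e 2 + 1) := coeff_pderiv f e

lemma EqOnU0.dv {f g : Ser} (h : EqOnU0 f g) : EqOnU0 (dv f) (dv g) := fun n p => by
  simp only [coef]
  rw [coeff_dv, coeff_dv, h.coeff (by simp)]

lemma dv_du (f : Ser) : dv (du f) = du (dv f) := by
  ext e
  rw [coeff_dv, coeff_du, coeff_du, coeff_dv, add_right_comm]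
  simp
  ring

lemma dv_smul (c : ℂ) (f : Ser) : dv (c • f) = c • dv f := by
  ext e
  simp [coeff_dv, mul_assoc]

lemma sub_single_add {e : Fin 3 →₀ ℕ} {i : Fin 3} (h : e i ≠ 0) :
    e - single i 1 + single i 1 = e :=
  tsub_add_cancel_of_le (by rw [Finsupp.single_le_iff]; omega)

lemma coeff_uu_mul_du (f : Ser) (e : Fin 3 →₀ ℕ) :
    coeff e (uu * du f) = e 0 * coeff e f := by
  rw [coeff_uu_mul]
  split_ifs with h
  · simp [h]
  · rw [coeff_du, sub_single_add h, mul_comm]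
    simp only [coe_tsub, Pi.sub_apply, single_eq_same]
    rw [Nat.cast_sub (by omega)]; simp

lemma coeff_shift (k : ℕ) (f : Ser) (e : Fin 3 →₀ ℕ) :
    coeff e (uu * du f + (k : Ser) * (C (1 / 2 : ℂ) : Ser) * f)
      = (e 0 + k / 2) * coeff e f := by
  rw [← C_shift, map_add, coeff_uu_mul_du, coeff_C_mul]; ring

lemma shift_ne_zero {m k : ℕ} (h : ¬(m = 0 ∧ k = 0)) : (m + k / 2 : ℂ) ≠ 0 := by
  have : ((2 * m + k : ℕ) : ℂ) ≠ 0 := by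
    rw [Nat.cast_ne_zero]; omega
  intro h'
  apply this
  push_cast
  linear_combination 2 * h'

lemma eq_solveU {k : ℕ} {f X : Ser} (h : uu * du f + (k : Ser) * (C (1 / 2 : ℂ) : Ser) * f = X)
    (h0 : k = 0 → EqOnU0 f 0) : solveU k X = f := by
  ext e
  rw [coeff_solveU, ← h, coeff_shift]
  by_cases he : e 0 = 0 ∧ k = 0
  · rw [(h0 he.2).coeff he.1]; simp
  · rw [mul_div_cancel_left₀ _ (shift_ne_zero he)]

/-- The operator u ∂_u annihilates exactly the series independent of u; that part has to be added
back. -/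
lemma eq_solveU_add {f X : Ser} (h : uu * du f + ((0 : ℕ) : Ser) * (C (1 / 2 : ℂ) : Ser) * f = X) :
    solveU 0 X + onU0 f = f := by
  ext e
  rw [map_add, coeff_solveU, ← h, coeff_shift, coeff_onU0]
  by_cases he : e 0 = 0
  · simp [he]
  · rw [mul_div_cancel_left₀ _ (shift_ne_zero (by tauto)), if_neg he, add_zero]

lemma intW_dw (f : Ser) : intW (dw f) + onW0 f = f := by
  ext e
  rw [map_add, coeff_intW, coeff_onW0]
  split_ifs with h
  · simp
  · rw [coeff_dw, sub_single_add h]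
    simp only [coe_tsub, Pi.sub_apply, single_eq_same]
    rw [Nat.cast_sub (by omega)]
    have : (e 2 : ℂ) ≠ 0 := by exact_mod_cast h
    field_simp; simp

lemma dw_intW (X : Ser) : dw (intW X) = X := by
  ext e
  rw [coeff_dw, coeff_intW, if_neg (by simp), add_tsub_cancel_right]
  have : (e 2 : ℂ) + 1 ≠ 0 := by exact_mod_cast Nat.succ_ne_zero (e 2)
  simp; field_simp

lemma onU0_add (f g : Ser) : onU0 (f + g) = onU0 f + onU0 g := by
  ext e; simp only [map_add, coeff_onU0]; split_ifs <;> simp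

lemma EqOnU0.onU0_intW {f g : Ser} (h : EqOnU0 f g) : onU0 (intW f) = onU0 (intW g) := by
  ext e
  rw [coeff_onU0, coeff_onU0, coeff_intW, coeff_intW]
  split_ifs with h0 h2
  · rfl
  · rw [h.coeff (by simp [h0])]
  · rfl

lemma EqOnI.onU0_onW0 {f g : Ser} (h : EqOnI f g) : onU0 (onW0 f) = onU0 (onW0 g) := by
  ext e
  rw [coeff_onU0, coeff_onU0, coeff_onW0, coeff_onW0]
  split_ifs with h0 h2
  · rw [← coef_eq, ← coef_eq, h0, h2, h]
  · rfl
  · rfl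

lemma onW0_eq_ofData {ψ : ℕ → ℕ → ℂ} {f : Ser} (h : ∀ m n, coef f m n 0 = ψ m n) :
    onW0 f = ofData ψ := by
  ext e
  rw [coeff_onW0, coeff_ofData]
  split_ifs with h0
  · rw [← h, ← coef_eq, h0]
  · rfl

lemma EqOnU0.eqOnI {f g : Ser} (h : EqOnU0 f g) : EqOnI f g := fun n => h n 0

lemma eqOnU0_valR {F : Unknown → Ser} (h0 : du (F .phi) = F .phi_00)
    (h1 : EqOnU0 (F .phi_01) ((1 / 2 : ℂ) • du (dv (F .phi))))
    (h2 : EqOnU0 (F .phi_11) ((1 / 2 : ℂ) • du (dv (dv (F .phi))))) :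
    EqOnU0 (Rhs.valR.eval F)
      (-6 - 8 * du (F .phi) * du (dv (dv (F .phi))) + 4 * du (dv (F .phi)) ^ 2) := by
  rw [eqOnU0_iff] at *
  obtain ⟨a, ha⟩ := h1
  obtain ⟨b, hb⟩ := h2
  simp only [Rhs.valR, PE.eval_add, PE.eval_sub, PE.eval_neg, PE.eval_mul, PE.eval_var,
    PE.eval_pow, PE.eval_ofNat, smul_eq_C_mul] at *
  have h := C_half_mul_two
  -- The second summand is the factorisation of φ_01² - c² with c = ½ ∂_u∂_vφ, where φ_01 - c = u a.
  refine ⟨-16 * F .phi_00 * b + 16 * a * (F .phi_01 + C (1 / 2) * du (dv (F .phi))), ?_⟩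
  linear_combination -16 * F .phi_00 * hb + 16 * (F .phi_01 + C (1 / 2) * du (dv (F .phi))) * ha
    + 8 * du (dv (dv (F .phi))) * h0 - 8 * F .phi_00 * du (dv (dv (F .phi))) * h
    + 4 * du (dv (F .phi)) ^ 2 * (C (1 / 2) * 2 + 1) * h

lemma eval_dwOm00 (F : Unknown → Ser) : Rhs.dwOm00.eval F = -((1 / 3 : ℂ) • F .R)
      + (8 / 3 : ℂ) • ((1 - F .phi ^ 2)⁻¹ * (F .phi * F .Om_00 * F .phi_11
          - 2 * F .phi_00 * F .phi_11 + 2 * F .phi_01 ^ 2)) := by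
  simp [Rhs.dwOm00]

lemma eval_dwR (F : Unknown → Ser) : Rhs.dwR.eval F = 3 * F .Om_00 * F .S_4
      + 8 * (1 - F .phi ^ 2)⁻¹ * ((F .phi * F .Om_00 - 2 * F .phi_00) * dw (F .phi_11)
          + 4 * F .phi_01 * dw (F .phi_01) - 2 * F .phi_11 * dw (F .phi_00)
          - (1 / 3 : ℂ) • (F .phi * F .R * F .phi_11))
      + (8 / 3 : ℂ) • ((1 - F .phi ^ 2)⁻¹ ^ 2 * F .phi_11 * (
          (3 + 11 * F .phi ^ 2) * F .Om_00 * F .phi_11 - 28 * F .phi * detPhi F)) := by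
  simp [Rhs.dwR]

/-- No growth or vanishing property of the series enters here, so uniqueness holds among all formal
series. -/
theorem IsFormalExpansion.step_eq {ψ Ψ : ℕ → ℕ → ℂ} {F : Unknown → Ser}
    (h : IsFormalExpansion ψ Ψ F) : step ψ Ψ F = F := by
  have hu := h.du_equations
  have h0 := hu.A_00
  have hw := (dwEquations_iff h0 (uu_mul_E1 hu)).1 h.dw_equations
  have hi := h.initial
  funext f
  by_cases hf : f.Regular
  · rw [step_regular _ _ _ hf]
    refine eq_solveU (hu.solvedEq f ⟨hf.1, hf.2.1, hf.2.2.1⟩) ?_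
    obtain ⟨h1, h2, h3, h4, h5⟩ := hf
    cases f <;> simp [Rhs.shift] at h1 h2 h3 h4 h5 ⊢
    -- These are the regular unknowns with c = 0, for which the equation does not determine the
    -- value on U_0.
    exacts [hi.e1_11, hi.e2_11, hi.G_1101, hi.G_1111, hi.Om, hi.Om_01, hi.Om_11]
  · have hcase : f = .phi ∨ f = .phi_00 ∨ f = .S_0 ∨ f = .Om_00 ∨ f = .R := by
      unfold Unknown.Regular at hf; tauto
    rcases hcase with rfl | rfl | rfl | rfl | rfl
    · change ofData ψ + intW (Rhs.phi.eval F) = F .phi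
      rw [← hw.1, ← onW0_eq_ofData h.data_phi, add_comm, intW_dw]
    · exact h0
    · change ofData Ψ + intW (Rhs.S0.eval F) = F .S_0
      rw [← hw.2, ← onW0_eq_ofData h.data_S_0, add_comm, intW_dw]
    · change solveU 0 _ + onU0 (intW _) = F .Om_00
      conv_rhs => rw [← eq_solveU_add (hu.solvedEq .Om_00 (by simp))]
      -- The value on U_0 is the integral of the transport equation in w plus the value on I.
      conv_rhs => rw [← intW_dw (F .Om_00)]
      rw [onU0_add, hi.Om_00.onU0_onW0, hi.dw_Om_00.onU0_intW, eval_dwOm00]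
      have : onU0 (onW0 (0 : Ser)) = 0 := by ext e; simp [coeff_onU0, coeff_onW0]
      rw [this, add_zero]
    · change solveU 0 _ + onU0 (intW _) + onU0 (onW0 _) = F .R
      conv_rhs => rw [← eq_solveU_add (hu.solvedEq .R (by simp))]
      conv_rhs => rw [← intW_dw (F .R)]
      rw [onU0_add, hi.R.onU0_onW0, hi.dw_R.onU0_intW, eval_dwR,
        (eqOnU0_valR h0 hi.phi_01 hi.phi_11).eqOnI.onU0_onW0, add_assoc]

/-! ### From fixed points back to formal expansions. -/

section

variable {ψ Ψ : ℕ → ℕ → ℂ} {F : Unknown → Ser}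

lemma EqOnU0.solveU_zero {X : Ser} : EqOnU0 (solveU 0 X) 0 := fun n p => by
  simp [coef, coeff_solveU]

/-- For k = 0 the operator `solveU` discards the part of X on U_0, so the equation can be recovered
only if that part vanishes. -/
lemma solvedEq_of_solveU {k : ℕ} {f X Y : Ser} (h : solveU k X + onU0 Y = f)
    (hX : k = 0 → EqOnU0 X 0) (hY : k ≠ 0 → onU0 Y = 0) :
    uu * du f + (k : Ser) * (C (1 / 2 : ℂ) : Ser) * f = X := by
  ext e
  rw [coeff_shift, ← h]
  by_cases he : e 0 = 0 ∧ k = 0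
  · rw [(hX he.2).coeff he.1, he.1, he.2]; simp
  · have h0 : coeff e (onU0 Y) = 0 := by
      by_cases hk : k = 0
      · rw [coeff_onU0, if_neg (by tauto)]
      · rw [hY hk]; simp
    rw [map_add, h0, add_zero, coeff_solveU, mul_div_cancel₀ _ (shift_ne_zero he)]

lemma eqOnU0_uu_mul (X : Ser) : EqOnU0 (uu * X) 0 := by
  rw [eqOnU0_iff, sub_zero]; exact dvd_mul_right _ _

lemma solvedEq_of_step (h : step ψ Ψ F = F) (f : Unknown)
    (hf : f ≠ .phi ∧ f ≠ .phi_00 ∧ f ≠ .S_0) : SolvedEq F f := by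
  have h1 : EqOnU0 (F .G_1100) 0 := by
    have h2 : solveU 2 ((Rhs.all .G_1100).eval F) = F .G_1100 := congrFun h .G_1100
    intro n p
    rw [← h2, coef, coeff_solveU, Rhs.all, EE.eval_u, coeff_uu_mul]
    simp [coef]
  have hX : Rhs.shift f = 0 → EqOnU0 ((Rhs.all f).eval F) 0 := by
    intro hs
    cases f <;> simp only [Rhs.shift, reduceCtorEq, OfNat.ofNat_ne_zero, one_ne_zero, ne_eq,
      not_true_eq_false, false_and, and_false] at hs hf
    all_goals try exact eqOnU0_uu_mul _
    -- Only ê^2_11 is left: its right-hand side contains Γ̂_1100 without a factor u, and Γ̂_1100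
    -- vanishes on U_0 by its own equation. All other right-hand sides with c = 0 are multiples of
    -- u.
    rw [eqOnU0_iff] at *
    obtain ⟨a, ha⟩ := h1
    rw [sub_zero] at ha ⊢
    rw [Rhs.all, EE.eval_add, EE.eval_u, EE.eval_pol, PE.eval_var, ha, ← mul_add]
    exact dvd_mul_right _ _
  have h0 : onU0 (0 : Ser) = 0 := by ext e; simp [coeff_onU0]
  have hs := congrFun h f
  by_cases hr : f.Regular
  · rw [step_regular _ _ _ hr] at hs
    exact solvedEq_of_solveU (Y := 0) (by rw [h0, add_zero, hs]) hX fun _ => h0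
  · have hcase : f = .Om_00 ∨ f = .R := by
      unfold Unknown.Regular at hr; tauto
    rcases hcase with rfl | rfl
    · exact solvedEq_of_solveU hs hX fun h => absurd rfl h
    · refine solvedEq_of_solveU (Y := intW (Rhs.dwR.eval F) + onW0 (Rhs.valR.eval F))
        ?_ hX fun h => absurd rfl h
      rw [onU0_add, ← add_assoc]; exact hs

lemma dw_ofData_add_intW (ψ : ℕ → ℕ → ℂ) (X : Ser) : dw (ofData ψ + intW X) = X := by
  have h : dw (ofData ψ) = 0 := by
    ext e; rw [coeff_dw, coeff_ofData]; simp
  rw [dw, map_add]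
  change dw _ + dw _ = X
  rw [h, dw_intW, zero_add]

lemma coef_ofData_add_intW (ψ : ℕ → ℕ → ℂ) (X : Ser) (m n : ℕ) :
    coef (ofData ψ + intW X) m n 0 = ψ m n := by
  simp [coef, coeff_ofData, coeff_intW]

lemma EqOnU0.add_uu_mul {X Y Z : Ser} (h : EqOnU0 X Y) : EqOnU0 (X + uu * Z) Y := by
  rw [eqOnU0_iff] at *
  obtain ⟨a, ha⟩ := h
  exact ⟨a + Z, by linear_combination ha⟩

lemma EqOnU0.add_mul_zero {X Y Z W : Ser} (h : EqOnU0 X Y) (h' : EqOnU0 Z 0) :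
    EqOnU0 (X + W * Z) Y := by
  rw [eqOnU0_iff] at *
  obtain ⟨a, ha⟩ := h
  obtain ⟨b, hb⟩ := h'
  exact ⟨a + W * b, by linear_combination ha + W * hb⟩

lemma EqOnU0.smul {X Y : Ser} (c : ℂ) (h : EqOnU0 X Y) : EqOnU0 (c • X) (c • Y) := fun n p => by
  have := h n p
  simp only [coef] at *
  simp [this]

lemma EqOnU0.refl (X : Ser) : EqOnU0 X X := fun _ _ => rfl

/-- On U_0 the term u ∂_u f drops out and the equation is algebraic for f. -/
lemma SolvedEq.eqOnU0 {f : Unknown} (h : SolvedEq F f) {X : Ser} (hk : Rhs.shift f ≠ 0)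
    (hX : EqOnU0 ((Rhs.all f).eval F) (((Rhs.shift f : ℂ) / 2) • X)) : EqOnU0 (F f) X := by
  intro n p
  have h1 := hX n p
  rw [← h, coef, coeff_shift] at h1
  have h2 : (Rhs.shift f : ℂ) ≠ 0 := by exact_mod_cast hk
  simpa [coef, h2] using h1

lemma eqOnU0_step_zero (h : step ψ Ψ F = F) {f : Unknown} (hf : f.Regular)
    (hs : Rhs.shift f = 0) : EqOnU0 (F f) 0 := by
  rw [← congrFun h f, step_regular _ _ _ hf, hs]
  exact EqOnU0.solveU_zero

/-- The initial conditions with c ≠ 0 are forced by the equations restricted to u = 0. For the S_k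
they form a recursion c S_k = ½ ∂_v S_(k-1) with c = 2, 3/2, 1, 1/2, which produces 1/4, 1/12, 1/24,
1/24. For S_3 and S_4 the extra terms with ∂_v φ_11 are removed by `h11`. -/
theorem isFormalExpansion_of_step (h : step ψ Ψ F = F) (h11 : EqOnU0 (dv (F .phi_11)) 0) :
    IsFormalExpansion ψ Ψ F := by
  have hphi : ofData ψ + intW (Rhs.phi.eval F) = F .phi := congrFun h .phi
  have hS0 : ofData Ψ + intW (Rhs.S0.eval F) = F .S_0 := congrFun h .S_0
  have h0 : du (F .phi) = F .phi_00 := congrFun h .phi_00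
  have hO : solveU 0 _ + onU0 (intW (Rhs.dwOm00.eval F)) = F .Om_00 := congrFun h .Om_00
  have hR : solveU 0 _ + onU0 (intW (Rhs.dwR.eval F)) + onU0 (onW0 (Rhs.valR.eval F)) = F .R :=
    congrFun h .R
  have hs := solvedEq_of_step h
  have hu := duEquations_of_solvedEq h0 hs
  have h2 := C_half_mul_two
  have hz : ∀ f : Unknown, f.Regular → Rhs.shift f = 0 → EqOnU0 (F f) 0 := fun f =>
    eqOnU0_step_zero h
  have h01 : EqOnU0 (F .phi_01) ((1 / 2 : ℂ) • du (dv (F .phi))) := by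
    refine (hs .phi_01 (by simp)).eqOnU0 (by simp [Rhs.shift]) (EqOnU0.add_uu_mul ?_)
    rw [EE.eval_smul, EE.eval_dv, ← h0, dv_du]
    simpa [Rhs.shift] using EqOnU0.refl _
  have hphi11 : EqOnU0 (F .phi_11) ((1 / 2 : ℂ) • du (dv (dv (F .phi)))) := by
    refine (hs .phi_11 (by simp)).eqOnU0 (by simp [Rhs.shift]) (EqOnU0.add_uu_mul ?_)
    have := h01.dv.smul (1 / 2)
    rw [dv_smul, dv_du] at this
    simpa [Rhs.shift] using this
  have hS1 : EqOnU0 (F .S_1) ((1 / 4 : ℂ) • dv (F .S_0)) := by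
    refine (hs .S_1 (by simp)).eqOnU0 (by simp [Rhs.shift]) (EqOnU0.add_uu_mul ?_)
    rw [EE.eval_smul, EE.eval_dv, smul_smul]
    norm_num [Rhs.shift]
    exact EqOnU0.refl _
  have hS2 : EqOnU0 (F .S_2) ((1 / 12 : ℂ) • dv (dv (F .S_0))) := by
    refine (hs .S_2 (by simp)).eqOnU0 (by simp [Rhs.shift]) (EqOnU0.add_uu_mul ?_)
    rw [EE.eval_smul, EE.eval_dv, smul_smul]
    have := hS1.dv.smul (1 / 2)
    rw [dv_smul, smul_smul] at this
    norm_num [Rhs.shift] at this ⊢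
    exact this
  have hS3 : EqOnU0 (F .S_3) ((1 / 24 : ℂ) • dv (dv (dv (F .S_0)))) := by
    refine (hs .S_3 (by simp)).eqOnU0 (by simp [Rhs.shift]) (EqOnU0.add_uu_mul ?_)
    have := hS2.dv.smul (1 / 2)
    rw [dv_smul, smul_smul] at this
    rw [EE.eval_add, EE.eval_smul, EE.eval_dv, smul_smul]
    simp only [EE.eval_smul, EE.eval_mul, EE.eval_dv, ← mul_assoc]
    rw [← smul_mul_assoc]
    refine EqOnU0.add_mul_zero ?_ (by simpa using h11.smul (1 / 2))
    norm_num [Rhs.shift] at this ⊢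
    exact this
  have hS4 : EqOnU0 (F .S_4) ((1 / 24 : ℂ) • dv (dv (dv (dv (F .S_0))))) := by
    refine (hs .S_4 (by simp)).eqOnU0 (by simp [Rhs.shift]) (EqOnU0.add_uu_mul ?_)
    have := hS3.dv.smul (1 / 2)
    rw [dv_smul, smul_smul] at this
    rw [EE.eval_add, EE.eval_smul, EE.eval_dv, smul_smul]
    simp only [EE.eval_smul, EE.eval_mul, EE.eval_dv]
    refine EqOnU0.add_mul_zero ?_ (by simpa using h11.smul (1 / 2))
    norm_num [Rhs.shift] at this ⊢
    exact this
  have hG : ∀ f : Unknown, f ≠ .phi ∧ f ≠ .phi_00 ∧ f ≠ .S_0 → Rhs.shift f ≠ 0 →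
      EqOnU0 ((Rhs.all f).eval F) 0 → EqOnU0 (F f) 0 := fun f hf hk h =>
    (hs f hf).eqOnU0 hk (by rwa [smul_zero])
  have hG00 := hG .G_0100 (by simp) (by simp [Rhs.shift]) (eqOnU0_uu_mul _)
  exact
  { data_phi := fun m n => by rw [← hphi, coef_ofData_add_intW]
    data_S_0 := fun m n => by rw [← hS0, coef_ofData_add_intW]
    du_equations := hu
    dw_equations := (dwEquations_iff h0 (uu_mul_E1 hu)).2
      ⟨by conv_lhs => rw [← hphi, dw_ofData_add_intW],
        by conv_lhs => rw [← hS0, dw_ofData_add_intW]⟩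
    initial :=
    { e1_01 := hG .e1_01 (by simp) (by simp [Rhs.shift]) (eqOnU0_uu_mul _)
      e2_01 := hG .e2_01 (by simp) (by simp [Rhs.shift]) hG00.add_uu_mul
      e1_11 := hz _ (by simp [Unknown.Regular]) rfl
      e2_11 := hz _ (by simp [Unknown.Regular]) rfl
      G_0100 := hG00
      G_0101 := hG .G_0101 (by simp) (by simp [Rhs.shift]) (eqOnU0_uu_mul _)
      G_0111 := hG .G_0111 (by simp) (by simp [Rhs.shift]) (eqOnU0_uu_mul _)
      G_1100 := hG .G_1100 (by simp) (by simp [Rhs.shift]) (eqOnU0_uu_mul _)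
      G_1101 := hz _ (by simp [Unknown.Regular]) rfl
      G_1111 := hz _ (by simp [Unknown.Regular]) rfl
      phi_01 := h01
      phi_11 := hphi11
      S_1 := hS1
      S_2 := hS2
      S_3 := hS3
      S_4 := hS4
      Om := hz _ (by simp [Unknown.Regular]) rfl
      Om_01 := hz _ (by simp [Unknown.Regular]) rfl
      Om_11 := hz _ (by simp [Unknown.Regular]) rfl
      Om_00 := fun n => by
        rw [← hO]; simp [coef, coeff_solveU, coeff_onU0, coeff_intW]
      dw_Om_00 := by
        rw [← eval_dwOm00]
        intro n p
        rw [coef, coeff_dw, ← hO, map_add, coeff_solveU, coeff_onU0, coeff_intW]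
        have : (p : ℂ) + 1 ≠ 0 := by exact_mod_cast Nat.succ_ne_zero p
        simp [coef, this]
      R := by
        have := (eqOnU0_valR h0 h01 hphi11).eqOnI
        intro n
        rw [← this n, ← hR]
        simp [coef, coeff_solveU, coeff_onU0, coeff_onW0, coeff_intW]
      dw_R := by
        rw [← eval_dwR]
        intro n p
        rw [coef, coeff_dw, ← hR, map_add, map_add, coeff_solveU, coeff_onU0, coeff_onU0,
          coeff_intW, coeff_onW0]
        have : (p : ℂ) + 1 ≠ 0 := by exact_mod_cast Nat.succ_ne_zero p
        simp [coef, this] } }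

end

open scoped NNReal ENNReal

/-! ### Weighted norms on power series -/

/-- The weighted `ℓ¹`-norm of a power series. -/
def nrm (ω : (Fin 3 →₀ ℕ) → ℝ≥0∞) (f : Ser) : ℝ≥0∞ := ∑' e, ‖coeff e f‖ₑ * ω e

section

variable {ω ω' ω₁ ω₂ : (Fin 3 →₀ ℕ) → ℝ≥0∞} {f g X : Ser} {C : ℝ≥0∞}

lemma nrm_add_le : nrm ω (f + g) ≤ nrm ω f + nrm ω g := by
  rw [nrm, nrm, nrm, ← ENNReal.tsum_add]
  refine ENNReal.tsum_le_tsum fun e => ?_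
  rw [← add_mul, map_add]
  gcongr
  exact enorm_add_le _ _

lemma nrm_neg : nrm ω (-f) = nrm ω f := by
  simp [nrm]

lemma nrm_sub_le : nrm ω (f - g) ≤ nrm ω f + nrm ω g := by
  rw [sub_eq_add_neg, ← nrm_neg (f := g)]; exact nrm_add_le

lemma nrm_zero : nrm ω 0 = 0 := by simp [nrm]

lemma nrm_C (c : ℂ) : nrm ω (MvPowerSeries.C c) = ‖c‖ₑ * ω 0 := by
  classical
  rw [nrm, tsum_eq_single 0]
  · simp
  · intro e he
    rw [coeff_C, if_neg he]; simp

lemma nrm_le_of_coeff (h : ∀ e, ‖coeff e f‖ₑ * ω e ≤ C * (‖coeff e X‖ₑ * ω' e)) :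
    nrm ω f ≤ C * nrm ω' X := by
  rw [nrm, nrm, ← ENNReal.tsum_mul_left]
  exact ENNReal.tsum_le_tsum h

lemma nrm_mono_weight (h : ∀ e, ω e ≤ ω' e) : nrm ω f ≤ nrm ω' f := by
  rw [nrm, nrm]
  gcongr with e
  exact h e

lemma tsum_sum_antidiagonal {A : Type*} [AddCommMonoid A] [Finset.HasAntidiagonal A]
    (H : A × A → ℝ≥0∞) :
    ∑' e, ∑ x ∈ Finset.HasAntidiagonal.antidiagonal e, H x = ∑' x, H x := by
  rw [← Finset.HasAntidiagonal.sigmaAntidiagonalEquivProd.tsum_eq H, ENNReal.tsum_sigma']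
  exact tsum_congr fun e => (Finset.tsum_subtype _ H).symm

lemma nrm_mul_le (h : ∀ a b, ω (a + b) ≤ ω₁ a * ω₂ b) : nrm ω (f * g) ≤ nrm ω₁ f * nrm ω₂ g := by
  classical
  have h1 : nrm ω (f * g) ≤ ∑' e, ∑ x ∈ Finset.HasAntidiagonal.antidiagonal e,
      (‖coeff x.1 f‖ₑ * ω₁ x.1) * (‖coeff x.2 g‖ₑ * ω₂ x.2) := by
    refine ENNReal.tsum_le_tsum fun e => ?_
    rw [coeff_mul]
    calc _ ≤ (∑ x ∈ Finset.HasAntidiagonal.antidiagonal e, ‖coeff x.1 f * coeff x.2 g‖ₑ) * ω e := by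
          gcongr; exact enorm_sum_le _ _
      _ ≤ _ := by
          rw [Finset.sum_mul]
          refine Finset.sum_le_sum fun x hx => ?_
          replace hx := Finset.HasAntidiagonal.mem_antidiagonal.1 hx
          calc _ ≤ ‖coeff x.1 f‖ₑ * ‖coeff x.2 g‖ₑ * (ω₁ x.1 * ω₂ x.2) := by
                rw [enorm_mul, ← hx]; gcongr; exact h _ _
            _ = _ := by ring
  refine h1.trans_eq ?_
  set H : (Fin 3 →₀ ℕ) × (Fin 3 →₀ ℕ) → ℝ≥0∞ := fun x =>
    (‖coeff x.1 f‖ₑ * ω₁ x.1) * (‖coeff x.2 g‖ₑ * ω₂ x.2)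
  calc _ = ∑' x, H x := tsum_sum_antidiagonal H
    _ = ∑' a, ∑' b, H (a, b) := ENNReal.tsum_prod (f := fun a b => H (a, b))
    _ = nrm ω₁ f * nrm ω₂ g := by
        simp only [H, nrm, ENNReal.tsum_mul_left, ENNReal.tsum_mul_right]

/-- Differentiation shifts exponents and multiplies by the exponent, so a pointwise comparison of
the shifted weights is enough. -/
lemma nrm_pderiv_le (i : Fin 3) (h : ∀ e, ((e i : ℝ≥0∞) + 1) * ω e ≤ C * ω' (e + single i 1)) :
    nrm ω (pderiv ℂ i f) ≤ C * nrm ω' f := by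
  have hinj : Function.Injective fun e : Fin 3 →₀ ℕ => e + single i 1 := add_left_injective _
  calc _ ≤ ∑' e, C * (‖coeff (e + single i 1) f‖ₑ * ω' (e + single i 1)) := by
        refine ENNReal.tsum_le_tsum fun e => ?_
        have h1 : ‖(e i : ℂ) + 1‖ₑ = (e i : ℝ≥0∞) + 1 := by
          have : ((e i : ℂ) + 1) = ((e i + 1 : ℕ) : ℂ) := by push_cast; rfl
          rw [this, enorm_eq_nnnorm, Complex.nnnorm_natCast]; push_cast; rfl
        rw [coeff_pderiv, enorm_mul, mul_assoc, h1]
        calc _ ≤ ‖coeff (e + single i 1) f‖ₑ * (C * ω' (e + single i 1)) :=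
              mul_le_mul' le_rfl (h e)
          _ = _ := by ring
    _ = C * ∑' e, ‖coeff (e + single i 1) f‖ₑ * ω' (e + single i 1) := ENNReal.tsum_mul_left
    _ ≤ _ := by
        gcongr
        exact ENNReal.tsum_comp_le_tsum_of_injective hinj (fun e => ‖coeff e f‖ₑ * ω' e)

lemma nrm_shift_le (i : Fin 3) (h0 : ∀ e : Fin 3 →₀ ℕ, e i = 0 → coeff e f = 0)
    (h : ∀ e, ‖coeff (e + single i 1) f‖ₑ * ω (e + single i 1) ≤ C * (‖coeff e X‖ₑ * ω' e)) :
    nrm ω f ≤ C * nrm ω' X := by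
  have hinj : Function.Injective fun e : Fin 3 →₀ ℕ => e + single i 1 := add_left_injective _
  rw [nrm, ← hinj.tsum_eq, nrm, ← ENNReal.tsum_mul_left]
  · exact ENNReal.tsum_le_tsum h
  · intro e he
    by_contra hr
    apply he
    have : e i = 0 := by
      by_contra h'
      exact hr ⟨e - single i 1, sub_single_add h'⟩
    simp [h0 e this]

/-- The norm is the supremum of its finite partial sums, so bounds survive coefficientwise limits.
-/
lemma nrm_le_of_approx (h : ∀ S : Finset (Fin 3 →₀ ℕ), ∃ g, nrm ω g ≤ C ∧
    ∀ e ∈ S, coeff e g = coeff e f) : nrm ω f ≤ C := by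
  rw [nrm, ENNReal.tsum_eq_iSup_sum]
  refine iSup_le fun S => ?_
  obtain ⟨g, hg, hS⟩ := h S
  calc _ = ∑ e ∈ S, ‖coeff e g‖ₑ * ω e := Finset.sum_congr rfl fun e he => by rw [hS e he]
    _ ≤ nrm ω g := ENNReal.sum_le_tsum S
    _ ≤ C := hg

end

/-! ### The weights -/

/-- The weight `s ^ (m + p) * t ^ n / (m + p).choose m` with `s = ε ^ 100` and `t = ε ^ (-2)`. -/
def wgt (ε : ℝ≥0) (e : Fin 3 →₀ ℕ) : ℝ≥0 :=
  (ε ^ 100) ^ (e 0 + e 2) * (ε⁻¹ ^ 2) ^ e 1 / (e 0 + e 2).choose (e 0)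

section

variable {ε : ℝ≥0}

lemma wgt_pos (hε : 0 < ε) (e : Fin 3 →₀ ℕ) : 0 < wgt ε e := by
  have : 0 < (e 0 + e 2).choose (e 0) := Nat.choose_pos (by omega)
  unfold wgt; positivity

lemma wgt_zero : wgt ε 0 = 1 := by simp [wgt]

/-- The left side is one term of Vandermonde's sum. It makes the weight submultiplicative in spite
of the binomial in its denominator. -/
lemma choose_mul_choose_le (a b c d : ℕ) :
    (a + b).choose a * (c + d).choose c ≤ ((a + c) + (b + d)).choose (a + c) := by
  rw [show (a + c) + (b + d) = (a + b) + (c + d) by ring, Nat.add_choose_eq (a + b)]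
  exact Finset.single_le_sum (f := fun ij : ℕ × ℕ => (a + b).choose ij.1 * (c + d).choose ij.2)
    (fun _ _ => Nat.zero_le _) (a := (a, c))
    (Finset.HasAntidiagonal.mem_antidiagonal.2 rfl)

lemma wgt_add_le (a b : Fin 3 →₀ ℕ) : wgt ε (a + b) ≤ wgt ε a * wgt ε b := by
  have h1 : 0 < (a 0 + a 2).choose (a 0) := Nat.choose_pos (by omega)
  have h2 : 0 < (b 0 + b 2).choose (b 0) := Nat.choose_pos (by omega)
  have h3 := choose_mul_choose_le (a 0) (a 2) (b 0) (b 2)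
  simp only [wgt, Finsupp.add_apply]
  rw [div_mul_div_comm]
  have h4 : (((a 0 + a 2).choose (a 0) : ℝ≥0) * (b 0 + b 2).choose (b 0))
      ≤ ((a 0 + b 0) + (a 2 + b 2)).choose (a 0 + b 0) := by exact_mod_cast h3
  calc _ ≤ (ε ^ 100) ^ (a 0 + b 0 + (a 2 + b 2)) * (ε⁻¹ ^ 2) ^ (a 1 + b 1)
        / (((a 0 + a 2).choose (a 0) : ℝ≥0) * (b 0 + b 2).choose (b 0)) := by
        gcongr
    _ = _ := by
        congr 1; ring

/-- This is the reason for the binomial: the factor m + 1 produced by ∂_u becomes m + p + 1,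
symmetric in u and w, so a loss in one variable can be made up by integrating in the other. -/
lemma wgt_add_u (e : Fin 3 →₀ ℕ) :
    wgt ε (e + single 0 1) * (e 0 + e 2 + 1) = ε ^ 100 * (e 0 + 1) * wgt ε e := by
  have h1 : 0 < (e 0 + e 2).choose (e 0) := Nat.choose_pos (by omega)
  have h2 : 0 < (e 0 + 1 + e 2).choose (e 0 + 1) := Nat.choose_pos (by omega)
  have h3 := Nat.add_one_mul_choose_eq (e 0 + e 2) (e 0)
  have h4 : ((e 0 : ℝ≥0) + e 2 + 1) * (e 0 + e 2).choose (e 0)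
      = (e 0 + 1 + e 2).choose (e 0 + 1) * (e 0 + 1) := by
    rw [show e 0 + 1 + e 2 = e 0 + e 2 + 1 by ring]; exact_mod_cast h3
  simp only [wgt, Finsupp.add_apply]
  simp
  rw [div_mul_eq_mul_div, mul_div_assoc', div_eq_div_iff (by positivity) (by positivity)]
  calc _ = (ε ^ 100) ^ (e 0 + 1 + e 2) * ((ε ^ 2)⁻¹) ^ e 1
        * (((e 0 : ℝ≥0) + e 2 + 1) * (e 0 + e 2).choose (e 0)) := by ring
    _ = _ := by rw [h4]; ring

lemma wgt_add_w (e : Fin 3 →₀ ℕ) :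
    wgt ε (e + single 2 1) * (e 0 + e 2 + 1) = ε ^ 100 * (e 2 + 1) * wgt ε e := by
  have h1 : 0 < (e 0 + e 2).choose (e 0) := Nat.choose_pos (by omega)
  have h2 : 0 < (e 0 + (e 2 + 1)).choose (e 0) := Nat.choose_pos (by omega)
  have h3 := Nat.choose_mul_succ_eq (e 0 + e 2) (e 0)
  rw [show e 0 + e 2 + 1 - e 0 = e 2 + 1 by omega] at h3
  have h4 : ((e 0 + e 2).choose (e 0) : ℝ≥0) * (e 0 + e 2 + 1)
      = (e 0 + (e 2 + 1)).choose (e 0) * (e 2 + 1) := by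
    rw [show e 0 + (e 2 + 1) = e 0 + e 2 + 1 by ring]; exact_mod_cast h3
  simp only [wgt, Finsupp.add_apply]
  simp
  rw [div_mul_eq_mul_div, mul_div_assoc', div_eq_div_iff (by positivity) (by positivity)]
  calc _ = (ε ^ 100) ^ (e 0 + (e 2 + 1)) * ((ε ^ 2)⁻¹) ^ e 1
        * (((e 0 + e 2).choose (e 0) : ℝ≥0) * (e 0 + e 2 + 1)) := by ring
    _ = _ := by rw [h4]; ring

lemma wgt_add_v (e : Fin 3 →₀ ℕ) : wgt ε (e + single 1 1) = ε⁻¹ ^ 2 * wgt ε e := by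
  simp only [wgt, Finsupp.add_apply]
  simp
  ring

/-- The weight `c * wgt ε`, which is infinite at the exponents not allowed in type `k`. -/
def twgt (c : (Fin 3 →₀ ℕ) → ℝ≥0) (k : ℤ) (ε : ℝ≥0) (e : Fin 3 →₀ ℕ) : ℝ≥0∞ :=
  if (e 1 : ℤ) ≤ 2 * e 0 + k then ((c e * wgt ε e : ℝ≥0) : ℝ≥0∞) else ⊤

lemma mul_twgt_le {c c' : (Fin 3 →₀ ℕ) → ℝ≥0} {k k' : ℤ} {e e' : Fin 3 →₀ ℕ} {x y : ℝ≥0}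
    (hy : 0 < y) (ht : (e' 1 : ℤ) ≤ 2 * e' 0 + k' → (e 1 : ℤ) ≤ 2 * e 0 + k)
    (h : (e' 1 : ℤ) ≤ 2 * e' 0 + k' → x * (c e * wgt ε e) ≤ y * (c' e' * wgt ε e')) :
    x * twgt c k ε e ≤ y * twgt c' k' ε e' := by
  unfold twgt
  by_cases h' : (e' 1 : ℤ) ≤ 2 * e' 0 + k'
  · rw [if_pos h', if_pos (ht h')]
    exact_mod_cast h h'
  · rw [if_neg h', ENNReal.mul_top (by exact_mod_cast hy.ne')]
    exact le_top

/-- Types add under multiplication. Positivity of the multipliers ensures that an infinite factor is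
not cancelled by a zero one. -/
lemma twgt_add_le {c c₁ c₂ : (Fin 3 →₀ ℕ) → ℝ≥0} {k l : ℤ} (hε : 0 < ε)
    (h₁ : ∀ e, 0 < c₁ e) (h₂ : ∀ e, 0 < c₂ e) (h : ∀ a b, c (a + b) ≤ c₁ a * c₂ b)
    (a b : Fin 3 →₀ ℕ) : twgt c (k + l) ε (a + b) ≤ twgt c₁ k ε a * twgt c₂ l ε b := by
  have hp : ∀ {c : (Fin 3 →₀ ℕ) → ℝ≥0} (k : ℤ) (e : Fin 3 →₀ ℕ), (∀ e, 0 < c e) →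
      twgt c k ε e ≠ 0 := by
    intro c k e hc
    unfold twgt
    split_ifs
    · have := mul_pos (hc e) (wgt_pos hε e)
      exact_mod_cast this.ne'
    · exact ENNReal.top_ne_zero
  by_cases ha : (a 1 : ℤ) ≤ 2 * a 0 + k
  · by_cases hb : (b 1 : ℤ) ≤ 2 * b 0 + l
    · unfold twgt
      rw [if_pos ha, if_pos hb, if_pos (by simp only [Finsupp.add_apply]; push_cast; linarith)]
      rw [← ENNReal.coe_mul, ENNReal.coe_le_coe]
      calc _ ≤ (c₁ a * c₂ b) * (wgt ε a * wgt ε b) := mul_le_mul' (h a b) (wgt_add_le a b)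
        _ = _ := by ring
    · have : twgt c₂ l ε b = ⊤ := if_neg hb
      rw [this, ENNReal.mul_top (hp k a h₁)]; exact le_top
  · have : twgt c₁ k ε a = ⊤ := if_neg ha
    rw [this, ENNReal.top_mul (hp l b h₂)]; exact le_top

/-! ### Multipliers; estimates for derivatives and integrations. -/

/-- The multiplier of the basic weight. -/
def cO : (Fin 3 →₀ ℕ) → ℝ≥0 := fun _ => 1

/-- The multiplier of the weight for terms to be integrated with respect to `u` or `w`. -/
def cI (e : Fin 3 →₀ ℕ) : ℝ≥0 := (e 0 + e 2 + 1)⁻¹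

/-- The multiplier of the weight for the right-hand side of `u ∂_u f + c f = …`. -/
def cE (e : Fin 3 →₀ ℕ) : ℝ≥0 := (e 0 + 1)⁻¹

/-- The multiplier of the weight which controls first derivatives. -/
def cD (e : Fin 3 →₀ ℕ) : ℝ≥0 := e 0 + e 2 + 1

lemma cO_pos (e : Fin 3 →₀ ℕ) : 0 < cO e := one_pos
lemma cI_pos (e : Fin 3 →₀ ℕ) : 0 < cI e := by unfold cI; positivity
lemma cE_pos (e : Fin 3 →₀ ℕ) : 0 < cE e := by unfold cE; positivity

lemma cO_add_le (a b : Fin 3 →₀ ℕ) : cO (a + b) ≤ cO a * cO b := by simp [cO]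

lemma cI_add_le (a b : Fin 3 →₀ ℕ) : cI (a + b) ≤ cO a * cI b := by
  simp only [cI, cO, one_mul, Finsupp.add_apply]
  gcongr <;> simp

lemma cE_add_le (a b : Fin 3 →₀ ℕ) : cE (a + b) ≤ cO a * cE b := by
  simp only [cE, cO, one_mul, Finsupp.add_apply]
  gcongr; simp

lemma twgt_mono {c c' : (Fin 3 →₀ ℕ) → ℝ≥0} {k k' : ℤ} (hc : ∀ e, c e ≤ c' e) (hk : k' ≤ k)
    (e : Fin 3 →₀ ℕ) : twgt c k ε e ≤ twgt c' k' ε e := by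
  simpa using mul_twgt_le (x := 1) (y := 1) (ε := ε) (c := c) (c' := c') (k := k) (k' := k')
    (e := e) (e' := e) one_pos (fun h => by linarith) fun _ => by gcongr; exact hc e

lemma nrm_du_le (hε : 0 < ε) (k : ℤ) (f : Ser) :
    nrm (twgt cI (k + 2) ε) (du f) ≤ ((ε ^ 100)⁻¹ : ℝ≥0) * nrm (twgt cO k ε) f := by
  refine nrm_pderiv_le 0 fun e => ?_
  have := mul_twgt_le (ε := ε) (c := cI) (c' := cO) (k := k + 2) (k' := k) (e := e)
    (e' := e + single 0 1) (x := e 0 + 1) (y := (ε ^ 100)⁻¹) (by positivity) (fun h => by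
      simp at h; linarith) fun _ => by
    have h := wgt_add_u (ε := ε) e
    have h' : wgt ε (e + single 0 1) = ε ^ 100 * (e 0 + 1) * wgt ε e * (e 0 + e 2 + 1 : ℝ≥0)⁻¹ := by
      rw [← h]; field_simp
    rw [cO, cI, h']
    have := (pow_pos hε 100).ne'
    apply le_of_eq; field_simp
  simpa using this

lemma nrm_dw_le (hε : 0 < ε) (k : ℤ) (f : Ser) :
    nrm (twgt cI k ε) (dw f) ≤ ((ε ^ 100)⁻¹ : ℝ≥0) * nrm (twgt cO k ε) f := by
  refine nrm_pderiv_le 2 fun e => ?_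
  have := mul_twgt_le (ε := ε) (c := cI) (c' := cO) (k := k) (k' := k) (e := e)
    (e' := e + single 2 1) (x := e 2 + 1) (y := (ε ^ 100)⁻¹) (by positivity) (fun h => by
      simpa using h) fun _ => by
    have h := wgt_add_w (ε := ε) e
    have h' : wgt ε (e + single 2 1) = ε ^ 100 * (e 2 + 1) * wgt ε e * (e 0 + e 2 + 1 : ℝ≥0)⁻¹ := by
      rw [← h]; field_simp
    rw [cO, cI, h']
    have := (pow_pos hε 100).ne'
    apply le_of_eq; field_simp
  simpa using this

/-- The loss of m + p + 1 is paid by the stronger weight on the right; this is why φ is measured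
with `cD`, so that φ_00 = ∂_u φ has finite norm without any integration. -/
lemma nrm_du_le' (hε : 0 < ε) (f : Ser) :
    nrm (twgt cO 2 ε) (du f) ≤ ((ε ^ 100)⁻¹ : ℝ≥0) * nrm (twgt cD 0 ε) f := by
  refine nrm_pderiv_le 0 fun e => ?_
  have := mul_twgt_le (ε := ε) (c := cO) (c' := cD) (k := 2) (k' := 0) (e := e)
    (e' := e + single 0 1) (x := e 0 + 1) (y := (ε ^ 100)⁻¹) (by positivity) (fun h => by
      simp at h; linarith) fun _ => by
    have h := wgt_add_u (ε := ε) e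
    calc _ = (ε ^ 100)⁻¹ * (ε ^ 100 * (e 0 + 1) * wgt ε e) := by
          have := (pow_pos hε 100).ne'
          rw [cO]; field_simp
      _ ≤ _ := by
          rw [← h, cD, mul_comm (wgt ε _)]
          simp only [Finsupp.add_apply]
          gcongr <;> simp
  simpa using this

/-- The restriction on the type gives n + 1 ≤ (2 + |k|)(m + 1), so ∂_v costs only the factor
contained in `cE`, while the shift in v contributes ε². -/
lemma nrm_dv_le (hε : 0 < ε) (k : ℤ) (f : Ser) : nrm (twgt cE (k - 1) ε) (dv f)
    ≤ ((2 + k.natAbs) * ε ^ 2 : ℝ≥0) * nrm (twgt cO k ε) f := by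
  refine nrm_pderiv_le 1 fun e => ?_
  have := mul_twgt_le (ε := ε) (c := cE) (c' := cO) (k := k - 1) (k' := k) (e := e)
    (e' := e + single 1 1) (x := e 1 + 1) (y := (2 + k.natAbs) * ε ^ 2) (by positivity) (fun h => by
      simp at h; linarith) fun h => by
    have h1 : e 1 + 1 ≤ (2 + k.natAbs) * (e 0 + 1) := by
      simp at h
      zify
      nlinarith [le_abs_self k, abs_nonneg k]
    have h2 : ((e 1 : ℝ≥0) + 1) ≤ (2 + k.natAbs) * (e 0 + 1) := by exact_mod_cast h1
    have h3 : (2 + k.natAbs) * ε ^ 2 * (cO (e + single 1 1) * wgt ε (e + single 1 1))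
        = (2 + k.natAbs) * wgt ε e := by
      have := hε.ne'
      rw [cO, wgt_add_v]; field_simp
    rw [h3, cE, ← mul_assoc]
    gcongr
    rw [← div_eq_mul_inv, div_le_iff₀ (by positivity)]
    exact h2
  simpa using this

lemma nrm_dv_le' (hε : 0 < ε) (f : Ser) : nrm (twgt cO (-1) ε) (dv f)
    ≤ (2 * ε ^ 2 : ℝ≥0) * nrm (twgt cD 0 ε) f := by
  refine nrm_pderiv_le 1 fun e => ?_
  have := mul_twgt_le (ε := ε) (c := cO) (c' := cD) (k := -1) (k' := 0) (e := e)
    (e' := e + single 1 1) (x := e 1 + 1) (y := 2 * ε ^ 2) (by positivity) (fun h => by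
      simp at h; linarith) fun h => by
    have h1 : e 1 + 1 ≤ 2 * (e 0 + e 2 + 1) := by
      simp at h; omega
    have h2 : ((e 1 : ℝ≥0) + 1) ≤ 2 * (e 0 + e 2 + 1) := by exact_mod_cast h1
    have h3 : 2 * ε ^ 2 * (cD (e + single 1 1) * wgt ε (e + single 1 1))
        = 2 * (e 0 + e 2 + 1) * wgt ε e := by
      have := hε.ne'
      rw [cD, wgt_add_v]; simp; field_simp
    rw [h3, cO, one_mul]
    gcongr
  simpa using this

/-- The multiplier 1/(m + p + 1) on the right absorbs a derivative in u or in w; together with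
`nrm_solveU_le` this recovers the derivatives in the ∂_u-equations. -/
lemma nrm_uu_mul_le (hε : 0 < ε) (k : ℤ) (X : Ser) : nrm (twgt cE (k - 2) ε) (uu * X)
    ≤ (ε ^ 100 : ℝ≥0) * nrm (twgt cI k ε) X := by
  refine nrm_shift_le 0 (fun e he => by rw [coeff_uu_mul, if_pos he]) fun e => ?_
  rw [coeff_add_uu_mul, mul_left_comm]
  gcongr
  have := mul_twgt_le (ε := ε) (c := cE) (c' := cI) (k := k - 2) (k' := k) (e := e + single 0 1)
    (e' := e) (x := 1) (y := ε ^ 100) (by positivity) (fun h => by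
      simp; linarith) fun h => by
    have h := wgt_add_u (ε := ε) e
    have h' : wgt ε (e + single 0 1) = ε ^ 100 * (e 0 + 1) * wgt ε e * (e 0 + e 2 + 1 : ℝ≥0)⁻¹ := by
      rw [← h]; field_simp
    have h2 : ((e 0 : ℝ≥0) + 1 + 1)⁻¹ * (e 0 + 1) ≤ 1 := by
      rw [inv_mul_le_iff₀ (by positivity)]; simp
    simp only [cE, cI, h', Finsupp.add_apply]
    simp
    calc _ = (((e 0 : ℝ≥0) + 1 + 1)⁻¹ * (e 0 + 1))
          * (ε ^ 100 * ((e 0 + e 2 + 1 : ℝ≥0)⁻¹ * wgt ε e)) := by ring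
      _ ≤ _ := by
        calc _ ≤ 1 * (ε ^ 100 * ((e 0 + e 2 + 1 : ℝ≥0)⁻¹ * wgt ε e)) := by gcongr
          _ = _ := one_mul _
  simpa using this

lemma enorm_div_natCast_add_one (z : ℂ) (n : ℕ) :
    ‖z / ((n : ℂ) + 1)‖ₑ = ‖z‖ₑ * (((n : ℝ≥0) + 1)⁻¹ : ℝ≥0) := by
  have : ((n : ℂ) + 1) = ((n + 1 : ℕ) : ℂ) := by push_cast; rfl
  rw [this, div_eq_mul_inv, enorm_mul, enorm_eq_nnnorm (_⁻¹), nnnorm_inv, Complex.nnnorm_natCast]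
  push_cast; rfl

lemma nrm_intW_le (hε : 0 < ε) (k : ℤ) (X : Ser) : nrm (twgt cO k ε) (intW X)
    ≤ (ε ^ 100 : ℝ≥0) * nrm (twgt cI k ε) X := by
  refine nrm_shift_le 2 (fun e he => by rw [coeff_intW, if_pos he]) fun e => ?_
  rw [coeff_intW, if_neg (by simp), add_tsub_cancel_right, mul_left_comm]
  simp only [Finsupp.add_apply, single_eq_same, Nat.cast_add, Nat.cast_one]
  rw [enorm_div_natCast_add_one, mul_assoc]
  refine mul_le_mul' le_rfl (mul_twgt_le (ε := ε) (c := cO) (c' := cI) (k := k) (k' := k) (e := e + single 2 1)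
    (e' := e) (by positivity) (fun h => by simpa using h) fun h => ?_)
  have h := wgt_add_w (ε := ε) e
  have h' : wgt ε (e + single 2 1) = ε ^ 100 * (e 2 + 1) * wgt ε e * (e 0 + e 2 + 1 : ℝ≥0)⁻¹ := by
    rw [← h]; field_simp
  rw [cO, cI, h']
  apply le_of_eq; field_simp

/-- If the integrand contains no lost derivative, integration in w gains the factor m + p + 1
required by the stronger norm of φ. -/
lemma nrm_intW_le' (hε : 0 < ε) (X : Ser) : nrm (twgt cD 0 ε) (intW X)
    ≤ (2 * ε ^ 100 : ℝ≥0) * nrm (twgt cO 0 ε) X := by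
  refine nrm_shift_le 2 (fun e he => by rw [coeff_intW, if_pos he]) fun e => ?_
  rw [coeff_intW, if_neg (by simp), add_tsub_cancel_right, mul_left_comm]
  simp only [Finsupp.add_apply, single_eq_same, Nat.cast_add, Nat.cast_one]
  rw [enorm_div_natCast_add_one, mul_assoc]
  refine mul_le_mul' le_rfl (mul_twgt_le (ε := ε) (c := cD) (c' := cO) (k := 0) (k' := 0) (e := e + single 2 1)
    (e' := e) (by positivity) (fun h => by simpa using h) fun h => ?_)
  have h := wgt_add_w (ε := ε) e
  have h' : wgt ε (e + single 2 1) = ε ^ 100 * (e 2 + 1) * wgt ε e * (e 0 + e 2 + 1 : ℝ≥0)⁻¹ := by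
    rw [← h]; field_simp
  have h2 : ((e 0 : ℝ≥0) + (e 2 + 1) + 1) * (e 0 + e 2 + 1 : ℝ≥0)⁻¹ ≤ 2 := by
    rw [mul_inv_le_iff₀ (by positivity)]
    have : (0 : ℝ≥0) ≤ e 0 + e 2 := by positivity
    calc ((e 0 : ℝ≥0) + (e 2 + 1) + 1) = 0 + (e 0 + e 2 + 2) := by ring
      _ ≤ (e 0 + e 2) + (e 0 + e 2 + 2) := by gcongr
      _ = _ := by ring
  simp only [cO, cD, h', Finsupp.add_apply]
  simp
  calc _ = ((e 0 : ℝ≥0) + (e 2 + 1) + 1) * (e 0 + e 2 + 1 : ℝ≥0)⁻¹ * (ε ^ 100 * wgt ε e) := by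
        field_simp
    _ ≤ 2 * (ε ^ 100 * wgt ε e) := by gcongr
    _ = _ := by ring

lemma nrm_solveU_le (k : ℤ) (l : ℕ) (X : Ser) : nrm (twgt cO k ε) (solveU l X)
    ≤ (2 : ℝ≥0) * nrm (twgt cE k ε) X := by
  refine nrm_le_of_coeff fun e => ?_
  rw [coeff_solveU]
  by_cases h0 : e 0 = 0 ∧ l = 0
  · simp [h0.1, h0.2]
  · have h1 : ((e 0 : ℂ) + l / 2) = ((2 * e 0 + l : ℕ) : ℂ) / 2 := by push_cast; ring
    have h2 : ‖((e 0 : ℂ) + l / 2)⁻¹‖ₑ = ((2 / (2 * e 0 + l : ℕ) : ℝ≥0) : ℝ≥0∞) := by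
      rw [h1, enorm_eq_nnnorm, nnnorm_inv, nnnorm_div, Complex.nnnorm_natCast]; simp
    rw [div_eq_mul_inv, enorm_mul, mul_left_comm, mul_assoc, h2]
    refine mul_le_mul' le_rfl (mul_twgt_le (by norm_num) (fun h => h) fun _ => ?_)
    rw [cO, cE, one_mul, ← mul_assoc]
    gcongr
    rw [← div_eq_mul_inv]
    gcongr
    -- This uses that m and l are not both zero; in the excluded case the coefficient was set to 0.
    have : e 0 + 1 ≤ 2 * e 0 + l := by omega
    exact_mod_cast this

lemma nrm_onU0_le (ω : (Fin 3 →₀ ℕ) → ℝ≥0∞) (X : Ser) : nrm ω (onU0 X) ≤ nrm ω X := by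
  rw [← one_mul (nrm ω X)]
  refine nrm_le_of_coeff fun e => ?_
  rw [coeff_onU0]; split_ifs <;> simp

lemma nrm_onW0_le (ω : (Fin 3 →₀ ℕ) → ℝ≥0∞) (X : Ser) : nrm ω (onW0 X) ≤ nrm ω X := by
  rw [← one_mul (nrm ω X)]
  refine nrm_le_of_coeff fun e => ?_
  rw [coeff_onW0]; split_ifs <;> simp

/-! ### Products and inverses. -/

lemma nrm_mul_le_twgt (hε : 0 < ε) {c : (Fin 3 →₀ ℕ) → ℝ≥0} (hc : ∀ e, 0 < c e)
    (h : ∀ a b, c (a + b) ≤ cO a * c b) (k l : ℤ) (f g : Ser) :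
    nrm (twgt c (k + l) ε) (f * g) ≤ nrm (twgt cO k ε) f * nrm (twgt c l ε) g :=
  nrm_mul_le (twgt_add_le hε cO_pos hc h)

/-- Approximations of `(1 + x)⁻¹`. -/
def invApprox (x : Ser) : ℕ → Ser
  | 0 => 0
  | n + 1 => 1 - x * invApprox x n

/-- Since x has no constant term, each application of y ↦ 1 - x y fixes one further total degree of
its fixed point (1 + x)⁻¹. -/
lemma coeff_invApprox {x : Ser} (h0 : constantCoeff x = 0) (n : ℕ) (e : Fin 3 →₀ ℕ)
    (he : e.degree < n) : coeff e (invApprox x n) = coeff e (1 + x)⁻¹ := by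
  have hinv : (1 + x) * (1 + x)⁻¹ = 1 := MvPowerSeries.mul_inv_cancel _ (by simp [h0])
  have hx : (1 + x)⁻¹ = 1 - x * (1 + x)⁻¹ := by linear_combination hinv
  induction n generalizing e with
  | zero => omega
  | succ n ih =>
    rw [invApprox, hx, map_sub, map_sub, coeff_mul, coeff_mul]
    congr 1
    refine Finset.sum_congr rfl fun p hp => ?_
    replace hp := Finset.HasAntidiagonal.mem_antidiagonal.1 hp
    by_cases hp1 : p.1 = 0
    · rw [hp1, coeff_zero_eq_constantCoeff_apply, h0, zero_mul, zero_mul]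
    · rw [ih]
      have h2 : p.1.degree ≠ 0 := by rwa [Ne, Finsupp.degree_eq_zero_iff]
      have h3 := congrArg Finsupp.degree hp
      rw [map_add] at h3
      omega

lemma nrm_one : nrm (twgt cO 0 ε) 1 = 1 := by
  rw [show (1 : Ser) = C 1 from (map_one _).symm, nrm_C]
  simp [twgt, cO, wgt_zero]

/-- The map y ↦ 1 - x y preserves the ball of radius 2, because 1 + ½ · 2 = 2. -/
lemma nrm_inv_le (hε : 0 < ε) {x : Ser} (h0 : constantCoeff x = 0)
    (hx : nrm (twgt cO 0 ε) x ≤ 1 / 2) : nrm (twgt cO 0 ε) (1 + x)⁻¹ ≤ 2 := by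
  have hy : ∀ n, nrm (twgt cO 0 ε) (invApprox x n) ≤ 2 := by
    intro n
    induction n with
    | zero => rw [invApprox, nrm_zero]; exact zero_le
    | succ n ih =>
      have hmul := nrm_mul_le_twgt hε cO_pos cO_add_le 0 0 x (invApprox x n)
      rw [add_zero] at hmul
      rw [invApprox]
      refine nrm_sub_le.trans ((add_le_add nrm_one.le
        (hmul.trans (mul_le_mul' hx ih))).trans ?_)
      rw [ENNReal.div_mul_cancel (by simp) (by simp)]
      norm_num
  refine nrm_le_of_approx fun S =>
    ⟨invApprox x (S.sup Finsupp.degree + 1), hy _, fun e he => coeff_invApprox h0 _ e ?_⟩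
  exact Nat.lt_succ_of_le (Finset.le_sup (f := Finsupp.degree) he)

end

/-! ### The invariant ball -/

/-- The multiplier of the weight in which the unknown `f` is measured. -/
def Unknown.mult : Unknown → (Fin 3 →₀ ℕ) → ℝ≥0
  | .phi => cD
  | _ => cO

/-- The families of series which are bounded by the expected sizes. -/
structure InBall (ε : ℝ≥0) (F : Unknown → Ser) : Prop where
  bound : ∀ f : Unknown, nrm (twgt f.mult f.type ε) (F f) ≤ (ε ^ f.size : ℝ≥0)
  -- The norm bounds make these constant terms small only; the bound for 1/(1 + Ω - φ²) uses that
  -- they vanish.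
  phi_zero : constantCoeff (F .phi) = 0
  Om_zero : constantCoeff (F .Om) = 0

/-- The bound `O(ε ^ j)` in type `k`, uniformly on the balls. -/
def BdOn (c : (Fin 3 →₀ ℕ) → ℝ≥0) (k j : ℤ) (g : (Unknown → Ser) → Ser) : Prop :=
  ∃ K : ℝ≥0, ∀ ε : ℝ≥0, 0 < ε → ε ≤ 1 / 2 → ∀ F, InBall ε F →
    nrm (twgt c k ε) (g F) ≤ (K * ε ^ j : ℝ≥0)

lemma cO_le_cD (e : Fin 3 →₀ ℕ) : cO e ≤ cD e := by simp [cO, cD]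
lemma cI_le_cO (e : Fin 3 →₀ ℕ) : cI e ≤ cO e := by
  rw [cI, cO, inv_le_one₀ (by positivity)]; simp
lemma cE_le_cO (e : Fin 3 →₀ ℕ) : cE e ≤ cO e := by
  rw [cE, cO, inv_le_one₀ (by positivity)]; simp
lemma cI_le_cE (e : Fin 3 →₀ ℕ) : cI e ≤ cE e := by
  unfold cI cE; gcongr; simp

namespace BdOn

variable {c c' : (Fin 3 →₀ ℕ) → ℝ≥0} {k k' j j' : ℤ} {g g' : (Unknown → Ser) → Ser}

lemma mono (h : BdOn c k j g) (hc : ∀ e, c' e ≤ c e) (hk : k ≤ k') (hj : j' ≤ j) :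
    BdOn c' k' j' g := by
  obtain ⟨K, hK⟩ := h
  refine ⟨K, fun ε h0 h1 F hF => (nrm_mono_weight (twgt_mono hc hk)).trans
    ((hK ε h0 h1 F hF).trans ?_)⟩
  rw [ENNReal.coe_le_coe]
  exact mul_le_mul' le_rfl (zpow_le_zpow_right_of_le_one₀ h0 (h1.trans (by norm_num)) hj)

lemma transform (h : BdOn c k j g) (C : ℝ≥0) (i : ℤ)
    (ht : ∀ ε, 0 < ε → ∀ F, InBall ε F →
      nrm (twgt c' k' ε) (g' F) ≤ (C * ε ^ i : ℝ≥0) * nrm (twgt c k ε) (g F)) :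
    BdOn c' k' (i + j) g' := by
  obtain ⟨K, hK⟩ := h
  refine ⟨C * K, fun ε h0 h1 F hF => (ht ε h0 F hF).trans
    ((mul_le_mul' le_rfl (hK ε h0 h1 F hF)).trans_eq ?_)⟩
  rw [← ENNReal.coe_mul, zpow_add₀ h0.ne']
  congr 1; ring

lemma add (h : BdOn c k j g) (h' : BdOn c k j g') : BdOn c k j fun F => g F + g' F := by
  obtain ⟨K, hK⟩ := h
  obtain ⟨K', hK'⟩ := h'
  refine ⟨K + K', fun ε h0 h1 F hF => nrm_add_le.trans
    ((add_le_add (hK ε h0 h1 F hF) (hK' ε h0 h1 F hF)).trans_eq ?_)⟩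
  rw [← ENNReal.coe_add, add_mul]

lemma neg (h : BdOn c k j g) : BdOn c k j fun F => -g F := by
  obtain ⟨K, hK⟩ := h
  exact ⟨K, fun ε h0 h1 F hF => nrm_neg.trans_le (hK ε h0 h1 F hF)⟩

lemma sub (h : BdOn c k j g) (h' : BdOn c k j g') : BdOn c k j fun F => g F - g' F := by
  simpa only [sub_eq_add_neg] using h.add h'.neg

lemma mul (hc : ∀ e, 0 < c e) (hcc : ∀ a b, c (a + b) ≤ cO a * c b) (h : BdOn cO k j g)
    (h' : BdOn c k' j' g') : BdOn c (k + k') (j + j') fun F => g F * g' F := by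
  obtain ⟨K, hK⟩ := h
  obtain ⟨K', hK'⟩ := h'
  refine ⟨K * K', fun ε h0 h1 F hF => (nrm_mul_le_twgt h0 hc hcc _ _ _ _).trans
    ((mul_le_mul' (hK ε h0 h1 F hF) (hK' ε h0 h1 F hF)).trans_eq ?_)⟩
  rw [← ENNReal.coe_mul, zpow_add₀ h0.ne']
  congr 1; ring

lemma add' (h : BdOn c k j g) (h' : BdOn c k' j' g') :
    BdOn c (max k k') (min j j') fun F => g F + g' F :=
  (h.mono (fun _ => le_rfl) (le_max_left _ _) (min_le_left _ _)).add
    (h'.mono (fun _ => le_rfl) (le_max_right _ _) (min_le_right _ _))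

lemma sub' (h : BdOn c k j g) (h' : BdOn c k' j' g') :
    BdOn c (max k k') (min j j') fun F => g F - g' F :=
  (h.mono (fun _ => le_rfl) (le_max_left _ _) (min_le_left _ _)).sub
    (h'.mono (fun _ => le_rfl) (le_max_right _ _) (min_le_right _ _))

lemma phi : BdOn cD 0 95 fun F => F .phi :=
  ⟨1, fun ε h0 h1 F hF => by rw [one_mul]; exact hF.bound .phi⟩

lemma unknown (f : Unknown) : BdOn cO f.type f.size fun F => F f := by
  by_cases hf : f = .phi
  · subst hf
    exact phi.mono cO_le_cD le_rfl le_rfl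
  · refine ⟨1, fun ε h0 h1 F hF => ?_⟩
    have := hF.bound f
    rw [one_mul]
    convert this using 2
    cases f <;> first | contradiction | rfl

lemma const (z : ℂ) : BdOn cO 0 0 fun _ => C z := by
  refine ⟨‖z‖₊, fun ε h0 h1 F hF => ?_⟩
  rw [nrm_C]
  simp [twgt, cO, wgt_zero, enorm_eq_nnnorm]

lemma nrm_phi_sq_le {ε : ℝ≥0} (h0 : 0 < ε) (h1 : ε ≤ 1 / 2) {F : Unknown → Ser}
    (hF : InBall ε F) : nrm (twgt cO 0 ε) (F .phi ^ 2) ≤ ((1 / 4 : ℝ≥0) : ℝ≥0∞) := by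
  have h2 : nrm (twgt cO 0 ε) (F .phi) ≤ ((1 / 2 : ℝ≥0) : ℝ≥0∞) := by
    refine (nrm_mono_weight (twgt_mono cO_le_cD le_rfl)).trans ((hF.bound .phi).trans ?_)
    rw [ENNReal.coe_le_coe]
    calc ε ^ (95 : ℤ) ≤ ε ^ (1 : ℤ) :=
          zpow_le_zpow_right_of_le_one₀ h0 (h1.trans (by norm_num)) (by norm_num)
      _ ≤ _ := by simpa using h1
  have h3 := nrm_mul_le_twgt h0 cO_pos cO_add_le 0 0 (F .phi) (F .phi)
  rw [add_zero] at h3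
  rw [pow_two]
  refine h3.trans ((mul_le_mul' h2 h2).trans ?_)
  rw [← ENNReal.coe_mul, ENNReal.coe_le_coe]
  norm_num

lemma half_eq : (1 / 2 : ℝ≥0∞) = ((1 / 2 : ℝ≥0) : ℝ≥0∞) := by simp

lemma kap : BdOn cO 0 0 NullCone.kap := by
  refine ⟨2, fun ε h0 h1 F hF => ?_⟩
  rw [zpow_zero, mul_one, NullCone.kap, add_sub_assoc]
  refine nrm_inv_le h0 (by simp [hF.phi_zero, hF.Om_zero]) ?_
  have h2 : nrm (twgt cO 0 ε) (F .Om) ≤ ((1 / 4 : ℝ≥0) : ℝ≥0∞) := by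
    refine (hF.bound .Om).trans ?_
    rw [ENNReal.coe_le_coe]
    calc ε ^ (88 : ℤ) ≤ ε ^ (2 : ℤ) :=
          zpow_le_zpow_right_of_le_one₀ h0 (h1.trans (by norm_num)) (by norm_num)
      _ ≤ (1 / 2) ^ (2 : ℤ) := by
          rw [zpow_ofNat, zpow_ofNat]; gcongr
      _ = _ := by norm_num
  refine nrm_sub_le.trans ((add_le_add h2 (nrm_phi_sq_le h0 h1 hF)).trans ?_)
  rw [← ENNReal.coe_add, half_eq, ENNReal.coe_le_coe]
  norm_num

lemma kap0 : BdOn cO 0 0 fun F => (1 - F .phi ^ 2)⁻¹ := by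
  refine ⟨2, fun ε h0 h1 F hF => ?_⟩
  change nrm (twgt cO 0 ε) (1 - F .phi ^ 2)⁻¹ ≤ _
  rw [zpow_zero, mul_one, sub_eq_add_neg]
  refine nrm_inv_le h0 (by simp [hF.phi_zero]) ?_
  rw [nrm_neg]
  refine (nrm_phi_sq_le h0 h1 hF).trans ?_
  rw [half_eq, ENNReal.coe_le_coe]
  exact one_div_le_one_div_of_le (by norm_num) (by norm_num)

lemma du_phi : BdOn cO 2 (-5) fun F => du (F .phi) :=
  phi.transform 1 (-100) fun ε h0 F _ => by
    simpa using nrm_du_le' h0 (F .phi)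

lemma dv_phi : BdOn cO (-1) 97 fun F => dv (F .phi) :=
  phi.transform 2 2 fun ε h0 F _ => by
    simpa using nrm_dv_le' h0 (F .phi)

lemma du (h : BdOn cO k j g) : BdOn cI (k + 2) (j - 100) fun F => du (g F) := by
  rw [sub_eq_neg_add]
  exact h.transform 1 (-100) fun ε h0 F _ => by
    simpa using nrm_du_le h0 k (g F)

lemma dw (h : BdOn cO k j g) : BdOn cI k (j - 100) fun F => dw (g F) := by
  rw [sub_eq_neg_add]
  exact h.transform 1 (-100) fun ε h0 F _ => by
    simpa using nrm_dw_le h0 k (g F)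

lemma dv (h : BdOn cO k j g) : BdOn cE (k - 1) (j + 2) fun F => dv (g F) := by
  rw [add_comm j]
  exact h.transform (2 + k.natAbs) 2 fun ε h0 F _ => nrm_dv_le h0 k (g F)

lemma uu_mul (h : BdOn cI k j g) : BdOn cE (k - 2) (j + 100) fun F => uu * g F := by
  rw [add_comm j]
  exact h.transform 1 100 fun ε h0 F _ => by
    rw [one_mul]; exact nrm_uu_mul_le h0 k (g F)

lemma intW (h : BdOn cI k j g) : BdOn cO k (j + 100) fun F => intW (g F) := by
  rw [add_comm j]
  exact h.transform 1 100 fun ε h0 F _ => by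
    rw [one_mul]; exact nrm_intW_le h0 k (g F)

lemma intW' (h : BdOn cO 0 j g) : BdOn cD 0 (j + 100) fun F => NullCone.intW (g F) := by
  rw [add_comm j]
  exact h.transform 2 100 fun ε h0 F _ => nrm_intW_le' h0 (g F)

lemma solveU (h : BdOn cE k j g) (l : ℕ) : BdOn cO k j fun F => solveU l (g F) := by
  rw [← zero_add j]
  exact h.transform 2 0 fun ε h0 F _ => by
    rw [zpow_zero, mul_one]; exact nrm_solveU_le k l (g F)

lemma onU0 (h : BdOn c k j g) : BdOn c k j fun F => onU0 (g F) := by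
  obtain ⟨K, hK⟩ := h
  exact ⟨K, fun ε h0 h1 F hF => (nrm_onU0_le _ _).trans (hK ε h0 h1 F hF)⟩

lemma onW0 (h : BdOn c k j g) : BdOn c k j fun F => onW0 (g F) := by
  obtain ⟨K, hK⟩ := h
  exact ⟨K, fun ε h0 h1 F hF => (nrm_onW0_le _ _).trans (hK ε h0 h1 F hF)⟩

end BdOn

/-! ### Bounds for the right-hand sides by structural induction. -/

lemma PE.bdOn (a : PE) : BdOn cO a.type a.size fun F => a.eval F := by
  induction a with
  | var f => exact BdOn.unknown f
  | kap => exact BdOn.kap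
  | kap0 => exact BdOn.kap0
  | dvphi => exact BdOn.dv_phi
  | const c => exact BdOn.const c
  | add a b ha hb => exact ha.add' hb
  | sub a b ha hb => exact ha.sub' hb
  | neg a ha => exact ha.neg
  | mul a b ha hb => exact BdOn.mul cO_pos cO_add_le ha hb

lemma DE.bdOn (a : DE) : BdOn cI a.type a.size fun F => a.eval F := by
  induction a with
  | pol a => exact a.bdOn.mono cI_le_cO le_rfl le_rfl
  | du f => exact (BdOn.unknown f).du
  | dv f => exact (BdOn.unknown f).dv.mono cI_le_cE le_rfl le_rfl
  | dw f => exact (BdOn.unknown f).dw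
  | add a b ha hb => exact ha.add' hb
  | sub a b ha hb => exact ha.sub' hb
  | mul a b hb => exact BdOn.mul cI_pos cI_add_le a.bdOn hb

lemma EE.bdOn (a : EE) : BdOn cE a.type a.size fun F => a.eval F := by
  induction a with
  | pol a => exact a.bdOn.mono cE_le_cO le_rfl le_rfl
  | u a => exact a.bdOn.uu_mul
  | dv f => exact (BdOn.unknown f).dv
  | add a b ha hb => exact ha.add' hb
  | mul a b hb => exact BdOn.mul cE_pos cE_add_le a.bdOn hb

/-! ### Invariance of the ball -/

lemma Rhs.bdOn_all (f : Unknown) (hf : f ≠ .phi) :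
    BdOn cO f.type (f.size + 1) fun F => solveU (Rhs.shift f) ((Rhs.all f).eval F) :=
  ((Rhs.all f).bdOn.solveU _).mono (fun _ => le_rfl) (Rhs.type_all f) (Rhs.size_all f hf)

/-- The part of `step` which does not depend on the data is small of one order more than the ball
requires. -/
lemma bdOn_step (f : Unknown) :
    BdOn f.mult f.type (f.size + 1) fun F => step 0 0 F f := by
  have hd : ofData 0 = 0 := by ext e; simp [coeff_ofData]
  by_cases hf : f.Regular
  · have h1 : f.mult = cO := by cases f <;> first | rfl | exact absurd rfl hf.1
    simp only [step_regular _ _ _ hf]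
    rw [h1]
    exact Rhs.bdOn_all f hf.1
  · have hcase : f = .phi ∨ f = .phi_00 ∨ f = .S_0 ∨ f = .Om_00 ∨ f = .R := by
      unfold Unknown.Regular at hf; tauto
    rcases hcase with rfl | rfl | rfl | rfl | rfl
    · simp only [step, hd, zero_add]
      exact (Rhs.phi.bdOn.mono (fun _ => le_rfl) Rhs.type_phi le_rfl).intW'.mono
        (fun _ => le_rfl) le_rfl Rhs.size_phi
    · exact BdOn.du_phi
    · simp only [step, hd, zero_add]
      exact Rhs.S0.bdOn.intW.mono (fun _ => le_rfl) Rhs.type_S0 Rhs.size_S0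
    · exact (Rhs.bdOn_all .Om_00 (by simp)).add
        ((Rhs.dwOm00.bdOn.mono cI_le_cO le_rfl le_rfl).intW.onU0.mono (fun _ => le_rfl)
          Rhs.type_dwOm00 Rhs.size_dwOm00)
    · exact ((Rhs.bdOn_all .R (by simp)).add
        (Rhs.dwR.bdOn.intW.onU0.mono (fun _ => le_rfl) Rhs.type_dwR Rhs.size_dwR)).add
        (Rhs.valR.bdOn.onW0.onU0.mono (fun _ => le_rfl) Rhs.type_valR Rhs.size_valR)

/-- The contribution of the data to `step`. -/
def dataPart (ψ Ψ : ℕ → ℕ → ℂ) : Unknown → Ser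
  | .phi => ofData ψ
  | .S_0 => ofData Ψ
  | _ => 0

lemma step_eq_add (ψ Ψ : ℕ → ℕ → ℂ) (F : Unknown → Ser) (f : Unknown) :
    step ψ Ψ F f = step 0 0 F f + dataPart ψ Ψ f := by
  have hd : ofData 0 = 0 := by ext e; simp [coeff_ofData]
  cases f <;> simp [step, dataPart, hd, add_comm]

/-- The data are small of one order more than the ball requires. -/
def DataBound (ψ Ψ : ℕ → ℕ → ℂ) : Prop :=
  ∃ K ε₀ : ℝ≥0, 0 < ε₀ ∧ ∀ ε : ℝ≥0, 0 < ε → ε ≤ ε₀ →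
    -- The exponents are the sizes 95 and -12 of φ and S_0, plus one.
    nrm (twgt cD 0 ε) (ofData ψ) ≤ (K * ε ^ (96 : ℤ) : ℝ≥0) ∧
    nrm (twgt cO 4 ε) (ofData Ψ) ≤ (K * ε ^ (-11 : ℤ) : ℝ≥0)

open Classical in
instance : Fintype Unknown :=
  Fintype.ofList [.e1_01, .e2_01, .e1_11, .e2_11, .G_0100, .G_0101, .G_0111, .G_1100, .G_1101,
    .G_1111, .phi, .phi_00, .phi_01, .phi_11, .Om, .Om_00, .Om_01, .Om_11, .R, .S_0, .S_1, .S_2,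
    .S_3, .S_4] fun f => by cases f <;> simp

/-- The constants do not depend on ε, so the spare power of ε dominates them once M ε ≤ 1. -/
lemma exists_step_inBall {ψ Ψ : ℕ → ℕ → ℂ} (hψ : ψ 0 0 = 0) (hd : DataBound ψ Ψ) :
    ∃ ε : ℝ≥0, 0 < ε ∧ ε ≤ 1 / 2 ∧ ∀ F, InBall ε F → InBall ε (step ψ Ψ F) := by
  obtain ⟨K₀, ε₀, hε₀, hd⟩ := hd
  choose K hK using bdOn_step
  set M : ℝ≥0 := ∑ f, K f + K₀ + 1
  have hM : 0 < M := by positivity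
  have hKM : ∀ f, K f + K₀ ≤ M := fun f => by
    have : K f ≤ ∑ f, K f := Finset.single_le_sum (fun _ _ => zero_le) (Finset.mem_univ f)
    calc K f + K₀ ≤ ∑ f, K f + K₀ := by gcongr
      _ ≤ M := by simp [M]
  refine ⟨min (min (1 / 2) ε₀) M⁻¹, by positivity,
    (min_le_left _ _).trans (min_le_left _ _), fun F hF => ?_⟩
  set ε := min (min (1 / 2) ε₀) M⁻¹
  have h0 : 0 < ε := by positivity
  have h1 : ε ≤ 1 / 2 := (min_le_left _ _).trans (min_le_left _ _)
  have h2 : ε ≤ ε₀ := (min_le_left _ _).trans (min_le_right _ _)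
  have h3 : M * ε ≤ 1 := by
    calc M * ε ≤ M * M⁻¹ := by gcongr; exact min_le_right _ _
      _ = 1 := mul_inv_cancel₀ hM.ne'
  refine ⟨fun f => ?_, ?_, ?_⟩
  · have h4 : nrm (twgt f.mult f.type ε) (dataPart ψ Ψ f) ≤ (K₀ * ε ^ (f.size + 1) : ℝ≥0) := by
      have hd := hd ε h0 h2
      cases f
      case phi => exact hd.1
      case S_0 => exact hd.2
      all_goals
        change nrm _ 0 ≤ _
        rw [nrm_zero]; exact zero_le
    rw [step_eq_add]
    refine nrm_add_le.trans ((add_le_add (hK f ε h0 h1 F hF) h4).trans ?_)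
    rw [← ENNReal.coe_add, ENNReal.coe_le_coe, ← add_mul, zpow_add_one₀ h0.ne']
    calc (K f + K₀) * (ε ^ f.size * ε) ≤ M * (ε ^ f.size * ε) := by gcongr; exact hKM f
      _ = (M * ε) * ε ^ f.size := by ring
      _ ≤ 1 * ε ^ f.size := by gcongr
      _ = _ := one_mul _
  · rw [← coeff_zero_eq_constantCoeff_apply]
    change coeff 0 (ofData ψ + intW _) = 0
    rw [map_add, coeff_ofData, coeff_intW]
    simp [hψ]
  · rw [← coeff_zero_eq_constantCoeff_apply]
    change coeff 0 (solveU 0 _) = 0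
    simp [coeff_solveU]

lemma exists_solution_inBall {ψ Ψ : ℕ → ℕ → ℂ} (hψ : ψ 0 0 = 0) (hd : DataBound ψ Ψ) :
    ∃ ε : ℝ≥0, 0 < ε ∧ InBall ε (solution ψ Ψ) := by
  obtain ⟨ε, h0, h1, hs⟩ := exists_step_inBall hψ hd
  have hi : ∀ n, InBall ε (iter ψ Ψ n) := by
    intro n
    induction n with
    | zero => exact ⟨fun f => by change nrm _ 0 ≤ _; rw [nrm_zero]; exact zero_le,
        map_zero _, map_zero _⟩
    | succ n ih => rw [iter_succ]; exact hs _ ih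
  -- Any number above the largest rank, 22, serves here.
  have hc : ∀ f : Unknown, constantCoeff (iter ψ Ψ 100 f) = constantCoeff (solution ψ Ψ f) := by
    intro f
    rw [← coeff_zero_eq_constantCoeff_apply, ← coeff_zero_eq_constantCoeff_apply]
    refine agree_solution ψ Ψ 100 f 0 ?_
    cases f <;> simp [wdeg, Unknown.rank]
  refine ⟨ε, h0, fun f => nrm_le_of_approx fun S => ?_, ?_, ?_⟩
  · obtain ⟨n, hn⟩ : ∃ n : ℕ, ∀ e ∈ S, wdeg e < n - f.rank := by
      refine ⟨∑ e ∈ S, (wdeg e).toNat + f.rank.toNat + 1, fun e he => ?_⟩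
      have h2 : (wdeg e).toNat ≤ ∑ e ∈ S, (wdeg e).toNat :=
        Finset.single_le_sum (f := fun e => (wdeg e).toNat) (fun _ _ => Nat.zero_le _) he
      omega
    exact ⟨iter ψ Ψ n f, (hi n).bound f, fun e he => agree_solution ψ Ψ n f e (hn e he)⟩
  · rw [← hc]; exact (hi _).phi_zero
  · rw [← hc]; exact (hi _).Om_zero

/-! ### The size of the data -/

lemma nrm_ofData_lt_top {ψ : ℕ → ℕ → ℂ} {δ : ℝ≥0}
    (h : Summable fun k : ℕ × ℕ => ψ k.1 k.2 * (δ : ℂ) ^ k.1 * (δ : ℂ) ^ k.2) :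
    nrm (fun e => ((δ ^ (e 0 + e 1) : ℝ≥0) : ℝ≥0∞)) (ofData ψ) ≠ ⊤ := by
  have hinj : Function.Injective fun k : ℕ × ℕ => expo k.1 k.2 0 := by
    intro k l hkl
    have h0 := DFunLike.congr_fun hkl 0
    have h1 := DFunLike.congr_fun hkl 1
    simp [expo] at h0 h1
    exact Prod.ext h0 h1
  rw [nrm, ← hinj.tsum_eq]
  · have h1 : Summable fun k : ℕ × ℕ => ‖ψ k.1 k.2 * (δ : ℂ) ^ k.1 * (δ : ℂ) ^ k.2‖₊ :=
      NNReal.summable_coe.1 (by simpa only [coe_nnnorm] using h.norm)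
    have h2 := ENNReal.tsum_coe_ne_top_iff_summable.2 h1
    convert h2 using 4 with k
    rw [coeff_ofData, enorm_eq_nnnorm, ← ENNReal.coe_mul]
    simp [expo, pow_add, mul_assoc]
  · intro e he
    by_contra hr
    apply he
    have : e 2 ≠ 0 := fun h2 => hr ⟨(e 0, e 1), by
      have := expo_eq e
      rwa [h2] at this⟩
    simp [coeff_ofData, this]

lemma exists_nrm_ofData_lt_top {ψ : ℕ → ℕ → ℂ} {φ : ℂ × ℂ → ℂ}
    (h : ∀ᶠ z : ℂ × ℂ in 𝓝 (0, 0),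
      HasSum (fun k : ℕ × ℕ => ψ k.1 k.2 * z.1 ^ k.1 * z.2 ^ k.2) (φ z)) :
    ∃ δ : ℝ≥0, 0 < δ ∧ δ ≤ 1 ∧
      nrm (fun e => ((δ ^ (e 0 + e 1) : ℝ≥0) : ℝ≥0∞)) (ofData ψ) ≠ ⊤ := by
  -- One point (δ, δ) with δ > 0 at which the expansion converges suffices, since summability over ℂ
  -- is absolute.
  have ht : Filter.Tendsto (fun n : ℕ => (((n : ℂ) + 1)⁻¹, ((n : ℂ) + 1)⁻¹)) Filter.atTop
      (𝓝 ((0 : ℂ), (0 : ℂ))) := by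
    have h1 : Filter.Tendsto (fun n : ℕ => ((n : ℂ) + 1)⁻¹) Filter.atTop (𝓝 0) := by
      simpa using tendsto_one_div_add_atTop_nhds_zero_nat (𝕜 := ℂ)
    exact h1.prodMk_nhds h1
  obtain ⟨n, hn⟩ := (ht.eventually h).exists
  refine ⟨((n : ℝ≥0) + 1)⁻¹, by positivity, inv_le_one_of_one_le₀ (by simp),
    nrm_ofData_lt_top ?_⟩
  simpa using hn.summable

/-- Up to k exceptions every v is paired with half a u, so the large t = ε^(-2) is controlled by s
t² = ε^96; the powers of δ convert to the norm in which the data are finite. -/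
lemma pow_mul_pow_le {δ ε : ℝ≥0} (hδ : 0 < δ) (hδ1 : δ ≤ 1) (hε : 0 < ε) (hεδ : ε ≤ δ)
    {m n k : ℕ} (h : n ≤ 2 * m + k) :
    (ε ^ 100) ^ m * (ε⁻¹ ^ 2) ^ n
      ≤ (ε ^ 96 / δ ^ 3) ^ m * (ε⁻¹ ^ 2 / δ) ^ k * δ ^ (m + n) := by
  have h1 : 1 ≤ ε⁻¹ ^ 2 / δ := by
    rw [le_div_iff₀ hδ, one_mul]
    refine hδ1.trans (one_le_pow₀ ((one_le_inv₀ hε).2 (hεδ.trans hδ1)))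
  calc (ε ^ 100) ^ m * (ε⁻¹ ^ 2) ^ n = (ε ^ 100) ^ m * ((ε⁻¹ ^ 2 / δ) ^ n * δ ^ n) := by
        rw [← mul_pow, div_mul_cancel₀ _ hδ.ne']
    _ ≤ (ε ^ 100) ^ m * ((ε⁻¹ ^ 2 / δ) ^ (2 * m + k) * δ ^ n) := by gcongr
    _ = (ε ^ 100 * (ε⁻¹ ^ 2 / δ) ^ 2) ^ m * (ε⁻¹ ^ 2 / δ) ^ k * δ ^ n := by ring
    _ = (ε ^ 96 / δ ^ 3 * δ) ^ m * (ε⁻¹ ^ 2 / δ) ^ k * δ ^ n := by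
        have : ε ^ 100 * (ε⁻¹ ^ 2 / δ) ^ 2 = ε ^ 96 / δ ^ 3 * δ := by field_simp
        rw [this]
    _ = _ := by ring

lemma nrm_ofData_le {ψ : ℕ → ℕ → ℂ} {δ ε D : ℝ≥0} {c : (Fin 3 →₀ ℕ) → ℝ≥0} {k : ℕ}
    (hψ : ∀ m n, 2 * m + k < n → ψ m n = 0)
    (h : ∀ e : Fin 3 →₀ ℕ, e 2 = 0 → e 1 ≤ 2 * e 0 + k → ψ (e 0) (e 1) ≠ 0 →
      c e * ((ε ^ 100) ^ e 0 * (ε⁻¹ ^ 2) ^ e 1) ≤ D * δ ^ (e 0 + e 1)) :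
    nrm (twgt c k ε) (ofData ψ)
      ≤ D * nrm (fun e => ((δ ^ (e 0 + e 1) : ℝ≥0) : ℝ≥0∞)) (ofData ψ) := by
  refine nrm_le_of_coeff fun e => ?_
  by_cases h0 : coeff e (ofData ψ) = 0
  · simp [h0]
  rw [coeff_ofData] at h0
  have h2 : e 2 = 0 := by by_contra h2; simp [h2] at h0
  rw [if_pos h2] at h0
  have h1 : e 1 ≤ 2 * e 0 + k := by
    by_contra h1; exact h0 (hψ _ _ (not_le.1 h1))
  rw [mul_left_comm]
  refine mul_le_mul' le_rfl ?_
  rw [twgt, if_pos (by exact_mod_cast h1), ← ENNReal.coe_mul, ENNReal.coe_le_coe]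
  simpa [wgt, h2] using h e h2 h1 h0

/-- As ψ 0 0 = 0, every term of φ contains u and hence a factor ε^96. In S_0 the worst terms are
those without u, of order t^4 = ε^(-8), which is below the allowed ε^(-11). -/
lemma dataBound_of_hasSum {ψ Ψ : ℕ → ℕ → ℂ} {φ S₀ : ℂ × ℂ → ℂ}
    (hψ : ∀ m n : ℕ, 2 * m < n → ψ m n = 0) (hΨ : ∀ m n : ℕ, 2 * m + 4 < n → Ψ m n = 0)
    (hφ : ∀ᶠ z : ℂ × ℂ in 𝓝 (0, 0),
      HasSum (fun k : ℕ × ℕ => ψ k.1 k.2 * z.1 ^ k.1 * z.2 ^ k.2) (φ z))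
    (hS₀ : ∀ᶠ z : ℂ × ℂ in 𝓝 (0, 0),
      HasSum (fun k : ℕ × ℕ => Ψ k.1 k.2 * z.1 ^ k.1 * z.2 ^ k.2) (S₀ z))
    (h0 : ψ 0 0 = 0) : DataBound ψ Ψ := by
  obtain ⟨δ, hδ, hδ1, hA⟩ := exists_nrm_ofData_lt_top hφ
  obtain ⟨δ', hδ', hδ1', hB⟩ := exists_nrm_ofData_lt_top hS₀
  lift nrm (fun e => ((δ ^ (e 0 + e 1) : ℝ≥0) : ℝ≥0∞)) (ofData ψ) to ℝ≥0 using hA with A hA'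
  lift nrm (fun e => ((δ' ^ (e 0 + e 1) : ℝ≥0) : ℝ≥0∞)) (ofData Ψ) to ℝ≥0 using hB with B hB'
  refine ⟨max (2 / δ ^ 3 * A) ((δ'⁻¹) ^ 4 * B), min (1 / 2) (min δ δ'), by positivity,
    fun ε hε hle => ⟨?_, ?_⟩⟩
  · have hε2 : ε ≤ 1 / 2 := hle.trans (min_le_left _ _)
    have hεδ : ε ≤ δ := hle.trans ((min_le_right _ _).trans (min_le_left _ _))
    set x := ε ^ 96 / δ ^ 3 with hx
    have hx1 : 2 * x ≤ 1 := by
      rw [hx, mul_div_assoc', div_le_one (by positivity)]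
      calc 2 * ε ^ 96 = 2 * ε * ε ^ 3 * ε ^ 92 := by ring
        _ ≤ 2 * (1 / 2) * δ ^ 3 * 1 := by
            gcongr
            exact pow_le_one₀ zero_le (hεδ.trans hδ1)
        _ = δ ^ 3 := by ring
    have h1 := nrm_ofData_le (ψ := ψ) (δ := δ) (ε := ε) (D := 2 * x) (c := cD) (k := 0)
      (by simpa using hψ) fun e h2 h1 hne => by
        have hm : e 0 ≠ 0 := fun hm => by
          have : e 1 = 0 := by omega
          rw [hm, this] at hne
          exact hne h0
        obtain ⟨l, hl⟩ := Nat.exists_eq_succ_of_ne_zero hm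
        have h3 := pow_mul_pow_le hδ hδ1 hε hεδ h1
        rw [pow_zero, mul_one, ← hx] at h3
        -- The multiplier `cD` is absorbed by replacing x with 2 x, still at most 1.
        have h4 : ((e 0 : ℝ≥0) + 1) ≤ 2 ^ e 0 := by
          exact_mod_cast Nat.succ_le_of_lt (Nat.lt_two_pow_self (n := e 0))
        calc _ ≤ 2 ^ e 0 * (x ^ e 0 * δ ^ (e 0 + e 1)) := by
              rw [cD, h2]
              refine mul_le_mul' ?_ h3
              simpa using h4
          _ = (2 * x) ^ e 0 * δ ^ (e 0 + e 1) := by ring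
          _ ≤ (2 * x) ^ 1 * δ ^ (e 0 + e 1) := by
              gcongr ?_ * _
              exact pow_le_pow_of_le_one zero_le hx1 (by omega)
          _ = _ := by rw [pow_one]
    rw [← hA'] at h1
    refine h1.trans ?_
    rw [← ENNReal.coe_mul, ENNReal.coe_le_coe]
    calc 2 * x * A = 2 / δ ^ 3 * A * ε ^ (96 : ℤ) := by
          rw [hx, zpow_ofNat]; ring
      _ ≤ _ := by gcongr; exact le_max_left _ _
  · have hεδ : ε ≤ δ' := hle.trans ((min_le_right _ _).trans (min_le_right _ _))
    have hx1 : ε ^ 96 / δ' ^ 3 ≤ 1 := by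
      rw [div_le_one (by positivity)]
      calc ε ^ 96 = ε ^ 3 * ε ^ 93 := by ring
        _ ≤ δ' ^ 3 * 1 := by
            gcongr
            exact pow_le_one₀ zero_le (hεδ.trans hδ1')
        _ = δ' ^ 3 := by ring
    have h1 := nrm_ofData_le (ψ := Ψ) (δ := δ') (ε := ε) (D := (ε⁻¹ ^ 2 / δ') ^ 4) (c := cO)
      (k := 4) hΨ fun e h2 h1 hne => by
        rw [cO, one_mul]
        refine (pow_mul_pow_le hδ' hδ1' hε hεδ h1).trans ?_
        calc _ ≤ 1 * (ε⁻¹ ^ 2 / δ') ^ 4 * δ' ^ (e 0 + e 1) := by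
              gcongr; exact pow_le_one₀ zero_le hx1
          _ = _ := by rw [one_mul]
    rw [← hB'] at h1
    refine h1.trans ?_
    rw [← ENNReal.coe_mul, ENNReal.coe_le_coe]
    calc (ε⁻¹ ^ 2 / δ') ^ 4 * B = (δ'⁻¹) ^ 4 * B * ε ^ (-8 : ℤ) := by
          rw [show (-8 : ℤ) = -((8 : ℕ) : ℤ) by norm_num, zpow_neg, zpow_natCast]; field_simp
      _ ≤ _ := by
          refine mul_le_mul' (le_max_right _ _) ?_
          exact zpow_le_zpow_right_of_le_one₀ hε (hεδ.trans hδ1') (by norm_num)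

/-! ### Consequences of the bounds -/

lemma Unknown.one_le_mult (f : Unknown) (e : Fin 3 →₀ ℕ) : 1 ≤ f.mult e := by
  cases f <;> first | exact le_rfl | exact cO_le_cD e

lemma Unknown.type_le (f : Unknown) : f.type ≤ 4 := by
  cases f <;> decide

namespace InBall

variable {ε : ℝ≥0} {F : Unknown → Ser}

lemma coeff_le (h : InBall ε F) (f : Unknown) (e : Fin 3 →₀ ℕ) :
    ‖coeff e (F f)‖ₑ * twgt f.mult f.type ε e ≤ (ε ^ f.size : ℝ≥0) :=
  (ENNReal.le_tsum e).trans (h.bound f)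

lemma coef_eq_zero (h : InBall ε F) (f : Unknown) {m n p : ℕ} (hn : 2 * (m : ℤ) + f.type < n) :
    coef (F f) m n p = 0 := by
  have h1 := h.coeff_le f (expo m n p)
  rw [twgt, if_neg (by simpa [expo] using hn)] at h1
  by_contra h0
  rw [ENNReal.mul_top (by simpa [coef] using h0)] at h1
  simp at h1

lemma norm_coef_le (h0 : 0 < ε) (h : InBall ε F) (f : Unknown) (m n p : ℕ) :
    ‖coef (F f) m n p‖
      ≤ (ε : ℝ) ^ f.size * (m + p).choose m * (((ε : ℝ) ^ 100)⁻¹ ^ (m + p) * ((ε : ℝ) ^ 2) ^ n) := by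
  have hε : (0 : ℝ) < ε := h0
  by_cases hn : 2 * (m : ℤ) + f.type < n
  · rw [h.coef_eq_zero f hn, norm_zero]; positivity
  have h1 := h.coeff_le f (expo m n p)
  rw [twgt, if_pos (by simpa [expo] using hn), enorm_eq_nnnorm, ← ENNReal.coe_mul,
    ENNReal.coe_le_coe] at h1
  have h2 : ‖coef (F f) m n p‖₊ * wgt ε (expo m n p) ≤ ε ^ f.size :=
    (mul_le_mul' le_rfl (le_mul_of_one_le_left zero_le (f.one_le_mult _))).trans h1
  have h3 : (wgt ε (expo m n p) : ℝ)
      = ((ε : ℝ) ^ 100) ^ (m + p) * ((ε : ℝ)⁻¹ ^ 2) ^ n / (m + p).choose m := by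
    simp [wgt, expo]
  have h4 : ‖coef (F f) m n p‖ * wgt ε (expo m n p) ≤ (ε : ℝ) ^ f.size := by exact_mod_cast h2
  have hc : 0 < (m + p).choose m := Nat.choose_pos (by omega)
  have h5 : (0 : ℝ) < wgt ε (expo m n p) := wgt_pos h0 _
  rw [← le_div_iff₀ h5, h3] at h4
  refine h4.trans_eq ?_
  rw [inv_pow, inv_pow, inv_pow]
  field_simp

/-- φ_11 has type 0, so on U_0 it is independent of v. -/
lemma eqOnU0_dv_phi_11 (h : InBall ε F) : EqOnU0 (dv (F .phi_11)) 0 := fun n p => by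
  have h1 := h.coef_eq_zero .phi_11 (m := 0) (n := n + 1) (p := p) (by simp [Unknown.type])
  have h2 : expo 0 (n + 1) p = expo 0 n p + single 1 1 := by
    simp only [expo, single_add]; abel
  rw [coef, h2] at h1
  rw [coef, coeff_dv, h1, zero_mul]; simp [coef]

end InBall

/-! ### Derivative estimates and domain of convergence. -/

lemma coeff_iterate_pderiv (i : Fin 3) (m : ℕ) (f : Ser) (e : Fin 3 →₀ ℕ) :
    coeff e ((pderiv ℂ i)^[m] f) * (e i).factorial
      = coeff (e + single i m) f * (e i + m).factorial := by
  induction m generalizing e with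
  | zero => simp
  | succ m ih =>
    have h := ih (e + single i 1)
    rw [Finsupp.add_apply, single_eq_same, Nat.factorial_succ, add_assoc, ← single_add] at h
    rw [Function.iterate_succ_apply', coeff_pderiv, add_comm m 1, ← add_assoc (e i), ← h]
    push_cast; ring

lemma derivAt_eq (f : Ser) (m n p : ℕ) :
    derivAt f m n p = m.factorial * n.factorial * p.factorial * coef f m n p := by
  have hu := coeff_iterate_pderiv 0 m (dv^[n] (dw^[p] f)) 0
  have hv := coeff_iterate_pderiv 1 n (dw^[p] f) (single 0 m)
  have hw := coeff_iterate_pderiv 2 p f (single 0 m + single 1 n)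
  simp at hu hv hw
  change coeff 0 (du^[m] _) = _ at hu
  change coeff _ (dv^[n] _) = _ at hv
  change coeff _ (dw^[p] _) = _ at hw
  rw [derivAt, ← coeff_zero_eq_constantCoeff_apply, hu, hv, hw, coef, expo]
  ring

lemma add_one_sq_le (m : ℕ) : ((m : ℝ) + 1) ^ 2 ≤ 6 * 2 ^ m := by
  -- The lower-order terms make the induction close; at m = 0 there is equality.
  have h : ((m : ℝ) + 1) ^ 2 + 2 * (m + 1) + 3 ≤ 6 * 2 ^ m := by
    induction m with
    | zero => norm_num
    | succ m ih =>
      rw [pow_succ (2 : ℝ)]; push_cast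
      nlinarith [sq_nonneg ((m : ℝ) + 1)]
  linarith [(Nat.cast_nonneg m : (0 : ℝ) ≤ m)]

/-- The binomial of the weight turns m! p! into (m + p)!. The factor 2 in r and in ρ pays for the
three squared denominators, each at a cost of 6, whence 216 = 6³. -/
lemma InBall.norm_derivAt_le {ε : ℝ≥0} {F : Unknown → Ser} (h0 : 0 < ε) (h : InBall ε F)
    {r ρ : ℝ} (hr : r = 2 * ((ε : ℝ) ^ 100)⁻¹) (hρ : ρ = 2 * (ε : ℝ) ^ 2)
    (f : Unknown) (m n p : ℕ) :
    ‖derivAt (F f) m n p‖ ≤ 216 * (ε : ℝ) ^ f.size * r ^ (-f.q) *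
      (r ^ ((m : ℤ) + (p : ℤ) + f.q) * ((m + p).factorial : ℝ) * ρ ^ n * (n.factorial : ℝ))
        / (((m : ℝ) + 1) ^ 2 * ((n : ℝ) + 1) ^ 2 * ((p : ℝ) + 1) ^ 2) := by
  have hε : (0 : ℝ) < ε := h0
  have hr0 : 0 < r := by rw [hr]; positivity
  have h1 : r ^ (-f.q) * r ^ ((m : ℤ) + (p : ℤ) + f.q) = r ^ (m + p) := by
    rw [← zpow_add₀ hr0.ne', ← zpow_natCast]; congr 1; push_cast; ring
  have hf : ((m + p).choose m : ℝ) * m.factorial * p.factorial = (m + p).factorial := by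
    rw [Nat.choose_symm_add]
    exact_mod_cast Nat.add_choose_mul_factorial_mul_factorial m p
  set A : ℝ := (ε : ℝ) ^ f.size * (((ε : ℝ) ^ 100)⁻¹ ^ (m + p) * ((ε : ℝ) ^ 2) ^ n)
    * (m + p).factorial * n.factorial with hA
  have hA0 : 0 < A := by positivity
  have h2 : ‖derivAt (F f) m n p‖ ≤ A := by
    rw [derivAt_eq, norm_mul, norm_mul, norm_mul]
    simp only [Complex.norm_natCast]
    calc _ ≤ (m.factorial : ℝ) * n.factorial * p.factorial * ((ε : ℝ) ^ f.size * (m + p).choose m *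
          (((ε : ℝ) ^ 100)⁻¹ ^ (m + p) * ((ε : ℝ) ^ 2) ^ n)) := by
          gcongr; exact h.norm_coef_le h0 f m n p
      _ = A := by rw [hA, ← hf]; ring
  have h3 : 216 * (ε : ℝ) ^ f.size * r ^ (-f.q) *
      (r ^ ((m : ℤ) + (p : ℤ) + f.q) * ((m + p).factorial : ℝ) * ρ ^ n * (n.factorial : ℝ))
      = A * ((6 * 2 ^ m) * (6 * 2 ^ n) * (6 * 2 ^ p)) := by
    calc _ = 216 * (ε : ℝ) ^ f.size * (r ^ (-f.q) * r ^ ((m : ℤ) + (p : ℤ) + f.q)) *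
          ((m + p).factorial : ℝ) * ρ ^ n * (n.factorial : ℝ) := by ring
      _ = _ := by rw [h1, hr, hρ, hA]; ring
  rw [h3, le_div_iff₀ (by positivity)]
  gcongr
  all_goals exact add_one_sq_le _

/-- Since n ≤ 2m + 4, the factor (ρ|v|)^n is at most α^(-(2m+4)), which moves α^(-2) onto each power
of u. The binomial is at most 2^(m+p), absorbed in r, and the 2 in ρ leaves (1/2)^n, so a product of
three geometric series dominates. -/
lemma InBall.summable {ε : ℝ≥0} {F : Unknown → Ser} (h0 : 0 < ε) (h : InBall ε F)
    {r ρ : ℝ} (hr : r = 2 * ((ε : ℝ) ^ 100)⁻¹) (hρ : ρ = 2 * (ε : ℝ) ^ 2)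
    {α : ℝ} (hα : 0 < α) (hα1 : α ≤ 1) {u v w : ℂ}
    (hv : ‖v‖ < 1 / (α * ρ)) (huw : ‖u‖ + ‖w‖ < α ^ 2 / r) (f : Unknown) :
    Summable fun k : ℕ × ℕ × ℕ =>
      ‖coef (F f) k.1 k.2.1 k.2.2 * u ^ k.1 * v ^ k.2.1 * w ^ k.2.2‖ := by
  have hε : (0 : ℝ) < ε := h0
  have hr0 : 0 < r := by rw [hr]; positivity
  have hρ0 : 0 < ρ := by rw [hρ]; positivity
  have hu1 : r * ‖u‖ < α ^ 2 := by
    rw [mul_comm, ← lt_div_iff₀ hr0]; linarith [norm_nonneg w]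
  have hw1 : r * ‖w‖ < 1 := by
    have : r * ‖w‖ < α ^ 2 := by
      rw [mul_comm, ← lt_div_iff₀ hr0]; linarith [norm_nonneg u]
    exact this.trans_le (pow_le_one₀ hα.le hα1)
  have hv1 : ρ * ‖v‖ ≤ α⁻¹ := by
    rw [lt_div_iff₀ (by positivity)] at hv
    rw [inv_eq_one_div, le_div_iff₀ hα]; linarith
  have hy : 1 ≤ α⁻¹ := (one_le_inv₀ hα).2 hα1
  have hX : r * ‖u‖ * α⁻¹ ^ 2 < 1 := by
    rw [inv_pow, mul_inv_lt_iff₀ (by positivity)]; linarith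
  have hs : Summable fun k : ℕ × ℕ × ℕ => (ε : ℝ) ^ f.size * α⁻¹ ^ 4 *
      ((r * ‖u‖ * α⁻¹ ^ 2) ^ k.1 * ((1 / 2) ^ k.2.1 * (r * ‖w‖) ^ k.2.2)) := by
    refine Summable.mul_left _ ?_
    refine (summable_geometric_of_lt_one (by positivity) hX).mul_of_nonneg
      (g := fun l : ℕ × ℕ => (1 / 2 : ℝ) ^ l.1 * (r * ‖w‖) ^ l.2) ?_
      (fun _ => by positivity) (fun _ => by positivity)
    exact (summable_geometric_of_lt_one (by positivity) (by norm_num)).mul_of_nonneg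
      (summable_geometric_of_lt_one (by positivity) hw1) (fun _ => by positivity)
      (fun _ => by positivity)
  refine hs.of_nonneg_of_le (fun _ => norm_nonneg _) ?_
  rintro ⟨m, n, p⟩
  dsimp only
  by_cases hn : 2 * (m : ℤ) + f.type < n
  · rw [h.coef_eq_zero f hn]; simp; positivity
  have hn' : n ≤ 2 * m + 4 := by have := f.type_le; omega
  have hc : ((m + p).choose m : ℝ) ≤ 2 ^ (m + p) := by exact_mod_cast Nat.choose_le_two_pow _ _
  rw [norm_mul, norm_mul, norm_mul, norm_pow, norm_pow, norm_pow]
  calc _ ≤ (ε : ℝ) ^ f.size * 2 ^ (m + p) * (((ε : ℝ) ^ 100)⁻¹ ^ (m + p) * ((ε : ℝ) ^ 2) ^ n)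
        * ‖u‖ ^ m * ‖v‖ ^ n * ‖w‖ ^ p := by
        gcongr
        refine (h.norm_coef_le h0 f m n p).trans ?_
        gcongr
    _ = (ε : ℝ) ^ f.size * ((r * ‖u‖) ^ m * ((1 / 2) ^ n * (ρ * ‖v‖) ^ n * (r * ‖w‖) ^ p)) := by
        have : ((ε : ℝ) ^ 2) ^ n = (1 / 2) ^ n * ρ ^ n := by
          rw [hρ, ← mul_pow]; congr 1; ring
        rw [this, hr]; ring
    _ ≤ (ε : ℝ) ^ f.size * ((r * ‖u‖) ^ m *
        ((1 / 2) ^ n * α⁻¹ ^ (2 * m + 4) * (r * ‖w‖) ^ p)) := by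
        gcongr
        exact (pow_le_pow_left₀ (by positivity) hv1 n).trans (pow_le_pow_right₀ hy hn')
    _ = _ := by ring

lemma coeff_zero_eq_of_hasSum {ψ : ℕ → ℕ → ℂ} {φ : ℂ × ℂ → ℂ}
    (h : ∀ᶠ z : ℂ × ℂ in 𝓝 (0, 0),
      HasSum (fun k : ℕ × ℕ => ψ k.1 k.2 * z.1 ^ k.1 * z.2 ^ k.2) (φ z)) :
    ψ 0 0 = φ (0, 0) := by
  have h1 := hasSum_single (f := fun k : ℕ × ℕ => ψ k.1 k.2 * (0 : ℂ) ^ k.1 * (0 : ℂ) ^ k.2) (0, 0)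
    (by
      rintro ⟨m, n⟩ hmn
      rcases Nat.eq_zero_or_pos m with rfl | hm
      · rcases Nat.eq_zero_or_pos n with rfl | hn
        · exact absurd rfl hmn
        · simp [hn.ne']
      · simp [hm.ne'])
  simpa using h1.unique h.self_of_nhds

end NullCone

end

theorem mainTheorem5
    (U : Set (ℂ × ℂ)) (hU : IsOpen U) (hO : ((0, 0) : ℂ × ℂ) ∈ U)
    (φ S₀ : ℂ × ℂ → ℂ) (hφ : DifferentiableOn ℂ φ U) (hS₀ : DifferentiableOn ℂ S₀ U)
    (ψ Ψ : ℕ → ℕ → ℂ)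
    (hψ : ∀ m n : ℕ, 2 * m < n → ψ m n = 0)
    (hΨ : ∀ m n : ℕ, 2 * m + 4 < n → Ψ m n = 0)
    (hφ_exp : ∀ᶠ z : ℂ × ℂ in 𝓝 (0, 0),
      HasSum (fun k : ℕ × ℕ => ψ k.1 k.2 * z.1 ^ k.1 * z.2 ^ k.2) (φ z))
    (hS₀_exp : ∀ᶠ z : ℂ × ℂ in 𝓝 (0, 0),
      HasSum (fun k : ℕ × ℕ => Ψ k.1 k.2 * z.1 ^ k.1 * z.2 ^ k.2) (S₀ z))
    (hφ_zero : φ (0, 0) = 0)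
    (cφ rφ ρφ cS rS ρS : ℝ) (hcφ : 0 < cφ) (hrφ : 0 < rφ) (hρφ : 0 < ρφ) (hρφ' : ρφ < 1 / 3)
    (hcS : 0 < cS) (hrS : 0 < rS) (hρS : 0 < ρS) (hρS' : ρS < 1 / 3)
    (hφ_est : ∀ m n : ℕ, n ≤ 2 * m →
      ‖NullCone.derivAt2 φ m n‖ ≤
        cφ * (rφ ^ ((m : ℤ) - 1) * (m.factorial : ℝ) * ρφ ^ n * (n.factorial : ℝ))
          / (((m : ℝ) + 1) ^ 2 * ((n : ℝ) + 1) ^ 2))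
    (hS₀_est : ∀ m n : ℕ, n ≤ 2 * m + 4 →
      ‖NullCone.derivAt2 S₀ m n‖ ≤
        cS * (rS ^ m * (m.factorial : ℝ) * ρS ^ n * (n.factorial : ℝ))
          / (((m : ℝ) + 1) ^ 2 * ((n : ℝ) + 1) ^ 2)) :
    ∃ F : NullCone.Unknown → NullCone.Ser,
      NullCone.IsFormalExpansion ψ Ψ F ∧
      (∀ G : NullCone.Unknown → NullCone.Ser, NullCone.IsFormalExpansion ψ Ψ G → G = F) ∧
      ∃ (r ρ : ℝ) (c : NullCone.Unknown → ℝ), 0 < r ∧ 0 < ρ ∧ (∀ f, 0 < c f) ∧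
        (∀ (f : NullCone.Unknown) (m n p : ℕ),
          ‖NullCone.derivAt (F f) m n p‖ ≤
            c f * (r ^ ((m : ℤ) + (p : ℤ) + f.q) * ((m + p).factorial : ℝ)
                * ρ ^ n * (n.factorial : ℝ))
              / (((m : ℝ) + 1) ^ 2 * ((n : ℝ) + 1) ^ 2 * ((p : ℝ) + 1) ^ 2)) ∧
        (∀ α : ℝ, 0 < α → α ≤ 1 → ∀ u v w : ℂ,
          ‖v‖ < 1 / (α * ρ) → ‖u‖ + ‖w‖ < α ^ 2 / r →
          ∀ f : NullCone.Unknown,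
            Summable (fun k : ℕ × ℕ × ℕ =>
              ‖NullCone.coef (F f) k.1 k.2.1 k.2.2 * u ^ k.1 * v ^ k.2.1 * w ^ k.2.2‖)) := by
  have h00 : ψ 0 0 = 0 := (NullCone.coeff_zero_eq_of_hasSum hφ_exp).trans hφ_zero
  obtain ⟨ε, hε, hF⟩ := NullCone.exists_solution_inBall h00
    (NullCone.dataBound_of_hasSum hψ hΨ hφ_exp hS₀_exp h00)
  have hε' : (0 : ℝ) < ε := hε
  have hs := NullCone.step_solution ψ Ψ
  exact ⟨NullCone.solution ψ Ψ, NullCone.isFormalExpansion_of_step hs hF.eqOnU0_dv_phi_11,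
    fun G hG => NullCone.step_fixed_unique hG.step_eq hs,
    2 * ((ε : ℝ) ^ 100)⁻¹, 2 * (ε : ℝ) ^ 2,
    fun f => 216 * (ε : ℝ) ^ f.size * (2 * ((ε : ℝ) ^ 100)⁻¹) ^ (-f.q),
    by positivity, by positivity, fun f => by positivity,
    fun f m n p => hF.norm_derivAt_le hε rfl rfl f m n p,
    fun α hα hα1 u v w hv huw f => hF.summable hε rfl rfl hα hα1 hv huw f⟩
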